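/- Let $n\ge 2$ be an integer. The Jorge–Meeks type maximal surface $f_n$ in Lorentz–Minkowski space $\mathbf R^3_1=(\mathbf R^3;t,x,y)$ is the map $$f_n(z)=\operatorname{Re}\int_0^z\bigl(-2g,\;1+g^2,\;\mathrm i(1-g^2)\bigr)\,\omega,\qquad g=z^{n-1},\quad \omega=\frac{\mathrm i\,dz}{(z^n-1)^2},$$ considered on the set of all $z\in\mathbf C$ with $|z|\le 1$ and $z^n\ne 1$. Let $$\Omega_n=\Bigl\{(u,\theta)\in\mathbf R\times\mathbf R/2\pi\mathbf Z\;:\;u>\max_{0\le j<n}\cos\bigl(\theta-\tfrac{2\pi j}{n}\bigr)\Bigr\}\cup\{p_\infty\},$$ where $p_\infty$ is a point added at $u=+\infty$, and let $\iota(re^{\mathrm i\theta})=\bigl(\tfrac{r+r^{-1}}2,\theta\bigr)$ for $r>0$, $\iota(0)=p_\infty$. Regard $\Omega_n$ as a real analytic $2$-manifold, with local coordinates $(u,\theta)$ away from $p_\infty$ and with the local coordinate $z$, $|z|<1$, around $p_\infty=\iota(0)$ given by $\iota$. Theorem. There is exactly one real analytic map $\tilde f_n:\Omega_n\to\mathbf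 R^3_1$ with $\tilde f_n(\iota(z))=f_n(z)$ for all $z$ with $|z|\le1$, $z^n\neq1$ (the analytic extension of $f_n$), and $\tilde f_n$ is a proper embedding: it is an immersion, a homeomorphism onto its image, and a proper map. -/

import Mathlib

noncomputable section

namespace JorgeMeeks

open Complex OnePoint

/-- The underlying analytic manifold of Lorentz-Minkowski 3-space, with coordinates
`(t, x, y) = (v 0, v 1, v 2)`.  The metric `-dt² + dx² + dy²` plays no role in the notion of a
proper embedding. -/
abbrev MinkowskiSpace : Type := Fin 3 → ℝ

/-- The integrand `(-2g, 1 + g², i(1 - g²)) ω` of the Weierstrass-type representation of maximal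
surfaces, for `ω = w(z) dz`. -/
def weierstrassIntegrand (g w : ℂ → ℂ) (z : ℂ) : Fin 3 → ℂ :=
  ![-2 * g z * w z, (1 + g z ^ 2) * w z, I * (1 - g z ^ 2) * w z]

/-- The maximal surface `Re ∫₀ᶻ (-2g, 1 + g², i(1 - g²)) ω`, the integral being taken along the
straight segment from `0` to `z`. -/
def maximalSurface (g w : ℂ → ℂ) (z : ℂ) : MinkowskiSpace := fun k =>
  (∫ t in (0 : ℝ)..1, weierstrassIntegrand g w (t * z) k * z).re

/-- The Jorge-Meeks type maximal surface `f_n`, with `g = z ^ (n - 1)` and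
`ω = i dz / (z ^ n - 1)²`, on the closed unit disc minus the `n`-th roots of unity.  This set is
star-shaped about `0` and the integrand is holomorphic near it, so that integration along
segments is integration along any path in it. -/
def jorgeMeeksSurface (n : ℕ) : ℂ → MinkowskiSpace :=
  maximalSurface (fun z => z ^ (n - 1)) (fun z => I / (z ^ n - 1) ^ 2)

/-- The cylinder `ℝ × ℝ/2πℤ` with a point `∞ = p_∞` added. -/
abbrev Cylinder : Type := OnePoint (ℝ × Real.Angle)

/-- The point of the cylinder with coordinates `(u, θ)`. -/
def polarPoint (p : ℝ × ℝ) : Cylinder := ((p.1, (p.2 : Real.Angle)) : ℝ × Real.Angle)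

/-- The map `ι : r e^{iθ} ↦ ((r + r⁻¹) / 2, θ)`, `0 ↦ p_∞`. -/
def iota (z : ℂ) : Cylinder :=
  if z = 0 then ∞ else polarPoint ((‖z‖ + ‖z‖⁻¹) / 2, z.arg)

/-- The domain `Ω_n = {(u, θ) : u > max_j cos (θ - 2πj/n)} ∪ {p_∞}`, with the subspace topology.
For `n ≥ 2` it lies in `{u > 0} ∪ {p_∞}`, so that its subsets `{u > M} ∪ {p_∞}` form a basis of
neighbourhoods of `p_∞`. -/
def Omega (n : ℕ) : Set Cylinder :=
  insert ∞ ((fun q : ℝ × Real.Angle => (q : Cylinder)) ''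
    {q | ∀ j < n, (q.2 - ((2 * Real.pi * j / n : ℝ) : Real.Angle)).cos < q.1})

theorem polarPoint_mem_Omega {n : ℕ} {p : ℝ × ℝ} :
    polarPoint p ∈ Omega n ↔ ∀ j < n, Real.cos (p.2 - 2 * Real.pi * j / n) < p.1 := by
  simp [polarPoint, Omega, ← Real.Angle.coe_sub, Real.Angle.cos_coe]

theorem iota_mem_Omega {n : ℕ} {z : ℂ} (hz : ‖z‖ ≤ 1) (hzn : z ^ n ≠ 1) :
    iota z ∈ Omega n := by
  unfold iota
  split_ifs with h0
  · exact Set.mem_insert _ _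
  · rw [polarPoint_mem_Omega]
    intro j hj
    have hr : 0 < ‖z‖ := norm_pos_iff.mpr h0
    have hmul : ‖z‖ * ‖z‖⁻¹ = 1 := mul_inv_cancel₀ hr.ne'
    have hri : 0 < ‖z‖⁻¹ := inv_pos.mpr hr
    have h1 : 1 ≤ (‖z‖ + ‖z‖⁻¹) / 2 := by
      nlinarith [sq_nonneg (‖z‖ - ‖z‖⁻¹), sq_nonneg (‖z‖ + ‖z‖⁻¹ - 2)]
    refine lt_of_le_of_ne ((Real.cos_le_one _).trans h1) fun heq => hzn ?_
    simp only at heq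
    have hu : (‖z‖ + ‖z‖⁻¹) / 2 = 1 := le_antisymm (heq.symm.trans_le (Real.cos_le_one _)) h1
    have hnorm : ‖z‖ = 1 := by
      have h2 : (‖z‖ - 1) ^ 2 = 0 := by
        have : ‖z‖⁻¹ = 2 - ‖z‖ := by linarith
        rw [this] at hmul
        nlinarith
      have := pow_eq_zero_iff (two_ne_zero) |>.mp h2
      linarith
    rw [hu] at heq
    obtain ⟨k, hk⟩ := (Real.cos_eq_one_iff _).mp heq
    have hn : (n : ℂ) ≠ 0 := by
      have : n ≠ 0 := by omega
      exact_mod_cast this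
    have hn' : (n : ℝ) ≠ 0 := by exact_mod_cast hn
    have harg : (n : ℝ) * z.arg = ((k * n + j : ℤ) : ℝ) * (2 * Real.pi) := by
      have : z.arg = k * (2 * Real.pi) + 2 * Real.pi * j / n := by
        linarith
      rw [this]
      push_cast
      field_simp
    have hz' : z = exp (z.arg * I) := by
      conv_lhs => rw [← norm_mul_exp_arg_mul_I z, hnorm]
      simp
    rw [hz', ← exp_nat_mul, exp_eq_one_iff]
    refine ⟨k * n + j, ?_⟩
    have := congrArg (fun x : ℝ => (x : ℂ)) harg
    push_cast at this ⊢
    linear_combination I * this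

open Classical in
/-- A map on `Ω_n`, extended by `0` to the rest of the cylinder; used only to write the map in
local coordinates. -/
def extendByZero {n : ℕ} (f : Omega n → MinkowskiSpace) (p : Cylinder) : MinkowskiSpace :=
  if h : p ∈ Omega n then f ⟨p, h⟩ else 0

/-- A map on `Ω_n` in the local coordinates `(u, θ)`, which cover `Ω_n \ {p_∞}`. -/
def inPolar {n : ℕ} (f : Omega n → MinkowskiSpace) (p : ℝ × ℝ) : MinkowskiSpace :=
  extendByZero f (polarPoint p)

/-- A map on `Ω_n` in the local coordinate `z`, `|z| < 1`, which covers `{u > 1} ∪ {p_∞}`. -/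
def inDisc {n : ℕ} (f : Omega n → MinkowskiSpace) (z : ℂ) : MinkowskiSpace :=
  extendByZero f (iota z)

/-- Real analyticity for the analytic structure of `Ω_n` given by the coordinates `(u, θ)` away
from `p_∞` and by the coordinate `z` on the open unit disc around `p_∞ = ι(0)`. -/
def IsAnalytic {n : ℕ} (f : Omega n → MinkowskiSpace) : Prop :=
  AnalyticOnNhd ℝ (inPolar f) {p | polarPoint p ∈ Omega n} ∧
  AnalyticOnNhd ℝ (inDisc f) (Metric.ball 0 1)

/-- The differential is injective at every point of `Ω_n`. -/
def IsImmersive {n : ℕ} (f : Omega n → MinkowskiSpace) : Prop :=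
  (∀ p, polarPoint p ∈ Omega n → Function.Injective (fderiv ℝ (inPolar f) p)) ∧
  (∀ z ∈ Metric.ball (0 : ℂ) 1, Function.Injective (fderiv ℝ (inDisc f) z))

/-- `f` is an analytic extension to `Ω_n` of `f_n ∘ ι⁻¹`. -/
def IsAnalyticExtension {n : ℕ} (f : Omega n → MinkowskiSpace) : Prop :=
  IsAnalytic f ∧
  ∀ (z : ℂ) (hz : ‖z‖ ≤ 1) (hzn : z ^ n ≠ 1),
    f ⟨iota z, iota_mem_Omega hz hzn⟩ = jorgeMeeksSurface n z

/-- A proper embedding: an immersion which is a homeomorphism onto its image (in particular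
injective) and a proper map. -/
def IsProperEmbedding {n : ℕ} (f : Omega n → MinkowskiSpace) : Prop :=
  IsImmersive f ∧ Topology.IsEmbedding f ∧ IsProperMap f

end JorgeMeeks

end

noncomputable section

namespace JorgeMeeks

open Complex OnePoint Finset

/-! The Weierstrass integrals are elementary. Partial fractions over the roots of unity ζ_j write n²
times each coordinate as a sum of multiples of Im (ζ_j/(z - ζ_j)) and log |z - ζ_j|. Since |re^{iθ}
- ζ_j|² = 2r(u - cos(θ - 2πj/n)), these are functions of (u, θ), the stray log 2r dropping out
because its coefficients sum to 0. The resulting `height` and `planar` are analytic on all of Ω_n,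
which gives the extension. Uniqueness is the identity theorem on the connected (u, θ)-domain,
starting from u > 1.

The geometry rests on two closed formulas. With N = T_n(u) - cos nθ, `height` equals n sin nθ / N,
and the Jacobian of (`height`, `planar` ψ) in (u, θ) is -n⁴ U_{n-2}(u) sin((n-1)θ + ψ) / N². Both
are computed in the disc for u = cosh s and carried to u ≤ 1 by analyticity. Since u > cos(π/n) on
the domain, N and U_{n-2}(u) are positive. The Jacobians for ψ = 0 and ψ = -π/2 never vanish
together, so the map is an immersion in the polar chart; in the disc |g| < 1 gives it directly.

Injectivity: `height` has the sign of sin nθ. On the sector 0 < θ < π/n each level set of `height`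
is a graph u = u(θ), along which `planar` 0 is strictly increasing, so the map is injective there.
Different sectors of positive height are rotations of this one. They are separated by the
inequalities `planar` (π/n) ≤ `height` < `planar` 0, which confine the argument of the horizontal
position, for given height and horizontal radius, to a half-open interval of length π/n, whereas the
rotations shift it by multiples of 2π/n. Each inequality is read off at one end of the level curve.
Negative height follows by reflection. At height 0 the points lie on rays θ = const, whose images
are radial segments traversed monotonically.

Properness: at a boundary point of Ω_n with angle θ₀, `planar` (θ₀ - π/2) tends to +∞. Preimages of
compact sets are therefore closed in the compact space `Cylinder`, and a continuous injective proper
map is a closed embedding. -/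

/-! ### Roots of unity and partial fractions -/

/-- The angle `2πj/n` of the `j`-th end. -/
def node (n j : ℕ) : ℝ := 2 * Real.pi * j / n

/-- The `n`-th root of unity with angle `node n j`. -/
def zeta (n j : ℕ) : ℂ := exp (node n j * I)

theorem norm_zeta (n j : ℕ) : ‖zeta n j‖ = 1 := by
  simp [zeta, norm_exp_ofReal_mul_I]

theorem zeta_ne_zero (n j : ℕ) : zeta n j ≠ 0 := exp_ne_zero _

theorem zeta_eq_pow (n j : ℕ) : zeta n j = exp (2 * Real.pi * I / n) ^ j := by
  rw [zeta, ← exp_nat_mul, node]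
  congr 1
  push_cast
  ring

theorem zeta_pow {n : ℕ} (hn : n ≠ 0) (j : ℕ) : zeta n j ^ n = 1 := by
  rw [zeta_eq_pow, pow_right_comm, (isPrimitiveRoot_exp n hn).pow_eq_one, one_pow]

theorem sub_zeta_ne_zero {n : ℕ} (hn : n ≠ 0) {z : ℂ} (hz : z ^ n ≠ 1) (j : ℕ) :
    z - zeta n j ≠ 0 := fun h => hz (by rw [sub_eq_zero.mp h, zeta_pow hn])

theorem sum_zeta_pow {n : ℕ} (hn : n ≠ 0) (m : ℕ) :
    ∑ j ∈ range n, zeta n j ^ m = if n ∣ m then (n : ℂ) else 0 := by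
  have hp := isPrimitiveRoot_exp n hn
  have h1 : ∀ j, zeta n j ^ m = (exp (2 * Real.pi * I / n) ^ m) ^ j := fun j => by
    rw [zeta_eq_pow, pow_right_comm]
  simp_rw [h1]
  split_ifs with h
  · rw [(hp.pow_eq_one_iff_dvd m).mpr h]
    simp
  · have hne : exp (2 * Real.pi * I / n) ^ m ≠ 1 := fun h' => h ((hp.pow_eq_one_iff_dvd m).mp h')
    rw [geom_sum_eq hne, pow_right_comm, hp.pow_eq_one]
    simp

/-- Multiply by z^n - 1 = z^n - ζ^n and expand the quotient by z - ζ as a geometric sum.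
Orthogonality of powers of roots of unity leaves only the term z^k. -/
theorem sum_zeta_pow_div_sub {n k : ℕ} (hk : k < n) {z : ℂ} (hz : z ^ n ≠ 1) :
    ∑ j ∈ range n, zeta n j ^ (k + 1) / (z - zeta n j) = n * z ^ k / (z ^ n - 1) := by
  have hn : n ≠ 0 := by omega
  have hz' : z ^ n - 1 ≠ 0 := sub_ne_zero.mpr hz
  rw [eq_div_iff hz', sum_mul]
  have h1 : ∀ j ∈ range n, zeta n j ^ (k + 1) / (z - zeta n j) * (z ^ n - 1) =
      ∑ i ∈ range n, z ^ i * zeta n j ^ (k + 1 + (n - 1 - i)) := fun j _ => by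
    have h2 := (Commute.all z (zeta n j)).geom_sum₂_mul n
    rw [zeta_pow hn] at h2
    rw [← h2]
    have := sub_zeta_ne_zero hn hz j
    field_simp
    rw [mul_sum]
    refine sum_congr rfl fun i _ => ?_
    rw [pow_add]
    ring
  rw [sum_congr rfl h1, sum_comm]
  simp_rw [← mul_sum, sum_zeta_pow hn]
  rw [sum_eq_single k]
  · rw [if_pos (by rw [show k + 1 + (n - 1 - k) = n by omega])]
    ring
  · intro i hi hik
    rw [if_neg, mul_zero]
    have hi' := mem_range.mp hi
    -- The exponent is n + k - i, strictly between 0 and 2n, so divisibility by n would force i = k.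
    rintro ⟨c, hc⟩
    rcases c with _ | _ | c
    · omega
    · simp at hc; omega
    · have : n * (c + 1 + 1) = n * c + 2 * n := by ring
      have : 0 ≤ n * c := Nat.zero_le _
      omega
  · intro h; exact absurd (mem_range.mpr hk) h

/-- Minus the z-derivative of `sum_zeta_pow_div_sub`. For k = 0 the truncated exponent k - 1 is
harmless, as its coefficient k vanishes. -/
theorem sum_zeta_pow_div_sub_sq {n k : ℕ} (hk : k < n) {z : ℂ} (hz : z ^ n ≠ 1) :
    ∑ j ∈ range n, zeta n j ^ (k + 1) / (z - zeta n j) ^ 2 =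
      n * (n * z ^ k * z ^ (n - 1) - k * z ^ (k - 1) * (z ^ n - 1)) / (z ^ n - 1) ^ 2 := by
  have hn : n ≠ 0 := by omega
  have hz' : z ^ n - 1 ≠ 0 := sub_ne_zero.mpr hz
  have hd1 : HasDerivAt (fun w => ∑ j ∈ range n, zeta n j ^ (k + 1) / (w - zeta n j))
      (∑ j ∈ range n, -(zeta n j ^ (k + 1) / (z - zeta n j) ^ 2)) z := by
    refine HasDerivAt.fun_sum fun j _ => ?_
    have h := (hasDerivAt_const z (zeta n j ^ (k + 1))).fun_div
      ((hasDerivAt_id z).sub_const (zeta n j)) (sub_zeta_ne_zero hn hz j)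
    refine h.congr_deriv ?_
    simp [neg_div]
  have hd2 : HasDerivAt (fun w : ℂ => n * w ^ k / (w ^ n - 1))
      ((n * (k * z ^ (k - 1)) * (z ^ n - 1) - n * z ^ k * (n * z ^ (n - 1))) / (z ^ n - 1) ^ 2)
      z := ((hasDerivAt_pow k z).const_mul (n : ℂ)).fun_div ((hasDerivAt_pow n z).sub_const 1) hz'
  have heq : (fun w => ∑ j ∈ range n, zeta n j ^ (k + 1) / (w - zeta n j)) =ᶠ[nhds z]
      fun w : ℂ => n * w ^ k / (w ^ n - 1) := by
    filter_upwards [(continuous_pow n).continuousAt.eventually_ne hz] with w hw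
    exact sum_zeta_pow_div_sub hk hw
  have := hd1.unique (hd2.congr_of_eventuallyEq heq)
  rw [sum_neg_distrib, neg_eq_iff_eq_neg] at this
  rw [this]
  ring

/-! ### Explicit primitives in the disc and polar coordinates -/

/-- The real linear form `v ↦ Re (D v)` on `ℂ`. -/
def reMul (D : ℂ) : ℂ →L[ℝ] ℝ := reCLM ∘L (ContinuousLinearMap.mul ℝ ℂ D)

@[simp] theorem reMul_apply (D v : ℂ) : reMul D v = (D * v).re := rfl

theorem reMul_sum {ι : Type*} (s : Finset ι) (D : ι → ℂ) :
    reMul (∑ i ∈ s, D i) = ∑ i ∈ s, reMul (D i) := by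
  ext v
  simp [sum_mul]

theorem _root_.HasDerivAt.hasFDerivAt_re {h : ℂ → ℂ} {h' z : ℂ} (hh : HasDerivAt h h' z) :
    HasFDerivAt (fun w => (h w).re) (reMul h') z := by
  have := reCLM.hasFDerivAt.comp z (hh.hasFDerivAt.restrictScalars ℝ)
  refine this.congr_fderiv ?_
  ext v
  simp [mul_comm]

theorem _root_.HasDerivAt.hasFDerivAt_im {h : ℂ → ℂ} {h' z : ℂ} (hh : HasDerivAt h h' z) :
    HasFDerivAt (fun w => (h w).im) (reMul (-I * h')) z := by
  have := (hh.const_mul (-I)).hasFDerivAt_re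
  simpa using this

theorem hasFDerivAt_log_norm_sub {a z : ℂ} (h : z - a ≠ 0) :
    HasFDerivAt (fun w => Real.log ‖w - a‖) (reMul (1 / (z - a))) z := by
  -- Dividing by z - a puts the argument near 1, away from the branch cut.
  have h1 : HasDerivAt (fun w => log ((w - a) / (z - a))) (1 / (z - a)) z := by
    have h2 := (((hasDerivAt_id z).sub_const a).div_const (z - a)).clog
      (by simp [div_self h])
    refine h2.congr_deriv ?_
    simp [div_self h]
  have h3 := h1.hasFDerivAt_re.add_const (Real.log ‖z - a‖)
  refine h3.congr_of_eventuallyEq ?_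
  have h4 : ∀ᶠ w in nhds z, w - a ≠ 0 :=
    (continuous_id.sub continuous_const).continuousAt.eventually_ne h
  filter_upwards [h4] with w hw
  rw [log_re, norm_div, Real.log_div (norm_ne_zero_iff.mpr hw) (norm_ne_zero_iff.mpr h)]
  ring

/-- `n² t` for the coordinate `t` of the extended surface, in the coordinates `(u, θ)`. -/
def height (n : ℕ) (u θ : ℝ) : ℝ :=
  ∑ j ∈ range n, Real.sin (θ - node n j) / (u - Real.cos (θ - node n j))

/-- `-n²` times the component `x cos ψ - y sin ψ` of the extended surface, in the coordinates
`(u, θ)`. -/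
def planar (n : ℕ) (ψ u θ : ℝ) : ℝ :=
  ∑ j ∈ range n, (Real.cos (node n j - ψ) *
      (Real.sin (θ - node n j) / (u - Real.cos (θ - node n j))) -
    (n - 1) * Real.sin (node n j - ψ) * Real.log (u - Real.cos (θ - node n j)))

/-- The function `height` in the coordinate `z`. -/
def discHeight (n : ℕ) (z : ℂ) : ℝ :=
  ∑ j ∈ range n, -2 * (zeta n j / (z - zeta n j)).im

/-- The function `planar` in the coordinate `z`. -/
def discPlanar (n : ℕ) (ψ : ℝ) (z : ℂ) : ℝ :=
  ∑ j ∈ range n, (Real.cos (node n j - ψ) * (-2 * (zeta n j / (z - zeta n j)).im) -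
    (n - 1) * Real.sin (node n j - ψ) * (2 * Real.log ‖z - zeta n j‖))

theorem sum_sin_node_sub {n : ℕ} (hn : 2 ≤ n) (ψ : ℝ) :
    ∑ j ∈ range n, Real.sin (node n j - ψ) = 0 := by
  have h1 : ∀ j, Real.sin (node n j - ψ) = (zeta n j ^ 1 * exp (-(ψ * I))).im := fun j => by
    rw [zeta, pow_one, ← exp_add, show (node n j : ℂ) * I + -(ψ * I) = ((node n j - ψ : ℝ) : ℂ) * I
      by push_cast; ring, exp_ofReal_mul_I_im]
  simp_rw [h1]
  rw [← im_sum, ← sum_mul, sum_zeta_pow (by omega), if_neg, zero_mul, zero_im]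
  intro h
  have := Nat.le_of_dvd one_pos h
  omega

theorem normSq_polar_sub_zeta (n j : ℕ) {r : ℝ} (hr : r ≠ 0) (θ : ℝ) :
    normSq (r * exp (θ * I) - zeta n j) = 2 * r * ((r + r⁻¹) / 2 - Real.cos (θ - node n j)) := by
  have e1 : (r * exp (θ * I) - zeta n j).re = r * Real.cos θ - Real.cos (node n j) := by
    simp [zeta, exp_ofReal_mul_I_re]
  have e2 : (r * exp (θ * I) - zeta n j).im = r * Real.sin θ - Real.sin (node n j) := by
    simp [zeta, exp_ofReal_mul_I_im]
  rw [normSq_apply, e1, e2, Real.cos_sub]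
  have := Real.sin_sq_add_cos_sq θ
  have := Real.sin_sq_add_cos_sq (node n j)
  field_simp
  linear_combination r ^ 2 * Real.sin_sq_add_cos_sq θ + Real.sin_sq_add_cos_sq (node n j)

theorem im_zeta_div_polar_sub (n j : ℕ) {r : ℝ} (hr : r ≠ 0) (θ : ℝ) :
    -2 * (zeta n j / (r * exp (θ * I) - zeta n j)).im =
      Real.sin (θ - node n j) / ((r + r⁻¹) / 2 - Real.cos (θ - node n j)) := by
  have e1 : (r * exp (θ * I) - zeta n j).re = r * Real.cos θ - Real.cos (node n j) := by
    simp [zeta, exp_ofReal_mul_I_re]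
  have e2 : (r * exp (θ * I) - zeta n j).im = r * Real.sin θ - Real.sin (node n j) := by
    simp [zeta, exp_ofReal_mul_I_im]
  have e3 : (zeta n j).re = Real.cos (node n j) := by simp [zeta, exp_ofReal_mul_I_re]
  have e4 : (zeta n j).im = Real.sin (node n j) := by simp [zeta, exp_ofReal_mul_I_im]
  rw [div_im, normSq_polar_sub_zeta n j hr, e1, e2, e3, e4, ← sub_div, ← mul_div_assoc,
    show -2 * (Real.sin (node n j) * (r * Real.cos θ - Real.cos (node n j)) -
      Real.cos (node n j) * (r * Real.sin θ - Real.sin (node n j))) =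
      2 * r * Real.sin (θ - node n j) by rw [Real.sin_sub]; ring,
    mul_div_mul_left _ _ (by simpa using hr)]

theorem discHeight_polar (n : ℕ) {r : ℝ} (hr : r ≠ 0) (θ : ℝ) :
    discHeight n (r * exp (θ * I)) = height n ((r + r⁻¹) / 2) θ :=
  sum_congr rfl fun j _ => im_zeta_div_polar_sub n j hr θ

/-- The squared distance to ζ_j is 2r(u - cos(θ - θ_j)). Its factor 2r, not a function of u,
disappears from the logarithms because the coefficients sin(θ_j - ψ) sum to zero. -/
theorem discPlanar_polar {n : ℕ} (hn : 2 ≤ n) (ψ : ℝ) {r : ℝ} (hr : 0 < r) (θ : ℝ)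
    (hz : (r * exp (θ * I)) ^ n ≠ 1) :
    discPlanar n ψ (r * exp (θ * I)) = planar n ψ ((r + r⁻¹) / 2) θ := by
  have h1 : ∀ j, 2 * Real.log ‖r * exp (θ * I) - zeta n j‖ =
      Real.log (2 * r) + Real.log ((r + r⁻¹) / 2 - Real.cos (θ - node n j)) := fun j => by
    have h2 := normSq_polar_sub_zeta n j hr.ne' θ
    have h3 : normSq (r * exp (θ * I) - zeta n j) ≠ 0 :=
      fun h => sub_zeta_ne_zero (by omega) hz j (normSq_eq_zero.mp h)
    rw [h2] at h3
    rw [← Real.log_mul (left_ne_zero_of_mul h3) (right_ne_zero_of_mul h3), ← h2,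
      normSq_eq_norm_sq, Real.log_pow]
    norm_num
  unfold discPlanar planar
  simp_rw [im_zeta_div_polar_sub n _ hr.ne', h1, mul_add, sub_add_eq_sub_sub]
  have h4 : ∑ j ∈ range n, ((n : ℝ) - 1) * Real.sin (node n j - ψ) * Real.log (2 * r) = 0 := by
    rw [← sum_mul, ← mul_sum, sum_sin_node_sub hn]
    simp
  simp only [sum_sub_distrib, h4]
  ring

/-- The differential of `discHeight n` is `v ↦ Re (heightForm n z * v)`. -/
def heightForm (n : ℕ) (z : ℂ) : ℂ := -2 * I * n ^ 2 * z ^ (n - 1) / (z ^ n - 1) ^ 2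

/-- The differential of `discPlanar n ψ` is `v ↦ Re (planarForm n ψ z * v)`. -/
def planarForm (n : ℕ) (ψ : ℝ) (z : ℂ) : ℂ :=
  -I * n ^ 2 * (exp (ψ * I) * z ^ (2 * (n - 1)) + exp (-(ψ * I))) / (z ^ n - 1) ^ 2

theorem hasFDerivAt_im_zeta_div_sub {n : ℕ} (hn : n ≠ 0) {z : ℂ} (hz : z ^ n ≠ 1) (j : ℕ) :
    HasFDerivAt (fun w => -2 * (zeta n j / (w - zeta n j)).im)
      (reMul (-2 * I * (zeta n j / (z - zeta n j) ^ 2))) z := by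
  have h := ((hasDerivAt_const z (zeta n j)).fun_div
    ((hasDerivAt_id z).sub_const (zeta n j)) (sub_zeta_ne_zero hn hz j)).hasFDerivAt_im.const_mul
    (-2)
  refine h.congr_fderiv ?_
  ext v
  simp [neg_div]
  ring

theorem hasFDerivAt_discHeight {n : ℕ} (hn : 2 ≤ n) {z : ℂ} (hz : z ^ n ≠ 1) :
    HasFDerivAt (discHeight n) (reMul (heightForm n z)) z := by
  have h : HasFDerivAt (discHeight n) (∑ j ∈ range n,
      reMul (-2 * I * (zeta n j / (z - zeta n j) ^ 2))) z :=
    HasFDerivAt.fun_sum fun j _ => hasFDerivAt_im_zeta_div_sub (by omega) hz j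
  refine h.congr_fderiv ?_
  rw [← reMul_sum, ← mul_sum]
  congr 1
  have := sum_zeta_pow_div_sub_sq (n := n) (k := 0) (by omega) hz
  simp only [zero_add, pow_one] at this
  rw [this, heightForm]
  simp
  ring

theorem hasFDerivAt_discPlanar {n : ℕ} (hn : 2 ≤ n) (ψ : ℝ) {z : ℂ} (hz : z ^ n ≠ 1) :
    HasFDerivAt (discPlanar n ψ) (reMul (planarForm n ψ z)) z := by
  have hn0 : n ≠ 0 := by omega
  have hz' : z ^ n - 1 ≠ 0 := sub_ne_zero.mpr hz
  have h : HasFDerivAt (discPlanar n ψ) (∑ j ∈ range n,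
      (Real.cos (node n j - ψ) • reMul (-2 * I * (zeta n j / (z - zeta n j) ^ 2)) -
        ((n - 1) * Real.sin (node n j - ψ)) • ((2 : ℝ) • reMul (1 / (z - zeta n j))))) z :=
    HasFDerivAt.fun_sum fun j _ =>
      ((hasFDerivAt_im_zeta_div_sub (by omega) hz j).const_mul _).sub
      (((hasFDerivAt_log_norm_sub (sub_zeta_ne_zero (by omega) hz j)).const_mul 2).const_mul _)
  refine h.congr_fderiv ?_
  -- Sine and cosine are written in ζ and ζ⁻¹ = ζ^(n-1). The exponents are displayed as k + 1 so
  -- that the partial fraction sums apply with k = 1, 0, n - 1, n - 2.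
  have hterm : ∀ j ∈ range n,
      (Real.cos (node n j - ψ) • reMul (-2 * I * (zeta n j / (z - zeta n j) ^ 2)) -
        ((n - 1) * Real.sin (node n j - ψ)) • ((2 : ℝ) • reMul (1 / (z - zeta n j)))) =
      reMul (-I * (exp (-(ψ * I)) * (zeta n j ^ (1 + 1) / (z - zeta n j) ^ 2 -
          (n - 1) * (zeta n j ^ (0 + 1) / (z - zeta n j))) +
        exp (ψ * I) * (zeta n j ^ (n - 1 + 1) / (z - zeta n j) ^ 2 +
          (n - 1) * (zeta n j ^ (n - 2 + 1) / (z - zeta n j))))) := fun j _ => by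
    have hE : exp (ψ * I) ≠ 0 := exp_ne_zero _
    have hζ := zeta_ne_zero n j
    have hc : ((Real.cos (node n j - ψ) : ℝ) : ℂ) =
        (zeta n j * exp (-(ψ * I)) + exp (ψ * I) * (zeta n j)⁻¹) / 2 := by
      rw [ofReal_cos, cos, zeta, ← exp_neg, ← exp_add, ← exp_add]
      push_cast
      ring_nf
    have hs : ((Real.sin (node n j - ψ) : ℝ) : ℂ) =
        -I * (zeta n j * exp (-(ψ * I)) - exp (ψ * I) * (zeta n j)⁻¹) / 2 := by
      rw [ofReal_sin, sin, zeta, ← exp_neg, ← exp_add, ← exp_add]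
      push_cast
      ring_nf
    have hp1 : zeta n j ^ (n - 1 + 1) = 1 := by
      rw [show n - 1 + 1 = n by omega, zeta_pow hn0]
    have hp2 : zeta n j ^ (n - 2 + 1) = (zeta n j)⁻¹ := by
      apply eq_inv_of_mul_eq_one_left
      rw [← pow_succ, show n - 2 + 1 + 1 = n by omega, zeta_pow hn0]
    rw [hp1, hp2]
    ext v
    have hsm : ∀ (a : ℝ) (b : ℂ), a * b.re = ((a : ℂ) * b).re := fun a b => by simp
    simp only [sub_apply, smul_apply, reMul_apply,
      smul_eq_mul, hsm, ← sub_re]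
    congr 1
    push_cast at hc hs ⊢
    rw [hc, hs]
    have := sub_zeta_ne_zero hn0 hz j
    field_simp
    ring
  rw [sum_congr rfl hterm, ← reMul_sum]
  congr 1
  rw [← mul_sum, sum_add_distrib, ← mul_sum, ← mul_sum, sum_sub_distrib, sum_add_distrib,
    ← mul_sum, ← mul_sum, sum_zeta_pow_div_sub_sq (by omega) hz,
    sum_zeta_pow_div_sub_sq (by omega) hz, sum_zeta_pow_div_sub (by omega) hz,
    sum_zeta_pow_div_sub (by omega) hz, planarForm]
  obtain ⟨m, rfl⟩ : ∃ m, n = m + 2 := ⟨n - 2, by omega⟩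
  simp only [show m + 2 - 1 = m + 1 by omega, show m + 2 - 2 = m by omega,
    show m + 1 - 1 = m by omega, show 1 - 1 = 0 by omega]
  field_simp
  push_cast
  ring

/-! ### The explicit surface and its agreement with the integral -/

/-- The extended surface in the coordinates `(u, θ)`. -/
def polarSurface (n : ℕ) (p : ℝ × ℝ) : MinkowskiSpace :=
  ((n : ℝ) ^ 2)⁻¹ • ![height n p.1 p.2, -planar n 0 p.1 p.2, -planar n (-(Real.pi / 2)) p.1 p.2]

/-- The extended surface in the coordinate `z`. -/
def discSurface (n : ℕ) (z : ℂ) : MinkowskiSpace :=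
  ((n : ℝ) ^ 2)⁻¹ • ![discHeight n z, -discPlanar n 0 z, -discPlanar n (-(Real.pi / 2)) z]

/-- The explicit extension of the Jorge-Meeks type surface, as a map on the whole cylinder (with
junk values off `Omega n`). -/
def extension (n : ℕ) (p : Cylinder) : MinkowskiSpace :=
  p.elim 0 fun q => polarSurface n (q.1, q.2.toReal)

theorem discHeight_zero (n : ℕ) : discHeight n 0 = 0 := by
  refine sum_eq_zero fun j _ => ?_
  rw [zero_sub, div_neg, div_self (zeta_ne_zero n j)]
  simp

theorem discPlanar_zero (n : ℕ) (ψ : ℝ) : discPlanar n ψ 0 = 0 := by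
  refine sum_eq_zero fun j _ => ?_
  rw [zero_sub, div_neg, div_self (zeta_ne_zero n j)]
  simp [norm_zeta]

theorem discSurface_zero (n : ℕ) : discSurface n 0 = 0 := by
  ext k
  fin_cases k <;> simp [discSurface, discHeight_zero, discPlanar_zero]

theorem sin_toReal_sub (θ : Real.Angle) (a : ℝ) :
    Real.sin (θ.toReal - a) = (θ - (a : Real.Angle)).sin := by
  rw [← Real.Angle.sin_coe, Real.Angle.coe_sub, Real.Angle.coe_toReal]

theorem cos_toReal_sub (θ : Real.Angle) (a : ℝ) :
    Real.cos (θ.toReal - a) = (θ - (a : Real.Angle)).cos := by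
  rw [← Real.Angle.cos_coe, Real.Angle.coe_sub, Real.Angle.coe_toReal]

theorem extension_infty (n : ℕ) : extension n ∞ = 0 := rfl

theorem extension_coe (n : ℕ) (q : ℝ × Real.Angle) :
    extension n (q : Cylinder) = polarSurface n (q.1, q.2.toReal) := rfl

theorem extension_polarPoint (n : ℕ) (p : ℝ × ℝ) :
    extension n (polarPoint p) = polarSurface n p := by
  have hs : ∀ a : ℝ, Real.sin ((p.2 : Real.Angle).toReal - a) = Real.sin (p.2 - a) := fun a => by
    rw [sin_toReal_sub, ← Real.Angle.coe_sub, Real.Angle.sin_coe]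
  have hc : ∀ a : ℝ, Real.cos ((p.2 : Real.Angle).toReal - a) = Real.cos (p.2 - a) := fun a => by
    rw [cos_toReal_sub, ← Real.Angle.coe_sub, Real.Angle.cos_coe]
  rw [polarPoint, extension_coe]
  simp only [polarSurface, height, planar, hs, hc]

theorem discSurface_polar {n : ℕ} (hn : 2 ≤ n) {r : ℝ} (hr : 0 < r) (θ : ℝ)
    (hz : (r * exp (θ * I)) ^ n ≠ 1) :
    discSurface n (r * exp (θ * I)) = polarSurface n ((r + r⁻¹) / 2, θ) := by
  simp only [discSurface, polarSurface, discHeight_polar n hr.ne', discPlanar_polar hn _ hr θ hz]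

theorem extension_iota {n : ℕ} (hn : 2 ≤ n) {z : ℂ} (hz : z ^ n ≠ 1) :
    extension n (iota z) = discSurface n z := by
  unfold iota
  split_ifs with h0
  · rw [h0, discSurface_zero, extension_infty]
  · have h := norm_mul_exp_arg_mul_I z
    rw [extension_polarPoint, ← discSurface_polar hn (norm_pos_iff.mpr h0) _ (by rwa [h]), h]

theorem pow_ne_one_of_mem_segment {n : ℕ} (hn : n ≠ 0) {z : ℂ} (hz : ‖z‖ ≤ 1) (hzn : z ^ n ≠ 1)
    {t : ℝ} (ht : t ∈ Set.Icc (0 : ℝ) 1) : (t * z) ^ n ≠ 1 := by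
  intro h
  have h1 : ‖(t : ℂ) * z‖ = 1 := by
    have := congrArg norm h
    rw [norm_pow, norm_one] at this
    exact (pow_eq_one_iff_of_nonneg (norm_nonneg _) hn).mp this
  rw [norm_mul, norm_real, Real.norm_of_nonneg ht.1] at h1
  have h2 : t = 1 := by nlinarith [norm_nonneg z, ht.1, ht.2]
  rw [h2, ofReal_one, one_mul] at h
  exact hzn h

theorem re_integral_segment {D : ℂ → ℂ} {G : ℂ → ℝ} {z : ℂ}
    (hD : ∀ t ∈ Set.Icc (0 : ℝ) 1, ContinuousAt D (t * z))
    (hG : ∀ t ∈ Set.Icc (0 : ℝ) 1, HasFDerivAt G (reMul (D (t * z))) (t * z)) :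
    (∫ t in (0 : ℝ)..1, D (t * z) * z).re = G z - G 0 := by
  have hc : ContinuousOn (fun t : ℝ => D (t * z) * z) (Set.uIcc 0 1) := by
    rw [Set.uIcc_of_le zero_le_one]
    intro t ht
    refine ContinuousAt.continuousWithinAt (ContinuousAt.mul ?_ continuousAt_const)
    exact ContinuousAt.comp (f := fun t : ℝ => (t : ℂ) * z) (hD t ht) (by fun_prop)
  have h1 := reCLM.intervalIntegral_comp_comm
    (hc.intervalIntegrable (μ := MeasureTheory.volume))
  simp only [reCLM_apply] at h1
  rw [← h1]
  have hd : ∀ t ∈ Set.uIcc (0 : ℝ) 1,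
      HasDerivAt (fun t : ℝ => G (t * z)) (D (t * z) * z).re t := fun t ht => by
    rw [Set.uIcc_of_le zero_le_one] at ht
    have h2 : HasDerivAt (fun t : ℝ => (t : ℂ) * z) z t := by
      simpa using (ofRealCLM.hasDerivAt (x := t)).mul_const z
    exact (hG t ht).comp_hasDerivAt t h2
  rw [intervalIntegral.integral_eq_sub_of_hasDerivAt hd
    (Complex.continuous_re.comp_continuousOn hc).intervalIntegrable]
  simp

/-- Each integrand times n² is the complex form whose real part is the differential of the matching
primitive. All primitives vanish at 0, so the fundamental theorem of calculus along the segment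
applies. The y-component is the case ψ = -π/2, where e^{iψ} = -i. -/
theorem jorgeMeeksSurface_eq {n : ℕ} (hn : 2 ≤ n) {z : ℂ} (hz : ‖z‖ ≤ 1) (hzn : z ^ n ≠ 1) :
    jorgeMeeksSurface n z = discSurface n z := by
  have hn0 : n ≠ 0 := by omega
  have hnR : (n : ℝ) ^ 2 ≠ 0 := by positivity
  have hseg := fun t ht => pow_ne_one_of_mem_segment (t := t) hn0 hz hzn ht
  have key : ∀ (W D : ℂ → ℂ) (G : ℂ → ℝ), (∀ w, D w = n ^ 2 * W w) →
      (∀ w, w ^ n ≠ 1 → ContinuousAt D w) → (∀ w, w ^ n ≠ 1 → HasFDerivAt G (reMul (D w)) w) →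
      G 0 = 0 → (∫ t in (0 : ℝ)..1, W (t * z) * z).re = ((n : ℝ) ^ 2)⁻¹ * G z := by
    intro W D G hWD hD hG h0
    have h := re_integral_segment (fun t ht => hD _ (hseg t ht)) (fun t ht => hG _ (hseg t ht))
    simp only [hWD, mul_assoc] at h
    rw [intervalIntegral.integral_const_mul, h0, sub_zero,
      show ((n : ℂ) ^ 2) = (((n : ℝ) ^ 2 : ℝ) : ℂ) by push_cast; rfl, re_ofReal_mul] at h
    rw [← h, inv_mul_cancel_left₀ hnR]
  have hcont : ∀ ψ w, w ^ n ≠ 1 → ContinuousAt (planarForm n ψ) w := fun ψ w hw =>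
    ContinuousAt.div (by fun_prop) (by fun_prop) (pow_ne_zero 2 (sub_ne_zero.mpr hw))
  have hI : exp (((-(Real.pi / 2) : ℝ) : ℂ) * I) = -I := by
    rw [show ((-(Real.pi / 2) : ℝ) : ℂ) * I = -(Real.pi / 2 * I) by push_cast; ring, exp_neg,
      exp_pi_div_two_mul_I, inv_I]
  have hI' : exp (-(((-(Real.pi / 2) : ℝ) : ℂ) * I)) = I := by
    rw [show -(((-(Real.pi / 2) : ℝ) : ℂ) * I) = (Real.pi / 2 * I) by push_cast; ring,
      exp_pi_div_two_mul_I]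
  ext k
  fin_cases k
  · refine (key (fun w => weierstrassIntegrand (fun z => z ^ (n - 1))
      (fun z => I / (z ^ n - 1) ^ 2) w 0) (heightForm n) (discHeight n) (fun w => ?_) (fun w hw => ?_)
      (fun w hw => hasFDerivAt_discHeight hn hw) (discHeight_zero n)).trans ?_
    · simp [weierstrassIntegrand, heightForm]
      ring
    · exact ContinuousAt.div (by fun_prop) (by fun_prop) (pow_ne_zero 2 (sub_ne_zero.mpr hw))
    · simp [discSurface]
  · refine (key (fun w => weierstrassIntegrand (fun z => z ^ (n - 1))
      (fun z => I / (z ^ n - 1) ^ 2) w 1) (fun w => -planarForm n 0 w) (fun w => -discPlanar n 0 w) (fun w => ?_)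
      (fun w hw => (hcont _ w hw).neg) (fun w hw => ?_) (by simp [discPlanar_zero])).trans ?_
    · simp [weierstrassIntegrand, planarForm]
      ring
    · refine (hasFDerivAt_discPlanar hn 0 hw).fun_neg.congr_fderiv ?_
      ext v
      simp
    · simp [discSurface]
  · refine (key (fun w => weierstrassIntegrand (fun z => z ^ (n - 1))
      (fun z => I / (z ^ n - 1) ^ 2) w 2) (fun w => -planarForm n (-(Real.pi / 2)) w)
      (fun w => -discPlanar n (-(Real.pi / 2)) w) (fun w => ?_)
      (fun w hw => (hcont _ w hw).neg) (fun w hw => ?_) (by simp [discPlanar_zero])).trans ?_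
    · rw [planarForm, hI, hI']
      simp [weierstrassIntegrand]
      ring
    · refine (hasFDerivAt_discPlanar hn _ hw).fun_neg.congr_fderiv ?_
      ext v
      simp
    · simp [discSurface]

/-! ### The polar domain, analyticity and uniqueness -/

/-- The domain of the coordinates `(u, θ)`. -/
def polarDomain (n : ℕ) : Set (ℝ × ℝ) := {p | polarPoint p ∈ Omega n}

theorem mem_polarDomain {n : ℕ} {p : ℝ × ℝ} :
    p ∈ polarDomain n ↔ ∀ j < n, Real.cos (p.2 - node n j) < p.1 :=
  polarPoint_mem_Omega

theorem isOpen_polarDomain (n : ℕ) : IsOpen (polarDomain n) := by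
  have : polarDomain n = ⋂ j ∈ range n, {p : ℝ × ℝ | Real.cos (p.2 - node n j) < p.1} := by
    ext p
    simp [mem_polarDomain]
  rw [this]
  exact isOpen_biInter_finset fun j _ => isOpen_lt (by fun_prop) (by fun_prop)

theorem mem_polarDomain_of_one_lt {n : ℕ} {p : ℝ × ℝ} (h : 1 < p.1) : p ∈ polarDomain n :=
  mem_polarDomain.mpr fun _ _ => (Real.cos_le_one _).trans_lt h

/-- Every point is joined by its upward ray, on which u grows, to the half-plane u > 1. -/
theorem isPreconnected_polarDomain (n : ℕ) : IsPreconnected (polarDomain n) := by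
  refine isPreconnected_of_forall ((2 : ℝ), (0 : ℝ)) fun p hp => ?_
  have hA : Convex ℝ (Set.Ioi (1 : ℝ) ×ˢ (Set.univ : Set ℝ)) := (convex_Ioi 1).prod convex_univ
  have hB : Convex ℝ (Set.Ici p.1 ×ˢ {p.2}) := (convex_Ici p.1).prod (convex_singleton p.2)
  refine ⟨_, ?_, Or.inl ?_, Or.inr ?_, IsPreconnected.union (max p.1 2, p.2) ?_ ?_
    hA.isPreconnected hB.isPreconnected⟩
  · rintro q (hq | hq)
    · exact mem_polarDomain_of_one_lt hq.1
    · rw [mem_polarDomain] at hp ⊢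
      intro j hj
      rw [show q.2 = p.2 from hq.2]
      exact (hp j hj).trans_le hq.1
  · simp
  · simp
  · simp
  · simp

theorem exists_polarPoint_eq {n : ℕ} {p : Cylinder} (hp : p ∈ Omega n) (h : p ≠ ∞) :
    ∃ q ∈ polarDomain n, polarPoint q = p := by
  rcases hp with hp | ⟨q, _, hq⟩
  · exact absurd hp h
  · have h1 : polarPoint (q.1, q.2.toReal) = p := by
      rw [← hq, polarPoint, Real.Angle.coe_toReal]
    exact ⟨_, by rw [polarDomain, Set.mem_ofPred_eq, h1, ← hq]; exact Or.inr ⟨q, ‹_›, rfl⟩, h1⟩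

theorem iota_polar {r : ℝ} (hr : 0 < r) (θ : ℝ) :
    iota (r * exp (θ * I)) = polarPoint ((r + r⁻¹) / 2, θ) := by
  have h0 : (r : ℂ) * exp (θ * I) ≠ 0 :=
    mul_ne_zero (ofReal_ne_zero.mpr hr.ne') (exp_ne_zero _)
  have h1 : ‖(r : ℂ) * exp (θ * I)‖ = r := by
    rw [norm_mul, norm_exp_ofReal_mul_I, mul_one, norm_real, Real.norm_of_nonneg hr.le]
  have h2 : ((arg ((r : ℂ) * exp (θ * I)) : ℝ) : Real.Angle) = θ := by
    rw [arg_real_mul _ hr, exp_mul_I, ← ofReal_cos, ← ofReal_sin,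
      ← Real.Angle.cos_coe, ← Real.Angle.sin_coe, arg_cos_add_sin_mul_I_coe_angle]
  rw [iota, if_neg h0, h1, polarPoint, polarPoint, h2]

theorem pow_ne_one_of_norm_lt {n : ℕ} (hn : n ≠ 0) {z : ℂ} (hz : ‖z‖ < 1) : z ^ n ≠ 1 := by
  intro h
  have := congrArg norm h
  rw [norm_pow, norm_one, pow_eq_one_iff_of_nonneg (norm_nonneg _) hn] at this
  exact hz.ne this

theorem norm_exp_neg_mul {s : ℝ} (θ : ℝ) :
    ‖((Real.exp (-s) : ℝ) : ℂ) * exp (θ * I)‖ = Real.exp (-s) := by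
  rw [norm_mul, norm_exp_ofReal_mul_I, mul_one, norm_real, Real.norm_of_nonneg (Real.exp_pos _).le]

theorem iota_exp (s θ : ℝ) :
    iota ((Real.exp (-s) : ℝ) * exp (θ * I)) = polarPoint (Real.cosh s, θ) := by
  rw [iota_polar (Real.exp_pos _), ← Real.exp_neg, neg_neg, Real.cosh_eq, add_comm]

theorem analyticAt_sin_snd_sub (a : ℝ) (p : ℝ × ℝ) :
    AnalyticAt ℝ (fun q : ℝ × ℝ => Real.sin (q.2 - a)) p :=
  Real.analyticAt_sin.comp (g := Real.sin) (f := fun q : ℝ × ℝ => q.2 - a)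
    (analyticAt_snd.sub analyticAt_const)

theorem analyticAt_cos_snd_sub (a : ℝ) (p : ℝ × ℝ) :
    AnalyticAt ℝ (fun q : ℝ × ℝ => Real.cos (q.2 - a)) p :=
  Real.analyticAt_cos.comp (g := Real.cos) (f := fun q : ℝ × ℝ => q.2 - a)
    (analyticAt_snd.sub analyticAt_const)

theorem analyticAt_fst_sub_cos (a : ℝ) (p : ℝ × ℝ) :
    AnalyticAt ℝ (fun q : ℝ × ℝ => q.1 - Real.cos (q.2 - a)) p :=
  analyticAt_fst.sub (analyticAt_cos_snd_sub a p)

theorem analyticAt_height {n : ℕ} {p : ℝ × ℝ} (hp : p ∈ polarDomain n) :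
    AnalyticAt ℝ (fun q : ℝ × ℝ => height n q.1 q.2) p :=
  Finset.analyticAt_fun_sum _ fun _ hj => (analyticAt_sin_snd_sub _ p).div
    (analyticAt_fst_sub_cos _ p) (sub_pos.mpr (mem_polarDomain.mp hp _ (mem_range.mp hj))).ne'

theorem analyticAt_planar {n : ℕ} (ψ : ℝ) {p : ℝ × ℝ} (hp : p ∈ polarDomain n) :
    AnalyticAt ℝ (fun q : ℝ × ℝ => planar n ψ q.1 q.2) p := by
  refine Finset.analyticAt_fun_sum _ fun j hj => ?_
  have hpos := sub_pos.mpr (mem_polarDomain.mp hp j (mem_range.mp hj))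
  have hs := analyticAt_fst_sub_cos (node n j) p
  exact (analyticAt_const.mul ((analyticAt_sin_snd_sub _ p).div hs hpos.ne')).sub
    (analyticAt_const.mul ((analyticAt_log hpos).comp (g := Real.log)
      (f := fun q : ℝ × ℝ => q.1 - Real.cos (q.2 - node n j)) hs))

theorem analyticAt_polarSurface {n : ℕ} {p : ℝ × ℝ} (hp : p ∈ polarDomain n) :
    AnalyticAt ℝ (polarSurface n) p := by
  have : AnalyticAt ℝ (fun q : ℝ × ℝ => polarSurface n q) p := by
    unfold polarSurface
    refine AnalyticAt.fun_const_smul (AnalyticAt.pi fun k => ?_)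
    fin_cases k
    · exact analyticAt_height hp
    · exact (analyticAt_planar _ hp).neg
    · exact (analyticAt_planar _ hp).neg
  exact this

theorem analyticAt_discSurface {n : ℕ} (hn : n ≠ 0) {z : ℂ} (hz : ‖z‖ < 1) :
    AnalyticAt ℝ (discSurface n) z := by
  have hzn := pow_ne_one_of_norm_lt hn hz
  have h1 : ∀ j, AnalyticAt ℝ (fun w => (zeta n j / (w - zeta n j)).im) z := fun j => by
    have : AnalyticAt ℂ (fun w => zeta n j / (w - zeta n j)) z :=
      AnalyticAt.div (by fun_prop) (by fun_prop) (sub_zeta_ne_zero hn hzn j)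
    exact (imCLM.analyticAt _).comp (this.restrictScalars (𝕜 := ℝ))
  -- As |ζ| = 1, |w - ζ| = |1 - w/ζ|, and 1 - w/ζ has positive real part in the unit disc, so the
  -- principal logarithm is analytic there.
  have h2 : ∀ j, AnalyticAt ℝ (fun w => Real.log ‖w - zeta n j‖) z := fun j => by
    have h3 : (fun w => Real.log ‖w - zeta n j‖) = fun w => (log (1 - w / zeta n j)).re := by
      funext w
      rw [log_re, one_sub_div (zeta_ne_zero n j), norm_div, norm_zeta, div_one, norm_sub_rev]
    have h4 : AnalyticAt ℂ (fun w => log (1 - w / zeta n j)) z := by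
      refine AnalyticAt.clog (analyticAt_const.sub
        (analyticAt_id.div analyticAt_const (zeta_ne_zero n j))) (Or.inl ?_)
      have h5 : ‖z / zeta n j‖ < 1 := by rwa [norm_div, norm_zeta, div_one]
      have := (re_le_norm (z / zeta n j)).trans_lt h5
      simpa using this
    rw [h3]
    exact (reCLM.analyticAt _).comp (h4.restrictScalars (𝕜 := ℝ))
  have hh : AnalyticAt ℝ (fun w => discHeight n w) z :=
    Finset.analyticAt_fun_sum _ fun j _ => analyticAt_const.mul (h1 j)
  have hpl : ∀ ψ, AnalyticAt ℝ (fun w => discPlanar n ψ w) z := fun ψ =>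
    Finset.analyticAt_fun_sum _ fun j _ =>
      (analyticAt_const.mul (analyticAt_const.mul (h1 j))).sub
        (analyticAt_const.mul (analyticAt_const.mul (h2 j)))
  have : AnalyticAt ℝ (fun w => discSurface n w) z := by
    unfold discSurface
    refine AnalyticAt.fun_const_smul (AnalyticAt.pi fun k => ?_)
    fin_cases k
    · exact hh
    · exact (hpl _).neg
    · exact (hpl _).neg
  exact this

/-- The analytic extension of the Jorge-Meeks type surface. -/
def extendedSurface (n : ℕ) (p : Omega n) : MinkowskiSpace := extension n p

theorem inPolar_apply {n : ℕ} (f : Omega n → MinkowskiSpace) {p : ℝ × ℝ} (hp : p ∈ polarDomain n) :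
    inPolar f p = f ⟨polarPoint p, hp⟩ := dif_pos hp

theorem inDisc_apply {n : ℕ} (hn : n ≠ 0) (f : Omega n → MinkowskiSpace) {z : ℂ} (hz : ‖z‖ < 1) :
    inDisc f z = f ⟨iota z, iota_mem_Omega hz.le (pow_ne_one_of_norm_lt hn hz)⟩ := dif_pos _

theorem inPolar_extendedSurface {n : ℕ} {p : ℝ × ℝ} (hp : p ∈ polarDomain n) :
    inPolar (extendedSurface n) p = polarSurface n p := by
  rw [inPolar_apply _ hp, extendedSurface, extension_polarPoint]

theorem inDisc_extendedSurface {n : ℕ} (hn : 2 ≤ n) {z : ℂ} (hz : ‖z‖ < 1) :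
    inDisc (extendedSurface n) z = discSurface n z := by
  rw [inDisc_apply (by omega) _ hz, extendedSurface,
    extension_iota hn (pow_ne_one_of_norm_lt (by omega) hz)]

theorem inPolar_eventuallyEq {n : ℕ} {p : ℝ × ℝ} (hp : p ∈ polarDomain n) :
    inPolar (extendedSurface n) =ᶠ[nhds p] polarSurface n := by
  filter_upwards [(isOpen_polarDomain n).mem_nhds hp] with q hq using inPolar_extendedSurface hq

theorem inDisc_eventuallyEq {n : ℕ} (hn : 2 ≤ n) {z : ℂ} (hz : ‖z‖ < 1) :
    inDisc (extendedSurface n) =ᶠ[nhds z] discSurface n := by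
  have : Metric.ball (0 : ℂ) 1 ∈ nhds z := Metric.isOpen_ball.mem_nhds (by simpa using hz)
  filter_upwards [this] with w hw using inDisc_extendedSurface hn (by simpa using hw)

theorem isAnalyticExtension_extendedSurface {n : ℕ} (hn : 2 ≤ n) :
    IsAnalyticExtension (extendedSurface n) := by
  refine ⟨⟨fun p hp => ?_, fun z hz => ?_⟩, fun z hz hzn => ?_⟩
  · exact (analyticAt_polarSurface hp).congr (inPolar_eventuallyEq hp).symm
  · have hz' : ‖z‖ < 1 := by simpa using hz
    exact (analyticAt_discSurface (by omega) hz').congr (inDisc_eventuallyEq hn hz').symm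
  · rw [extendedSurface, extension_iota hn hzn, jorgeMeeksSurface_eq hn hz hzn]

/-- Where u > 1 both maps are prescribed through ι with |z| < 1. The identity theorem on the
connected polar domain does the rest, and p_∞ is the value at z = 0. -/
theorem IsAnalyticExtension.unique {n : ℕ} (hn : n ≠ 0) {f f' : Omega n → MinkowskiSpace}
    (hf : IsAnalyticExtension f) (hf' : IsAnalyticExtension f') : f' = f := by
  have h1 : ∀ p : ℝ × ℝ, 1 < p.1 → inPolar f' p = inPolar f p := fun p hp => by
    have h2 := iota_exp (Real.arcosh p.1) p.2
    rw [Real.cosh_arcosh hp.le] at h2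
    set z : ℂ := (Real.exp (-Real.arcosh p.1) : ℝ) * exp (p.2 * I)
    have hz : ‖z‖ < 1 := by
      rw [norm_exp_neg_mul, Real.exp_lt_one_iff, neg_lt_zero]
      exact Real.arcosh_pos hp
    have hzn := pow_ne_one_of_norm_lt hn hz
    have h3 := (hf'.2 z hz.le hzn).trans (hf.2 z hz.le hzn).symm
    rw [inPolar, inPolar, ← h2]
    simp only [extendByZero, dif_pos (iota_mem_Omega hz.le hzn)]
    exact h3
  have h4 : Set.EqOn (inPolar f') (inPolar f) (polarDomain n) := by
    refine AnalyticOnNhd.eqOn_of_preconnected_of_eventuallyEq hf'.1.1 hf.1.1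
      (isPreconnected_polarDomain n) (z₀ := (2, 0)) (mem_polarDomain_of_one_lt (by norm_num)) ?_
    have : {p : ℝ × ℝ | 1 < p.1} ∈ nhds ((2 : ℝ), (0 : ℝ)) :=
      (isOpen_lt continuous_const continuous_fst).mem_nhds (by norm_num [Set.mem_ofPred_eq])
    filter_upwards [this] with p hp using h1 p hp
  funext ⟨p, hp⟩
  by_cases hi : p = ∞
  · subst hi
    have h0 : ((0 : ℂ)) ^ n ≠ 1 := by simp [hn]
    have h5 := (hf'.2 0 (by simp) h0).trans (hf.2 0 (by simp) h0).symm
    simpa [iota] using h5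
  · obtain ⟨q, hq, rfl⟩ := exists_polarPoint_eq hp hi
    have := h4 hq
    rwa [inPolar_apply _ hq, inPolar_apply _ hq] at this

/-! ### Partial derivatives in the polar coordinates -/

/-- `∂/∂u` of `height`. -/
def heightU (n : ℕ) (u θ : ℝ) : ℝ :=
  ∑ j ∈ range n, -Real.sin (θ - node n j) / (u - Real.cos (θ - node n j)) ^ 2

/-- `∂/∂θ` of `height`. -/
def heightTheta (n : ℕ) (u θ : ℝ) : ℝ :=
  ∑ j ∈ range n, (Real.cos (θ - node n j) * (u - Real.cos (θ - node n j)) -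
    Real.sin (θ - node n j) ^ 2) / (u - Real.cos (θ - node n j)) ^ 2

/-- `∂/∂u` of `planar`. -/
def planarU (n : ℕ) (ψ u θ : ℝ) : ℝ :=
  ∑ j ∈ range n, (Real.cos (node n j - ψ) *
      (-Real.sin (θ - node n j) / (u - Real.cos (θ - node n j)) ^ 2) -
    (n - 1) * Real.sin (node n j - ψ) * (1 / (u - Real.cos (θ - node n j))))

/-- `∂/∂θ` of `planar`. -/
def planarTheta (n : ℕ) (ψ u θ : ℝ) : ℝ :=
  ∑ j ∈ range n, (Real.cos (node n j - ψ) *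
      ((Real.cos (θ - node n j) * (u - Real.cos (θ - node n j)) -
        Real.sin (θ - node n j) ^ 2) / (u - Real.cos (θ - node n j)) ^ 2) -
    (n - 1) * Real.sin (node n j - ψ) *
      (Real.sin (θ - node n j) / (u - Real.cos (θ - node n j))))

/-- The differential on `ℝ × ℝ` with the given partial derivatives. -/
def pairing (a b : ℝ) : ℝ × ℝ →L[ℝ] ℝ :=
  a • ContinuousLinearMap.fst ℝ ℝ ℝ + b • ContinuousLinearMap.snd ℝ ℝ ℝ

@[simp] theorem pairing_apply (a b : ℝ) (v : ℝ × ℝ) : pairing a b v = a * v.1 + b * v.2 := rfl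

theorem hasFDerivAt_fst_sub_cos (a : ℝ) (p : ℝ × ℝ) :
    HasFDerivAt (fun q : ℝ × ℝ => q.1 - Real.cos (q.2 - a)) (pairing 1 (Real.sin (p.2 - a))) p := by
  refine (hasFDerivAt_fst.fun_sub (hasFDerivAt_snd.sub_const a).cos).congr_fderiv ?_
  ext <;> simp

theorem hasFDerivAt_sin_div (a : ℝ) {p : ℝ × ℝ} (h : p.1 - Real.cos (p.2 - a) ≠ 0) :
    HasFDerivAt (fun q : ℝ × ℝ => Real.sin (q.2 - a) / (q.1 - Real.cos (q.2 - a)))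
      (pairing (-Real.sin (p.2 - a) / (p.1 - Real.cos (p.2 - a)) ^ 2)
        ((Real.cos (p.2 - a) * (p.1 - Real.cos (p.2 - a)) - Real.sin (p.2 - a) ^ 2) /
          (p.1 - Real.cos (p.2 - a)) ^ 2)) p := by
  have h1 := (hasFDerivAt_snd (𝕜 := ℝ) (p := p)).sub_const a |>.sin
  have h2 := h1.fun_mul ((hasDerivAt_inv h).comp_hasFDerivAt p (hasFDerivAt_fst_sub_cos a p))
  simp only [div_eq_mul_inv]
  refine h2.congr_fderiv ?_
  ext
  · simp
  · simp
    field_simp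
    ring

theorem hasFDerivAt_log_sub_cos (a : ℝ) {p : ℝ × ℝ} (h : p.1 - Real.cos (p.2 - a) ≠ 0) :
    HasFDerivAt (fun q : ℝ × ℝ => Real.log (q.1 - Real.cos (q.2 - a)))
      (pairing (1 / (p.1 - Real.cos (p.2 - a)))
        (Real.sin (p.2 - a) / (p.1 - Real.cos (p.2 - a)))) p := by
  refine ((hasFDerivAt_fst_sub_cos a p).log h).congr_fderiv ?_
  ext
  · simp
  · simp
    field_simp

theorem pairing_sum {ι : Type*} (s : Finset ι) (a b : ι → ℝ) :
    pairing (∑ i ∈ s, a i) (∑ i ∈ s, b i) = ∑ i ∈ s, pairing (a i) (b i) := by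
  ext <;> simp

theorem hasFDerivAt_height {n : ℕ} {p : ℝ × ℝ} (hp : p ∈ polarDomain n) :
    HasFDerivAt (fun q : ℝ × ℝ => height n q.1 q.2)
      (pairing (heightU n p.1 p.2) (heightTheta n p.1 p.2)) p := by
  rw [heightU, heightTheta, pairing_sum]
  exact HasFDerivAt.fun_sum fun j hj => hasFDerivAt_sin_div _
    (sub_pos.mpr (mem_polarDomain.mp hp j (mem_range.mp hj))).ne'

theorem hasFDerivAt_planar {n : ℕ} (ψ : ℝ) {p : ℝ × ℝ} (hp : p ∈ polarDomain n) :
    HasFDerivAt (fun q : ℝ × ℝ => planar n ψ q.1 q.2)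
      (pairing (planarU n ψ p.1 p.2) (planarTheta n ψ p.1 p.2)) p := by
  rw [planarU, planarTheta, pairing_sum]
  refine HasFDerivAt.fun_sum fun j hj => ?_
  have h := (sub_pos.mpr (mem_polarDomain.mp hp j (mem_range.mp hj))).ne'
  refine (((hasFDerivAt_sin_div _ h).const_mul _).fun_sub
    ((hasFDerivAt_log_sub_cos _ h).const_mul _)).congr_fderiv ?_
  ext <;> simp

theorem analyticAt_partials {n : ℕ} (ψ : ℝ) {p : ℝ × ℝ} (hp : p ∈ polarDomain n) :
    AnalyticAt ℝ (fun q : ℝ × ℝ => heightU n q.1 q.2) p ∧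
    AnalyticAt ℝ (fun q : ℝ × ℝ => heightTheta n q.1 q.2) p ∧
    AnalyticAt ℝ (fun q : ℝ × ℝ => planarU n ψ q.1 q.2) p ∧
    AnalyticAt ℝ (fun q : ℝ × ℝ => planarTheta n ψ q.1 q.2) p := by
  have hs := fun j => analyticAt_sin_snd_sub (node n j) p
  have hc := fun j => analyticAt_cos_snd_sub (node n j) p
  have hd := fun j => analyticAt_fst_sub_cos (node n j) p
  have h0 : ∀ j ∈ range n, p.1 - Real.cos (p.2 - node n j) ≠ 0 := fun j hj =>
    (sub_pos.mpr (mem_polarDomain.mp hp j (mem_range.mp hj))).ne'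
  have a1 := fun j hj => (hs j).fun_neg.fun_div ((hd j).fun_pow 2) (pow_ne_zero 2 (h0 j hj))
  have a2 := fun j hj => (((hc j).fun_mul (hd j)).fun_sub ((hs j).fun_pow 2)).fun_div
    ((hd j).fun_pow 2) (pow_ne_zero 2 (h0 j hj))
  have a3 := fun j hj => (analyticAt_const (v := (1 : ℝ))).fun_div (hd j) (h0 j hj)
  have a4 := fun j hj => (hs j).fun_div (hd j) (h0 j hj)
  exact ⟨Finset.analyticAt_fun_sum _ a1, Finset.analyticAt_fun_sum _ a2,
    Finset.analyticAt_fun_sum _ fun j hj => (analyticAt_const.mul (a1 j hj)).sub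
      (analyticAt_const.mul (a3 j hj)),
    Finset.analyticAt_fun_sum _ fun j hj => (analyticAt_const.mul (a2 j hj)).sub
      (analyticAt_const.mul (a4 j hj))⟩

/-! ### Closed formulas for the height and the Jacobian -/

/-- The point with coordinates `(cosh s, θ)` in the coordinate `z`. -/
def discPoint (s θ : ℝ) : ℂ := (Real.exp (-s) : ℝ) * exp (θ * I)

theorem discPoint_pow (s θ : ℝ) (k : ℕ) : discPoint s θ ^ k = discPoint (k * s) (k * θ) := by
  rw [discPoint, discPoint, mul_pow, ← ofReal_pow, ← Real.exp_nat_mul, ← exp_nat_mul]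
  push_cast
  ring_nf

theorem discPoint_re (s θ : ℝ) : (discPoint s θ).re = Real.exp (-s) * Real.cos θ := by
  rw [discPoint, re_ofReal_mul, exp_ofReal_mul_I_re]

theorem discPoint_im (s θ : ℝ) : (discPoint s θ).im = Real.exp (-s) * Real.sin θ := by
  rw [discPoint, im_ofReal_mul, exp_ofReal_mul_I_im]

theorem normSq_discPoint_sub_one (s θ : ℝ) :
    normSq (discPoint s θ - 1) = 2 * Real.exp (-s) * (Real.cosh s - Real.cos θ) := by
  rw [normSq_apply, sub_re, sub_im, one_re, one_im, discPoint_re, discPoint_im, Real.cosh_eq,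
    Real.exp_neg]
  have := Real.exp_ne_zero s
  field_simp
  linear_combination Real.sin_sq_add_cos_sq θ

theorem hasDerivAt_discPoint_left (s θ : ℝ) :
    HasDerivAt (fun s' => discPoint s' θ) (-discPoint s θ) s := by
  have h : HasDerivAt (fun s' : ℝ => Real.exp (-s')) (-Real.exp (-s)) s := by
    simpa using (hasDerivAt_neg s).exp
  simpa [discPoint] using h.ofReal_comp.mul_const (exp (θ * I))

theorem hasDerivAt_discPoint_right (s θ : ℝ) :
    HasDerivAt (fun θ' => discPoint s θ') (I * discPoint s θ) θ := by
  have h : HasDerivAt (fun θ' : ℝ => exp (θ' * I)) (exp (θ * I) * I) θ := by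
    simpa using ((hasDerivAt_id θ).ofReal_comp.mul_const I).cexp
  refine (h.const_mul ((Real.exp (-s) : ℝ) : ℂ)).congr_deriv ?_
  rw [discPoint]
  ring

theorem discPoint_mem {n : ℕ} {s θ : ℝ} (hs : 0 ≤ s) (hz : discPoint s θ ^ n ≠ 1) :
    (Real.cosh s, θ) ∈ polarDomain n := by
  have h := iota_exp s θ
  rw [polarDomain, Set.mem_ofPred_eq, ← h]
  refine iota_mem_Omega ?_ hz
  rw [norm_exp_neg_mul]
  exact Real.exp_le_one_iff.mpr (by linarith)

theorem cosh_eq_exp_neg (s : ℝ) : (Real.exp (-s) + (Real.exp (-s))⁻¹) / 2 = Real.cosh s := by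
  rw [← Real.exp_neg, neg_neg, Real.cosh_eq, add_comm]

theorem discHeight_discPoint (n : ℕ) (s θ : ℝ) :
    discHeight n (discPoint s θ) = height n (Real.cosh s) θ := by
  rw [discPoint, discHeight_polar n (Real.exp_pos _).ne', cosh_eq_exp_neg]

theorem discPlanar_discPoint {n : ℕ} (hn : 2 ≤ n) (ψ : ℝ) {s θ : ℝ} (hz : discPoint s θ ^ n ≠ 1) :
    discPlanar n ψ (discPoint s θ) = planar n ψ (Real.cosh s) θ := by
  rw [discPoint, discPlanar_polar hn ψ (Real.exp_pos _) θ hz, cosh_eq_exp_neg]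

/-- Chain rule for z = e^{-s+iθ}, u = cosh s: ∂z/∂s = -z, ∂z/∂θ = iz and du/ds = sinh s. -/
theorem partials_of_disc {n : ℕ} {G : ℂ → ℝ} {F : ℝ × ℝ → ℝ} {D : ℂ} {a b s θ : ℝ}
    (hz : discPoint s θ ^ n ≠ 1)
    (hG : HasFDerivAt G (reMul D) (discPoint s θ))
    (hF : HasFDerivAt F (pairing a b) (Real.cosh s, θ))
    (hGF : ∀ s' θ', discPoint s' θ' ^ n ≠ 1 → G (discPoint s' θ') = F (Real.cosh s', θ')) :
    a * Real.sinh s = -(D * discPoint s θ).re ∧ b = -(D * discPoint s θ).im := by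
  have d1 := hG.comp_hasDerivAt s (hasDerivAt_discPoint_left s θ)
  have d2 := hG.comp_hasDerivAt θ (hasDerivAt_discPoint_right s θ)
  have e1 := hF.comp_hasDerivAt s ((Real.hasDerivAt_cosh s).prodMk (hasDerivAt_const s θ))
  have e2 := hF.comp_hasDerivAt θ ((hasDerivAt_const θ (Real.cosh s)).prodMk (hasDerivAt_id θ))
  have c1 : ∀ᶠ s' in nhds s, discPoint s' θ ^ n ≠ 1 :=
    ((hasDerivAt_discPoint_left s θ).continuousAt.pow n).eventually_ne hz
  have c2 : ∀ᶠ θ' in nhds θ, discPoint s θ' ^ n ≠ 1 :=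
    ((hasDerivAt_discPoint_right s θ).continuousAt.pow n).eventually_ne hz
  have f1 := e1.unique (d1.congr_of_eventuallyEq (c1.mono fun s' h => (hGF s' θ h).symm))
  have f2 := e2.unique (d2.congr_of_eventuallyEq (c2.mono fun θ' h => (hGF s θ' h).symm))
  constructor
  · simpa using f1
  · have f3 : (D * (I * discPoint s θ)).re = -(D * discPoint s θ).im := by
      rw [mul_left_comm, I_mul_re]
    rw [← f3]
    simpa using f2

theorem height_partials_discPoint {n : ℕ} (hn : 2 ≤ n) {s θ : ℝ} (hs : 0 ≤ s)
    (hz : discPoint s θ ^ n ≠ 1) :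
    heightU n (Real.cosh s) θ * Real.sinh s = -(heightForm n (discPoint s θ) * discPoint s θ).re ∧
    heightTheta n (Real.cosh s) θ = -(heightForm n (discPoint s θ) * discPoint s θ).im := by
  have hF := hasFDerivAt_height (discPoint_mem hs hz)
  exact partials_of_disc hz (hasFDerivAt_discHeight hn hz) hF
    fun s' θ' _ => discHeight_discPoint n s' θ'

theorem planar_partials_discPoint {n : ℕ} (hn : 2 ≤ n) (ψ : ℝ) {s θ : ℝ} (hs : 0 ≤ s)
    (hz : discPoint s θ ^ n ≠ 1) :
    planarU n ψ (Real.cosh s) θ * Real.sinh s =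
      -(planarForm n ψ (discPoint s θ) * discPoint s θ).re ∧
    planarTheta n ψ (Real.cosh s) θ = -(planarForm n ψ (discPoint s θ) * discPoint s θ).im := by
  have hF := hasFDerivAt_planar ψ (discPoint_mem hs hz)
  exact partials_of_disc hz (hasFDerivAt_discPlanar hn ψ hz) hF
    fun s' θ' h => discPlanar_discPoint hn ψ h

/-- The common denominator `T_n(u) - cos nθ`. -/
def denom (n : ℕ) (u θ : ℝ) : ℝ := (Polynomial.Chebyshev.T ℝ n).eval u - Real.cos (n * θ)

/-- The Chebyshev polynomial `U_{n-2}`. -/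
def chebU (n : ℕ) (u : ℝ) : ℝ := (Polynomial.Chebyshev.U ℝ (n - 2)).eval u

theorem denom_cosh (n : ℕ) (s θ : ℝ) :
    denom n (Real.cosh s) θ = Real.cosh (n * s) - Real.cos (n * θ) := by
  rw [denom, Polynomial.Chebyshev.T_real_cosh]
  simp

theorem chebU_cosh (n : ℕ) (s : ℝ) :
    chebU n (Real.cosh s) * Real.sinh s = Real.sinh ((n - 1) * s) := by
  rw [chebU, Polynomial.Chebyshev.U_real_cosh]
  congr 1
  push_cast
  ring

theorem normSq_discPoint_pow_sub_one (n : ℕ) (s θ : ℝ) :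
    normSq (discPoint s θ ^ n - 1) = 2 * Real.exp (-(n * s)) * denom n (Real.cosh s) θ := by
  rw [discPoint_pow, normSq_discPoint_sub_one, denom_cosh]

theorem height_mul_denom_cosh {n : ℕ} (hn : 2 ≤ n) {s θ : ℝ} (hz : discPoint s θ ^ n ≠ 1) :
    height n (Real.cosh s) θ * denom n (Real.cosh s) θ = n * Real.sin (n * θ) := by
  have h0 : normSq (discPoint s θ ^ n - 1) ≠ 0 := fun h =>
    sub_ne_zero.mpr hz (normSq_eq_zero.mp h)
  have h1 := sum_zeta_pow_div_sub (n := n) (k := 0) (by omega) hz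
  simp only [zero_add, pow_one, pow_zero, mul_one] at h1
  rw [← discHeight_discPoint, discHeight, ← mul_sum, ← im_sum, h1, div_im, natCast_re, natCast_im]
  have h2 : (discPoint s θ ^ n - 1).im = Real.exp (-(n * s)) * Real.sin (n * θ) := by
    rw [discPoint_pow, sub_im, discPoint_im, one_im, sub_zero]
  rw [h2, normSq_discPoint_pow_sub_one] 
  rw [normSq_discPoint_pow_sub_one] at h0
  have h3 := right_ne_zero_of_mul h0
  have h4 := Real.exp_ne_zero (-(n * s))
  field_simp
  ring

/-- By `partials_of_disc`, the Jacobian times sinh s is Im(ā b), where a and b are the two forms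
multiplied by z. This contains sinh((n-1)s) = U_{n-2}(cosh s) sinh s, so sinh s cancels and a
formula polynomial in u remains, meaningful for u ≤ 1 too. -/
theorem jacobian_cosh {n : ℕ} (hn : 2 ≤ n) (ψ : ℝ) {s θ : ℝ} (hs : 0 < s) :
    (heightU n (Real.cosh s) θ * planarTheta n ψ (Real.cosh s) θ -
      heightTheta n (Real.cosh s) θ * planarU n ψ (Real.cosh s) θ) * denom n (Real.cosh s) θ ^ 2 =
    -(n ^ 4 * chebU n (Real.cosh s) * Real.sin ((n - 1) * θ + ψ)) := by
  have hz : discPoint s θ ^ n ≠ 1 := pow_ne_one_of_norm_lt (by omega) (by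
    rw [discPoint, norm_exp_neg_mul, Real.exp_lt_one_iff]; linarith)
  have h0 : normSq (discPoint s θ ^ n - 1) ≠ 0 := fun h =>
    sub_ne_zero.mpr hz (normSq_eq_zero.mp h)
  obtain ⟨t1, t2⟩ := height_partials_discPoint hn hs.le hz
  obtain ⟨p1, p2⟩ := planar_partials_discPoint hn ψ hs.le hz
  set a := heightForm n (discPoint s θ) * discPoint s θ with ha
  set b := planarForm n ψ (discPoint s θ) * discPoint s θ with hb
  have hsinh : Real.sinh s ≠ 0 := (Real.sinh_pos_iff.mpr hs).ne'
  have e1 : (starRingEnd ℂ a * b).im * denom n (Real.cosh s) θ ^ 2 =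
      -(n ^ 4 * Real.sinh ((n - 1) * s) * Real.sin ((n - 1) * θ + ψ)) := by
    have e2 : starRingEnd ℂ a * b = ((2 * n ^ 4 / normSq (discPoint s θ ^ n - 1) ^ 2 : ℝ) : ℂ) *
        (starRingEnd ℂ (discPoint s θ ^ n) *
          (exp (ψ * I) * discPoint s θ ^ (2 * n - 1) + exp (-(ψ * I)) * discPoint s θ)) := by
      have hw := sub_ne_zero.mpr hz
      have hw' : starRingEnd ℂ (discPoint s θ ^ n - 1) ≠ 0 :=
        (map_ne_zero (starRingEnd ℂ)).mpr hw
      rw [ha, hb, heightForm, planarForm]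
      push_cast
      rw [normSq_eq_conj_mul_self]
      simp only [map_mul, map_div₀, map_pow, map_neg, conj_I, map_natCast, map_ofNat]
      simp only [map_sub, map_one, map_pow] at hw' ⊢
      obtain ⟨m, rfl⟩ : ∃ m, n = m + 1 := ⟨n - 1, by omega⟩
      simp only [show 2 * (m + 1) - 1 = 2 * m + 1 by omega, show m + 1 - 1 = m by omega]
      field_simp
      ring_nf
      simp only [I_sq]
      ring
    have e3 : (starRingEnd ℂ (discPoint s θ ^ n) *
          (exp (ψ * I) * discPoint s θ ^ (2 * n - 1) + exp (-(ψ * I)) * discPoint s θ)).im =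
        -2 * Real.exp (-(n * s)) ^ 2 * Real.sinh ((n - 1) * s) * Real.sin ((n - 1) * θ + ψ) := by
      have e4 : starRingEnd ℂ (discPoint s θ ^ n) *
          (exp (ψ * I) * discPoint s θ ^ (2 * n - 1) + exp (-(ψ * I)) * discPoint s θ) =
          (Real.exp (-((3 * n - 1) * s)) : ℝ) * exp (((n - 1) * θ + ψ : ℝ) * I) +
          (Real.exp (-((n + 1) * s)) : ℝ) * exp ((-((n - 1) * θ + ψ) : ℝ) * I) := by
        simp only [discPoint_pow]
        simp only [discPoint, map_mul, conj_ofReal, ← exp_conj, conj_I]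
        simp only [ofReal_exp, mul_add, ← exp_add]
        push_cast [Nat.cast_sub (show 1 ≤ 2 * n by omega)]
        congr 2 <;> ring
      rw [e4, add_im, im_ofReal_mul, im_ofReal_mul, exp_ofReal_mul_I_im, exp_ofReal_mul_I_im,
        Real.sin_neg, Real.sinh_eq, ← Real.exp_nat_mul,
        show -((3 * n - 1) * s) = (2 : ℕ) * -(n * s) + -((n - 1) * s) by push_cast; ring,
        show -((n + 1) * s) = (2 : ℕ) * -(n * s) + (n - 1) * s by push_cast; ring,
        Real.exp_add, Real.exp_add]
      ring
    rw [e2, im_ofReal_mul, e3, normSq_discPoint_pow_sub_one]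
    rw [normSq_discPoint_pow_sub_one] at h0
    have h3 := right_ne_zero_of_mul h0
    have h4 := Real.exp_ne_zero (-(n * s))
    field_simp
  rw [mul_im, conj_re, conj_im] at e1
  have e5 := chebU_cosh n s
  apply mul_right_cancel₀ hsinh
  rw [← e5] at e1
  rw [p2, t2]
  linear_combination e1 - b.im * denom n (Real.cosh s) θ ^ 2 * t1 + a.im * denom n (Real.cosh s) θ ^ 2 * p1

theorem analyticAt_polynomial_fst (P : Polynomial ℝ) (p : ℝ × ℝ) :
    AnalyticAt ℝ (fun q : ℝ × ℝ => P.eval q.1) p := by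
  simpa using (analyticAt_fst (𝕜 := ℝ) (p := p)).aeval_polynomial P

theorem analyticAt_denom (n : ℕ) (p : ℝ × ℝ) :
    AnalyticAt ℝ (fun q : ℝ × ℝ => denom n q.1 q.2) p :=
  (analyticAt_polynomial_fst _ p).sub (Real.analyticAt_cos.comp (g := Real.cos)
    (f := fun q : ℝ × ℝ => (n : ℝ) * q.2) (analyticAt_const.mul analyticAt_snd))

/-- Carries identities computed in the disc, hence only for u > 1, to the whole domain by the
identity theorem. -/
theorem eqOn_polarDomain_of_cosh {n : ℕ} {A B : ℝ × ℝ → ℝ}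
    (hA : ∀ p ∈ polarDomain n, AnalyticAt ℝ A p) (hB : ∀ p ∈ polarDomain n, AnalyticAt ℝ B p)
    (h : ∀ s θ, 0 < s → A (Real.cosh s, θ) = B (Real.cosh s, θ)) :
    ∀ p ∈ polarDomain n, A p = B p := by
  refine AnalyticOnNhd.eqOn_of_preconnected_of_eventuallyEq hA hB
    (isPreconnected_polarDomain n) (z₀ := (2, 0)) (mem_polarDomain_of_one_lt (by norm_num)) ?_
  have : {p : ℝ × ℝ | 1 < p.1} ∈ nhds ((2 : ℝ), (0 : ℝ)) :=
    (isOpen_lt continuous_const continuous_fst).mem_nhds (by norm_num [Set.mem_ofPred_eq])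
  filter_upwards [this] with p hp
  have hp' : 1 < p.1 := hp
  have h1 := h (Real.arcosh p.1) p.2 (Real.arcosh_pos hp')
  rwa [Real.cosh_arcosh hp'.le] at h1

theorem height_mul_denom {n : ℕ} (hn : 2 ≤ n) {p : ℝ × ℝ} (hp : p ∈ polarDomain n) :
    height n p.1 p.2 * denom n p.1 p.2 = n * Real.sin (n * p.2) := by
  refine eqOn_polarDomain_of_cosh (n := n) (A := fun q => height n q.1 q.2 * denom n q.1 q.2)
    (B := fun q => n * Real.sin (n * q.2)) (fun q hq => ?_) (fun q _ => ?_) (fun s θ hs => ?_) p hp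
  · exact (analyticAt_height hq).mul (analyticAt_denom n q)
  · exact analyticAt_const.mul (Real.analyticAt_sin.comp (g := Real.sin)
      (f := fun q : ℝ × ℝ => (n : ℝ) * q.2) (analyticAt_const.mul analyticAt_snd))
  · refine height_mul_denom_cosh hn (pow_ne_one_of_norm_lt (by omega) ?_)
    rw [discPoint, norm_exp_neg_mul, Real.exp_lt_one_iff]
    linarith

theorem jacobian_mul_denom_sq {n : ℕ} (hn : 2 ≤ n) (ψ : ℝ) {p : ℝ × ℝ} (hp : p ∈ polarDomain n) :
    (heightU n p.1 p.2 * planarTheta n ψ p.1 p.2 - heightTheta n p.1 p.2 * planarU n ψ p.1 p.2) *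
      denom n p.1 p.2 ^ 2 = -(n ^ 4 * chebU n p.1 * Real.sin ((n - 1) * p.2 + ψ)) := by
  refine eqOn_polarDomain_of_cosh (n := n)
    (A := fun q => (heightU n q.1 q.2 * planarTheta n ψ q.1 q.2 -
      heightTheta n q.1 q.2 * planarU n ψ q.1 q.2) * denom n q.1 q.2 ^ 2)
    (B := fun q => -(n ^ 4 * chebU n q.1 * Real.sin ((n - 1) * q.2 + ψ)))
    (fun q hq => ?_) (fun q _ => ?_) (fun s θ hs => jacobian_cosh hn ψ hs) p hp
  · obtain ⟨h1, h2, h3, h4⟩ := analyticAt_partials ψ hq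
    exact ((h1.mul h4).sub (h2.mul h3)).mul ((analyticAt_denom n q).pow 2)
  · exact ((analyticAt_const.mul (analyticAt_polynomial_fst _ q)).mul
      (Real.analyticAt_sin.comp (g := Real.sin) (f := fun q : ℝ × ℝ => ((n : ℝ) - 1) * q.2 + ψ)
        ((analyticAt_const.mul analyticAt_snd).add analyticAt_const))).neg

/-! ### Dihedral symmetries -/

theorem node_succ {n : ℕ} (j : ℕ) : node n (j + 1) = node n j + 2 * Real.pi / n := by
  rw [node, node]
  push_cast
  ring

theorem node_self {n : ℕ} (hn : n ≠ 0) : node n n = 2 * Real.pi := by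
  rw [node]
  field_simp

theorem node_zero (n : ℕ) : node n 0 = 0 := by simp [node]

theorem sum_range_succ_eq_of_periodic {n : ℕ} {φ : ℕ → ℝ} (h : φ n = φ 0) :
    ∑ j ∈ range n, φ (j + 1) = ∑ j ∈ range n, φ j := by
  have h1 := sum_range_succ φ n
  have h2 := sum_range_succ' φ n
  linarith

/-- Rotation by 2π/n permutes the nodes, so it shifts the summation index cyclically and only the
direction ψ changes. -/
theorem planar_add_two_pi_div {n : ℕ} (hn : n ≠ 0) (ψ u θ : ℝ) :
    planar n ψ u (θ + 2 * Real.pi / n) = planar n (ψ - 2 * Real.pi / n) u θ := by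
  unfold planar
  rw [← sum_range_succ_eq_of_periodic]
  · refine sum_congr rfl fun j _ => ?_
    rw [node_succ, show θ + 2 * Real.pi / n - (node n j + 2 * Real.pi / n) = θ - node n j by ring,
      show node n j + 2 * Real.pi / n - ψ = node n j - (ψ - 2 * Real.pi / n) by ring]
  · simp only [node_self hn, node_zero, sub_zero, Real.sin_sub_two_pi, Real.cos_sub_two_pi]
    rw [show 2 * Real.pi - ψ = 0 - ψ + 2 * Real.pi by ring, Real.sin_add_two_pi,
      Real.cos_add_two_pi]

theorem planar_add_int {n : ℕ} (hn : n ≠ 0) (ψ u θ : ℝ) (k : ℤ) :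
    planar n ψ u (θ + 2 * Real.pi * k / n) = planar n (ψ - 2 * Real.pi * k / n) u θ := by
  induction k generalizing ψ with
  | zero => simp
  | succ i ih =>
    have h := planar_add_two_pi_div hn ψ u (θ + 2 * Real.pi * (i : ℤ) / n)
    rw [ih] at h
    push_cast at h ⊢
    ring_nf at h ⊢
    exact h
  | pred i ih =>
    have h := planar_add_two_pi_div hn (ψ + 2 * Real.pi / n) u
      (θ + 2 * Real.pi * (-(i : ℤ) - 1 : ℤ) / n)
    rw [add_sub_cancel_right] at h
    rw [← h]
    have h2 := ih (ψ + 2 * Real.pi / n)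
    push_cast at h2 ⊢
    ring_nf at h2 ⊢
    exact h2

theorem height_add_two_pi_div {n : ℕ} (hn : n ≠ 0) (u θ : ℝ) :
    height n u (θ + 2 * Real.pi / n) = height n u θ := by
  unfold height
  rw [← sum_range_succ_eq_of_periodic]
  · refine sum_congr rfl fun j _ => ?_
    rw [node_succ, show θ + 2 * Real.pi / n - (node n j + 2 * Real.pi / n) = θ - node n j by ring]
  · simp only [node_self hn, node_zero, sub_zero, Real.sin_sub_two_pi, Real.cos_sub_two_pi]

theorem height_add_int {n : ℕ} (hn : n ≠ 0) (u θ : ℝ) (k : ℤ) :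
    height n u (θ + 2 * Real.pi * k / n) = height n u θ := by
  induction k with
  | zero => simp
  | succ i ih =>
    have h := height_add_two_pi_div hn u (θ + 2 * Real.pi * (i : ℤ) / n)
    rw [ih] at h
    push_cast at h ⊢
    ring_nf at h ⊢
    exact h
  | pred i ih =>
    have h := height_add_two_pi_div hn u (θ + 2 * Real.pi * (-(i : ℤ) - 1 : ℤ) / n)
    rw [← h]
    push_cast at ih ⊢
    ring_nf at ih ⊢
    exact ih

/-- Modulo 2π, the set of nodes is invariant under x ↦ -x, through j ↦ n - j. -/
theorem sum_node_neg {n : ℕ} (hn : n ≠ 0) {φ : ℝ → ℝ} (hφ : ∀ x, φ (2 * Real.pi - x) = φ (-x)) :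
    ∑ j ∈ range n, φ (node n j) = ∑ j ∈ range n, φ (-node n j) := by
  have h0 : φ (node n n) = φ (node n 0) := by
    have := hφ 0
    rwa [sub_zero, neg_zero, ← node_self hn, ← node_zero n] at this
  rw [← sum_range_succ_eq_of_periodic (φ := fun j => φ (node n j)) h0,
    ← sum_range_reflect]
  refine sum_congr rfl fun j hj => ?_
  have hj' := mem_range.mp hj
  rw [← hφ]
  congr 1
  rw [show n - 1 - j + 1 = n - j by omega, ← node_self hn, node, node, node,
    Nat.cast_sub hj'.le]
  ring

theorem planar_neg {n : ℕ} (hn : n ≠ 0) (ψ u θ : ℝ) :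
    planar n ψ u (-θ) = -planar n (-ψ) u θ := by
  unfold planar
  rw [sum_node_neg hn (φ := fun x => Real.cos (x - ψ) *
      (Real.sin (-θ - x) / (u - Real.cos (-θ - x))) -
    (n - 1) * Real.sin (x - ψ) * Real.log (u - Real.cos (-θ - x))), ← sum_neg_distrib]
  · refine sum_congr rfl fun j _ => ?_
    rw [show -θ - -node n j = -(θ - node n j) by ring, show -node n j - ψ = -(node n j - -ψ) by ring]
    simp only [Real.sin_neg, Real.cos_neg]
    ring
  · intro x
    rw [show 2 * Real.pi - x - ψ = -x - ψ + 2 * Real.pi by ring,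
      show -θ - (2 * Real.pi - x) = -θ - -x - 2 * Real.pi by ring]
    simp only [Real.sin_add_two_pi, Real.cos_add_two_pi, Real.sin_sub_two_pi, Real.cos_sub_two_pi]

theorem height_neg {n : ℕ} (hn : n ≠ 0) (u θ : ℝ) : height n u (-θ) = -height n u θ := by
  unfold height
  rw [sum_node_neg hn (φ := fun x => Real.sin (-θ - x) / (u - Real.cos (-θ - x))),
    ← sum_neg_distrib]
  · refine sum_congr rfl fun j _ => ?_
    rw [show -θ - -node n j = -(θ - node n j) by ring]
    simp only [Real.sin_neg, Real.cos_neg]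
    ring
  · intro x
    rw [show -θ - (2 * Real.pi - x) = -θ - -x - 2 * Real.pi by ring]
    simp only [Real.sin_sub_two_pi, Real.cos_sub_two_pi]

theorem planar_eq_comb (n : ℕ) (ψ u θ : ℝ) :
    planar n ψ u θ = Real.cos ψ * planar n 0 u θ - Real.sin ψ * planar n (-(Real.pi / 2)) u θ := by
  unfold planar
  rw [mul_sum, mul_sum, ← sum_sub_distrib]
  refine sum_congr rfl fun j _ => ?_
  rw [sub_neg_eq_add, Real.cos_add_pi_div_two, Real.sin_add_pi_div_two, sub_zero,
    Real.cos_sub (node n j) ψ, Real.sin_sub (node n j) ψ]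
  ring

/-! ### Chebyshev polynomials, positivity and signs -/

theorem exists_near_node {n : ℕ} (hn : n ≠ 0) (θ : ℝ) :
    ∃ j < n, ∃ m : ℤ, ∃ β, |β| ≤ Real.pi / n ∧ θ = β + node n j + m * (2 * Real.pi) := by
  have hn' : (0 : ℝ) < n := by positivity
  have hpi := Real.pi_pos
  set k : ℤ := round (θ * n / (2 * Real.pi)) with hk
  have h1 := abs_sub_round (θ * n / (2 * Real.pi))
  rw [← hk] at h1
  have hnz : (0 : ℤ) < n := by positivity
  have hmod := Int.emod_nonneg k hnz.ne'
  have hlt := Int.emod_lt_of_pos k hnz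
  refine ⟨(k % n).toNat, by omega, k / n, θ - 2 * Real.pi * k / n, ?_, ?_⟩
  · have h2 : θ - 2 * Real.pi * k / n = (2 * Real.pi / n) * (θ * n / (2 * Real.pi) - k) := by
      field_simp
    rw [h2, abs_mul, abs_of_pos (by positivity)]
    calc 2 * Real.pi / n * |θ * n / (2 * Real.pi) - k| ≤ 2 * Real.pi / n * (1 / 2) := by gcongr
      _ = Real.pi / n := by ring
  · have h3 : (((k % n).toNat : ℕ) : ℝ) = ((k % n : ℤ) : ℝ) := by
      exact_mod_cast congrArg (fun x : ℤ => (x : ℝ)) (Int.toNat_of_nonneg hmod)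
    have h4 : (k : ℝ) = ((k % n : ℤ) : ℝ) + n * ((k / n : ℤ) : ℝ) := by
      exact_mod_cast (Int.emod_add_mul_ediv k n).symm
    rw [node, h3, h4]
    field_simp
    ring

theorem cos_pi_div_le_cos {n : ℕ} (hn : n ≠ 0) {β : ℝ} (hβ : |β| ≤ Real.pi / n) :
    Real.cos (Real.pi / n) ≤ Real.cos β := by
  rw [← Real.cos_abs β]
  have h1 : (1 : ℝ) ≤ n := by exact_mod_cast Nat.one_le_iff_ne_zero.mpr hn
  exact Real.cos_le_cos_of_nonneg_of_le_pi (abs_nonneg _)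
    (div_le_self Real.pi_pos.le h1) hβ

theorem cos_pi_div_lt_of_mem {n : ℕ} (hn : n ≠ 0) {p : ℝ × ℝ} (hp : p ∈ polarDomain n) :
    Real.cos (Real.pi / n) < p.1 := by
  obtain ⟨j, hj, m, β, hβ, hθ⟩ := exists_near_node hn p.2
  refine (cos_pi_div_le_cos hn hβ).trans_lt ?_
  have := mem_polarDomain.mp hp j hj
  rwa [hθ, show β + node n j + m * (2 * Real.pi) - node n j = β + m * (2 * Real.pi) by ring,
    Real.cos_add_int_mul_two_pi] at this

/-- U_k(cos α) = sin((k+1)α)/sin α, and α < π/n keeps (k+1)α below π. For u > 1 the same quotient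
has hyperbolic sines, and U_k(1) = k + 1. -/
theorem chebyshevU_pos {n k : ℕ} (hk : k < n) {u : ℝ} (hu : Real.cos (Real.pi / n) < u) :
    0 < (Polynomial.Chebyshev.U ℝ k).eval u := by
  have hn : (0 : ℝ) < n := by exact_mod_cast (Nat.zero_le k).trans_lt hk
  rcases lt_trichotomy u 1 with h | h | h
  · have h0 : -1 ≤ u := (Real.neg_one_le_cos _).trans hu.le
    have h1 := Real.cos_arccos h0 h.le
    have hpos : 0 < Real.arccos u := Real.arccos_pos.mpr h
    have hlt : Real.arccos u < Real.pi / n := by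
      by_contra! hcon
      have h2 := Real.cos_le_cos_of_nonneg_of_le_pi (by positivity) (Real.arccos_le_pi u) hcon
      rw [h1] at h2
      linarith
    have h2 := Polynomial.Chebyshev.U_real_cos (Real.arccos u) k
    rw [h1] at h2
    have hk' : ((k : ℝ) + 1) ≤ n := by exact_mod_cast hk
    have h3 : 0 < Real.sin (Real.arccos u) :=
      Real.sin_pos_of_pos_of_lt_pi hpos (hlt.trans_le (div_le_self Real.pi_pos.le
        (by linarith [(Nat.cast_nonneg k : (0 : ℝ) ≤ k)])))
    have h4 : 0 < Real.sin (((k : ℤ) + 1) * Real.arccos u) := by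
      refine Real.sin_pos_of_pos_of_lt_pi (by positivity) ?_
      rw [Int.cast_natCast]
      calc ((k : ℝ) + 1) * Real.arccos u ≤ n * Real.arccos u := by gcongr
        _ < n * (Real.pi / n) := by gcongr
        _ = Real.pi := by field_simp
    rw [← h2] at h4
    exact pos_of_mul_pos_left h4 h3.le
  · rw [h, Polynomial.Chebyshev.U_eval_one]
    positivity
  · have h2 := Polynomial.Chebyshev.U_real_cosh (Real.arcosh u) k
    rw [Real.cosh_arcosh h.le] at h2
    have h3 : 0 < Real.sinh (Real.arcosh u) := Real.sinh_pos_iff.mpr (Real.arcosh_pos h)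
    have h4 : 0 < Real.sinh (((k : ℤ) + 1) * Real.arcosh u) := by
      rw [Real.sinh_pos_iff]
      have := Real.arcosh_pos h
      positivity
    rw [← h2] at h4
    exact pos_of_mul_pos_left h4 h3.le

theorem chebU_pos {n : ℕ} (hn : 2 ≤ n) {u : ℝ} (hu : Real.cos (Real.pi / n) < u) :
    0 < chebU n u := by
  have h := chebyshevU_pos (n := n) (k := n - 2) (by omega) hu
  rwa [Nat.cast_sub hn] at h

/-- The Chebyshev polynomial `T_n`, as a function. -/
def chebT (n : ℕ) (u : ℝ) : ℝ := (Polynomial.Chebyshev.T ℝ n).eval u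

/-- The derivative of `chebT`. -/
def chebTDeriv (n : ℕ) (u : ℝ) : ℝ := n * (Polynomial.Chebyshev.U ℝ (n - 1)).eval u

theorem hasDerivAt_chebT (n : ℕ) (u : ℝ) : HasDerivAt (chebT n) (chebTDeriv n u) u := by
  have h := (Polynomial.Chebyshev.T ℝ n).hasDerivAt u
  rw [Polynomial.Chebyshev.T_derivative_eq_U] at h
  refine HasDerivAt.congr_deriv (f := chebT n) h ?_
  simp [chebTDeriv]

theorem chebTDeriv_pos {n : ℕ} (hn : n ≠ 0) {u : ℝ} (hu : Real.cos (Real.pi / n) < u) :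
    0 < chebTDeriv n u := by
  have h := chebyshevU_pos (n := n) (k := n - 1) (by omega) hu
  rw [Nat.cast_sub (by omega), Nat.cast_one] at h
  have : (0 : ℝ) < n := by positivity
  exact mul_pos this h

theorem continuous_chebT (n : ℕ) : Continuous (chebT n) := (Polynomial.Chebyshev.T ℝ n).continuous

theorem strictMonoOn_chebT {n : ℕ} (hn : n ≠ 0) :
    StrictMonoOn (chebT n) (Set.Ici (Real.cos (Real.pi / n))) := by
  refine strictMonoOn_of_deriv_pos (convex_Ici _) (continuous_chebT n).continuousOn fun u hu => ?_
  rw [interior_Ici] at hu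
  rw [(hasDerivAt_chebT n u).deriv]
  exact chebTDeriv_pos hn hu

theorem chebT_cos (n : ℕ) (β : ℝ) : chebT n (Real.cos β) = Real.cos (n * β) := by
  rw [chebT, Polynomial.Chebyshev.T_real_cos]
  simp

theorem denom_eq (n : ℕ) (u θ : ℝ) : denom n u θ = chebT n u - Real.cos (n * θ) := rfl

/-- If β is the offset of θ from a nearest node, then u > cos β ≥ cos(π/n). T_n is strictly
increasing from cos(π/n) on, so T_n(u) > T_n(cos β) = cos nβ = cos nθ. -/
theorem denom_pos {n : ℕ} (hn : n ≠ 0) {p : ℝ × ℝ} (hp : p ∈ polarDomain n) :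
    0 < denom n p.1 p.2 := by
  obtain ⟨j, hj, m, β, hβ, hθ⟩ := exists_near_node hn p.2
  have h1 := mem_polarDomain.mp hp j hj
  rw [hθ, show β + node n j + m * (2 * Real.pi) - node n j = β + m * (2 * Real.pi) by ring,
    Real.cos_add_int_mul_two_pi] at h1
  have h2 := strictMonoOn_chebT hn (cos_pi_div_le_cos hn hβ) (cos_pi_div_lt_of_mem hn hp).le h1
  rw [chebT_cos] at h2
  have h3 : Real.cos (n * p.2) = Real.cos (n * β) := by
    rw [hθ, show (n : ℝ) * (β + node n j + m * (2 * Real.pi)) =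
      n * β + ((j + n * m : ℤ) : ℝ) * (2 * Real.pi) by
        rw [node]; push_cast; field_simp; ring, Real.cos_add_int_mul_two_pi]
  rw [denom_eq, h3]
  linarith

theorem height_pos_iff {n : ℕ} (hn : 2 ≤ n) {p : ℝ × ℝ} (hp : p ∈ polarDomain n) :
    0 < height n p.1 p.2 ↔ 0 < Real.sin (n * p.2) := by
  have h1 := denom_pos (by omega) hp
  have h2 := height_mul_denom hn hp
  have hn' : (0 : ℝ) < n := by positivity
  rw [← mul_pos_iff_of_pos_right h1, h2, mul_pos_iff_of_pos_left hn']

theorem height_eq_zero_iff {n : ℕ} (hn : 2 ≤ n) {p : ℝ × ℝ} (hp : p ∈ polarDomain n) :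
    height n p.1 p.2 = 0 ↔ Real.sin (n * p.2) = 0 := by
  have h1 := denom_pos (by omega) hp
  have h2 := height_mul_denom hn hp
  have hn' : (n : ℝ) ≠ 0 := by positivity
  constructor
  · intro h
    rw [h, zero_mul] at h2
    simpa [hn'] using h2.symm
  · intro h
    rw [h, mul_zero] at h2
    exact (mul_eq_zero.mp h2).resolve_right h1.ne'

theorem jacobian_eq {n : ℕ} (hn : 2 ≤ n) (ψ : ℝ) {p : ℝ × ℝ} (hp : p ∈ polarDomain n) :
    heightU n p.1 p.2 * planarTheta n ψ p.1 p.2 - heightTheta n p.1 p.2 * planarU n ψ p.1 p.2 =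
      -(n ^ 4 * chebU n p.1 / denom n p.1 p.2 ^ 2) * Real.sin ((n - 1) * p.2 + ψ) := by
  have h1 := (denom_pos (by omega) hp).ne'
  have h2 := jacobian_mul_denom_sq hn ψ hp
  rw [eq_comm, ← mul_left_inj' (pow_ne_zero 2 h1), h2]
  field_simp

theorem jacobianFactor_pos {n : ℕ} (hn : 2 ≤ n) {p : ℝ × ℝ} (hp : p ∈ polarDomain n) :
    0 < n ^ 4 * chebU n p.1 / denom n p.1 p.2 ^ 2 := by
  have h1 := denom_pos (by omega) hp
  have h2 := chebU_pos hn (cos_pi_div_lt_of_mem (by omega) hp)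
  positivity

/-- The product of `height` and `denom` does not depend on u; differentiate it. -/
theorem heightU_mul_denom {n : ℕ} (hn : 2 ≤ n) {p : ℝ × ℝ} (hp : p ∈ polarDomain n) :
    heightU n p.1 p.2 * denom n p.1 p.2 = -(height n p.1 p.2 * chebTDeriv n p.1) := by
  have hι : HasDerivAt (fun u : ℝ => (u, p.2)) ((1 : ℝ), (0 : ℝ)) p.1 :=
    (hasDerivAt_id _).prodMk (hasDerivAt_const _ _)
  have d1 : HasDerivAt (fun u => height n u p.2) (heightU n p.1 p.2) p.1 := by
    have := (hasFDerivAt_height hp).comp_hasDerivAt p.1 hι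
    refine HasDerivAt.congr_deriv (f := fun u => height n u p.2) this ?_
    simp
  have d2 : HasDerivAt (fun u => denom n u p.2) (chebTDeriv n p.1) p.1 :=
    (hasDerivAt_chebT n p.1).sub_const _
  have d3 := d1.fun_mul d2
  have hev : ∀ᶠ u in nhds p.1, (u, p.2) ∈ polarDomain n :=
    hι.continuousAt.eventually_mem ((isOpen_polarDomain n).mem_nhds hp)
  have d4 : HasDerivAt (fun u => height n u p.2 * denom n u p.2) 0 p.1 :=
    (hasDerivAt_const p.1 ((n : ℝ) * Real.sin (n * p.2))).congr_of_eventuallyEq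
      (hev.mono fun u hu => height_mul_denom hn hu)
  have := d3.unique d4
  linarith

theorem heightU_neg {n : ℕ} (hn : 2 ≤ n) {p : ℝ × ℝ} (hp : p ∈ polarDomain n)
    (h : 0 < height n p.1 p.2) : heightU n p.1 p.2 < 0 := by
  have h1 := denom_pos (by omega) hp
  have h2 := heightU_mul_denom hn hp
  have h3 := chebTDeriv_pos (by omega) (cos_pi_div_lt_of_mem (by omega) hp)
  by_contra! hc
  have := mul_nonneg hc h1.le
  have := mul_pos h h3
  linarith

/-! ### Immersion -/

theorem isImmersive_extendedSurface {n : ℕ} (hn : 2 ≤ n) : IsImmersive (extendedSurface n) := by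
  have hn2 : ((n : ℝ) ^ 2)⁻¹ ≠ 0 := by positivity
  refine ⟨fun p hp => ?_, fun z hz => ?_⟩
  · have hp' : p ∈ polarDomain n := hp
    rw [(inPolar_eventuallyEq hp').fderiv_eq]
    have hd : HasFDerivAt (polarSurface n) (ContinuousLinearMap.pi fun k => ((n : ℝ) ^ 2)⁻¹ •
        (![pairing (heightU n p.1 p.2) (heightTheta n p.1 p.2),
          -pairing (planarU n 0 p.1 p.2) (planarTheta n 0 p.1 p.2),
          -pairing (planarU n (-(Real.pi / 2)) p.1 p.2)
            (planarTheta n (-(Real.pi / 2)) p.1 p.2)] : Fin 3 → (ℝ × ℝ →L[ℝ] ℝ)) k) p := by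
      refine hasFDerivAt_pi.mpr fun k => ?_
      fin_cases k
      · exact (hasFDerivAt_height hp').const_mul _
      · exact (hasFDerivAt_planar 0 hp').fun_neg.const_mul _
      · exact (hasFDerivAt_planar (-(Real.pi / 2)) hp').fun_neg.const_mul _
    rw [hd.fderiv, injective_iff_map_eq_zero]
    intro v hv
    have v0 := congrFun hv 0
    have v1 := congrFun hv 1
    have v2 := congrFun hv 2
    simp [hn2, -pairing_apply] at v0 v1 v2
    simp only [pairing_apply] at v0 v1 v2
    have hJ := jacobianFactor_pos hn hp'
    have j1 := jacobian_eq hn 0 hp'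
    have j2 := jacobian_eq hn (-(Real.pi / 2)) hp'
    rw [add_zero] at j1
    rw [← sub_eq_add_neg, Real.sin_sub_pi_div_two] at j2
    set κ := n ^ 4 * chebU n p.1 / denom n p.1 p.2 ^ 2
    set φ := ((n : ℝ) - 1) * p.2
    have hsc := Real.sin_sq_add_cos_sq φ
    -- Cramer's rule: a kernel vector is killed by every 2×2 minor. The two minors used are -κ sin φ
    -- and κ cos φ, with κ > 0.
    have w : ∀ {a b c d S : ℝ}, a * v.1 + b * v.2 = 0 → c * v.1 + d * v.2 = 0 →
        a * d - b * c = S → S * v.1 = 0 ∧ S * v.2 = 0 := by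
      intro a b c d S h1 h2 h3
      rw [← h3]
      constructor
      · linear_combination d * h1 - b * h2
      · linear_combination a * h2 - c * h1
    obtain ⟨a1, a2⟩ := w v0 v1 j1
    obtain ⟨b1, b2⟩ := w v0 v2 j2
    have e1 : κ * v.1 = 0 := by
      linear_combination -Real.sin φ * a1 + Real.cos φ * b1 - κ * v.1 * hsc
    have e2 : κ * v.2 = 0 := by
      linear_combination -Real.sin φ * a2 + Real.cos φ * b2 - κ * v.2 * hsc
    exact Prod.ext ((mul_eq_zero.mp e1).resolve_left hJ.ne')
      ((mul_eq_zero.mp e2).resolve_left hJ.ne')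
  · have hz' : ‖z‖ < 1 := by simpa using hz
    have hzn := pow_ne_one_of_norm_lt (n := n) (by omega) hz'
    rw [(inDisc_eventuallyEq hn hz').fderiv_eq]
    have hd : HasFDerivAt (discSurface n) (ContinuousLinearMap.pi fun k => ((n : ℝ) ^ 2)⁻¹ •
        (![reMul (heightForm n z), -reMul (planarForm n 0 z),
          -reMul (planarForm n (-(Real.pi / 2)) z)] : Fin 3 → (ℂ →L[ℝ] ℝ)) k) z := by
      refine hasFDerivAt_pi.mpr fun k => ?_
      fin_cases k
      · exact (hasFDerivAt_discHeight hn hzn).const_mul _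
      · exact (hasFDerivAt_discPlanar hn 0 hzn).fun_neg.const_mul _
      · exact (hasFDerivAt_discPlanar hn (-(Real.pi / 2)) hzn).fun_neg.const_mul _
    rw [hd.fderiv, injective_iff_map_eq_zero]
    intro v hv
    have v1 := congrFun hv 1
    have v2 := congrFun hv 2
    have hn0 : n ≠ 0 := by omega
    simp [hn0, -mul_re] at v1 v2
    have hI : exp (-(Real.pi / 2 * I)) = -I := by rw [exp_neg, exp_pi_div_two_mul_I, inv_I]
    simp only [planarForm, ofReal_zero, zero_mul, neg_zero, exp_zero, one_mul, ofReal_neg,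
      ofReal_div, ofReal_ofNat, neg_mul, neg_neg, exp_pi_div_two_mul_I, hI] at v1 v2
    have hz2 : z ^ n - 1 ≠ 0 := sub_ne_zero.mpr hzn
    set g := z ^ (2 * (n - 1)) with hg
    set w := I * n ^ 2 / (z ^ n - 1) ^ 2 * v with hw
    have r1 : (w * (g + 1)).re = 0 := by
      rw [← neg_eq_zero, ← neg_re, ← v1, hw]
      congr 1
      ring
    have r2 : (w * (1 - g)).im = 0 := by
      have : (w * (1 - g)).im = -(I * (w * (1 - g))).re := by simp
      rw [this, ← neg_re, ← v2, hw]
      congr 1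
      ring
    have hgn : ‖g‖ < 1 := by
      rw [hg, norm_pow]
      exact pow_lt_one₀ (norm_nonneg _) hz' (by omega)
    -- The horizontal components alone suffice: this relation gives |w| |g| = |w|, impossible for w
    -- ≠ 0 since |g| < 1.
    have r3 : w * g = -starRingEnd ℂ w := by
      simp only [mul_re, mul_im, add_re, add_im, sub_re, sub_im, one_re, one_im] at r1 r2
      apply Complex.ext
      · simp only [mul_re, neg_re, conj_re]; linarith
      · simp only [mul_im, neg_im, conj_im]; linarith
    have hw0 : w = 0 := by
      by_contra hne
      have h1 := congrArg norm r3
      rw [norm_mul, norm_neg, norm_conj] at h1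
      have := norm_pos_iff.mpr hne
      nlinarith
    rw [hw] at hw0
    refine (mul_eq_zero.mp hw0).resolve_left (div_ne_zero (mul_ne_zero I_ne_zero ?_)
      (pow_ne_zero 2 hz2))
    exact_mod_cast pow_ne_zero 2 hn0

/-! ### Level curves of the height over one sector -/

theorem mem_polarDomain_of_cos_lt {n : ℕ} {u θ : ℝ} (h0 : 0 ≤ θ)
    (h1 : θ ≤ Real.pi / n) (h : Real.cos θ < u) : (u, θ) ∈ polarDomain n := by
  rw [mem_polarDomain]
  intro j hj
  refine lt_of_le_of_lt ?_ h
  have hpi := Real.pi_pos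
  have hn : (0 : ℝ) < n := by exact_mod_cast (Nat.zero_le j).trans_lt hj
  have h2 : (n : ℝ) * (Real.pi / n) = Real.pi := by field_simp
  rcases Nat.eq_zero_or_pos j with rfl | hj0
  · simp [node_zero]
  have hj1 : (1 : ℝ) ≤ j := by exact_mod_cast hj0
  have hj2 : (j : ℝ) + 1 ≤ n := by exact_mod_cast hj
  have hq : 0 < Real.pi / n := by positivity
  have e1 : node n j = 2 * j * (Real.pi / n) := by rw [node]; ring
  have e2 : 2 * (Real.pi / n) ≤ node n j := by rw [e1]; nlinarith
  have e3 : node n j ≤ 2 * Real.pi - 2 * (Real.pi / n) := by rw [e1]; nlinarith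
  rw [show θ - node n j = -(node n j - θ) by ring, Real.cos_neg]
  rcases le_total (node n j - θ) Real.pi with hc | hc
  · exact Real.cos_le_cos_of_nonneg_of_le_pi h0 hc (by linarith)
  · rw [← Real.cos_two_pi_sub]
    exact Real.cos_le_cos_of_nonneg_of_le_pi h0 (by linarith) (by linarith)

theorem cos_lt_of_mem {n : ℕ} (hn : n ≠ 0) {p : ℝ × ℝ} (hp : p ∈ polarDomain n) :
    Real.cos p.2 < p.1 := by
  simpa [node_zero] using mem_polarDomain.mp hp 0 (by omega)

/-- The inverse function of `chebT n` on `(cos (π / n), ∞)`. -/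
def chebInv (n : ℕ) (x : ℝ) : ℝ :=
  Function.invFunOn (chebT n) (Set.Ioi (Real.cos (Real.pi / n))) x

theorem chebT_cos_pi_div {n : ℕ} (hn : n ≠ 0) : chebT n (Real.cos (Real.pi / n)) = -1 := by
  rw [chebT_cos, mul_div_cancel₀ _ (by positivity), Real.cos_pi]

theorem chebT_one (n : ℕ) : chebT n 1 = 1 :=
  Polynomial.Chebyshev.T_eval_one ℝ n

theorem le_chebT {n : ℕ} (hn : n ≠ 0) {u : ℝ} (hu : 1 ≤ u) : u ≤ chebT n u := by
  have h := Polynomial.Chebyshev.T_real_cosh (Real.arcosh u) n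
  rw [Real.cosh_arcosh hu] at h
  rw [chebT, h]
  conv_lhs => rw [← Real.cosh_arcosh hu]
  have h0 := Real.arcosh_nonneg hu
  have hn1 : (1 : ℝ) ≤ n := by exact_mod_cast Nat.one_le_iff_ne_zero.mpr hn
  rw [Real.cosh_le_cosh, abs_of_nonneg h0, Int.cast_natCast, abs_of_nonneg (by positivity)]
  nlinarith

theorem exists_chebT_eq {n : ℕ} (hn : n ≠ 0) {x : ℝ} (hx : -1 < x) :
    ∃ u ∈ Set.Ioi (Real.cos (Real.pi / n)), chebT n u = x := by
  have h1 : Real.cos (Real.pi / n) ≤ max x 1 := (Real.cos_le_one _).trans (le_max_right _ _)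
  have h2 : x ≤ chebT n (max x 1) := (le_max_left _ _).trans (le_chebT hn (le_max_right _ _))
  obtain ⟨u, hu, hux⟩ := intermediate_value_Icc h1 (continuous_chebT n).continuousOn
    ⟨(chebT_cos_pi_div hn).trans_le hx.le, h2⟩
  refine ⟨u, lt_of_le_of_ne hu.1 ?_, hux⟩
  rintro rfl
  rw [chebT_cos_pi_div hn] at hux
  exact hx.ne hux

theorem cos_pi_div_lt_chebInv {n : ℕ} (hn : n ≠ 0) {x : ℝ} (hx : -1 < x) :
    Real.cos (Real.pi / n) < chebInv n x := Function.invFunOn_mem (exists_chebT_eq hn hx)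

theorem chebT_chebInv {n : ℕ} (hn : n ≠ 0) {x : ℝ} (hx : -1 < x) : chebT n (chebInv n x) = x :=
  Function.invFunOn_eq (exists_chebT_eq hn hx)

theorem chebInv_eq {n : ℕ} (hn : n ≠ 0) {u : ℝ} (hu : Real.cos (Real.pi / n) < u) :
    chebInv n (chebT n u) = u := by
  have hx : -1 < chebT n u := by
    rw [← chebT_cos_pi_div hn]
    exact strictMonoOn_chebT hn Set.self_mem_Ici hu.le hu
  exact (strictMonoOn_chebT hn).injOn (cos_pi_div_lt_chebInv hn hx).le hu.le (chebT_chebInv hn hx)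

theorem continuousAt_chebInv {n : ℕ} (hn : n ≠ 0) {x : ℝ} (hx : -1 < x) :
    ContinuousAt (chebInv n) x := by
  have hm := strictMonoOn_chebT hn
  have hgx := cos_pi_div_lt_chebInv hn hx
  have hev := eventually_gt_nhds hx
  refine tendsto_order.2 ⟨fun a ha => ?_, fun b hb => ?_⟩
  · rcases le_or_gt a (Real.cos (Real.pi / n)) with h | h
    · filter_upwards [hev] with y hy using h.trans_lt (cos_pi_div_lt_chebInv hn hy)
    · have h1 : chebT n a < x := by
        rw [← chebT_chebInv hn hx]
        exact hm h.le hgx.le ha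
      filter_upwards [hev, eventually_gt_nhds h1] with y hy hay
      rw [← chebT_chebInv hn hy] at hay
      exact (hm.lt_iff_lt h.le (cos_pi_div_lt_chebInv hn hy).le).mp hay
  · have hb' := hgx.trans hb
    have h1 : x < chebT n b := by
      conv_lhs => rw [← chebT_chebInv hn hx]
      exact hm hgx.le hb'.le hb
    filter_upwards [hev, eventually_lt_nhds h1] with y hy hay
    rw [← chebT_chebInv hn hy] at hay
    exact (hm.lt_iff_lt (cos_pi_div_lt_chebInv hn hy).le hb'.le).mp hay

theorem differentiableAt_chebInv {n : ℕ} (hn : n ≠ 0) {x : ℝ} (hx : -1 < x) :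
    DifferentiableAt ℝ (chebInv n) x :=
  (HasDerivAt.of_local_left_inverse (continuousAt_chebInv hn hx) (hasDerivAt_chebT n _)
    (chebTDeriv_pos hn (cos_pi_div_lt_chebInv hn hx)).ne'
    ((eventually_gt_nhds hx).mono fun _ hy => chebT_chebInv hn hy)).differentiableAt

/-- The right-hand side of the equation `T_n(u) = cos nθ + (n / c) sin nθ` of the level curves of
`height`. -/
def levelValue (n : ℕ) (c θ : ℝ) : ℝ := Real.cos (n * θ) + n / c * Real.sin (n * θ)

/-- The level curve `height = c` over the sector `0 < θ < π / n`. -/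
def levelCurve (n : ℕ) (c θ : ℝ) : ℝ := chebInv n (levelValue n c θ)

theorem sin_mul_pos {n : ℕ} (hn : n ≠ 0) {θ : ℝ} (hθ : θ ∈ Set.Ioo 0 (Real.pi / n)) :
    0 < Real.sin (n * θ) := by
  have hn' : (0 : ℝ) < n := by positivity
  refine Real.sin_pos_of_pos_of_lt_pi (mul_pos hn' hθ.1) ?_
  rw [mul_comm, ← lt_div_iff₀ hn']
  exact hθ.2

theorem neg_one_lt_levelValue {n : ℕ} (hn : n ≠ 0) {c : ℝ} (hc : 0 < c) {θ : ℝ}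
    (hθ : θ ∈ Set.Ioo 0 (Real.pi / n)) : -1 < levelValue n c θ := by
  have h1 := sin_mul_pos hn hθ
  have hn' : (0 : ℝ) < n := by positivity
  have h2 : 0 < n / c * Real.sin (n * θ) := by positivity
  have := Real.neg_one_le_cos (n * θ)
  rw [levelValue]
  linarith

theorem chebT_levelCurve {n : ℕ} (hn : n ≠ 0) {c : ℝ} (hc : 0 < c) {θ : ℝ}
    (hθ : θ ∈ Set.Ioo 0 (Real.pi / n)) : chebT n (levelCurve n c θ) = levelValue n c θ :=
  chebT_chebInv hn (neg_one_lt_levelValue hn hc hθ)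

theorem levelCurve_mem {n : ℕ} (hn : n ≠ 0) {c : ℝ} (hc : 0 < c) {θ : ℝ}
    (hθ : θ ∈ Set.Ioo 0 (Real.pi / n)) : (levelCurve n c θ, θ) ∈ polarDomain n := by
  have hx := neg_one_lt_levelValue hn hc hθ
  refine mem_polarDomain_of_cos_lt hθ.1.le hθ.2.le ?_
  have h1 := sin_mul_pos hn hθ
  have hn' : (0 : ℝ) < n := by positivity
  have h2 : 0 < n / c * Real.sin (n * θ) := by positivity
  have h3 : Real.cos (Real.pi / n) ≤ Real.cos θ :=
    cos_pi_div_le_cos hn (by rw [abs_of_pos hθ.1]; exact hθ.2.le)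
  refine ((strictMonoOn_chebT hn).lt_iff_lt h3 (cos_pi_div_lt_chebInv hn hx).le).mp ?_
  rw [chebT_cos, chebT_chebInv hn hx, levelValue]
  linarith

theorem height_levelCurve {n : ℕ} (hn : 2 ≤ n) {c : ℝ} (hc : 0 < c) {θ : ℝ}
    (hθ : θ ∈ Set.Ioo 0 (Real.pi / n)) : height n (levelCurve n c θ) θ = c := by
  have hn0 : n ≠ 0 := by omega
  have h1 := height_mul_denom hn (levelCurve_mem hn0 hc hθ)
  have h2 := sin_mul_pos hn0 hθ
  rw [denom_eq] at h1
  simp only [chebT_levelCurve hn0 hc hθ] at h1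
  rw [levelValue, add_sub_cancel_left] at h1
  have hn' : (0 : ℝ) < n := by positivity
  field_simp at h1
  exact h1

theorem eq_levelCurve {n : ℕ} (hn : 2 ≤ n) {p : ℝ × ℝ} (hp : p ∈ polarDomain n)
    (hθ : p.2 ∈ Set.Ioo 0 (Real.pi / n)) : p.1 = levelCurve n (height n p.1 p.2) p.2 := by
  have hn0 : n ≠ 0 := by omega
  have h1 := height_mul_denom hn hp
  have hc := (height_pos_iff hn hp).mpr (sin_mul_pos hn0 hθ)
  have h2 : levelValue n (height n p.1 p.2) p.2 = chebT n p.1 := by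
    rw [denom_eq] at h1
    rw [levelValue]
    field_simp
    linear_combination -h1
  rw [levelCurve, h2, chebInv_eq hn0 (cos_pi_div_lt_of_mem hn0 hp)]

theorem continuous_levelValue (n : ℕ) (c : ℝ) : Continuous (levelValue n c) := by
  unfold levelValue
  fun_prop

theorem differentiableAt_levelCurve {n : ℕ} (hn : n ≠ 0) {c : ℝ} (hc : 0 < c) {θ : ℝ}
    (hθ : θ ∈ Set.Ioo 0 (Real.pi / n)) : DifferentiableAt ℝ (levelCurve n c) θ := by
  refine (differentiableAt_chebInv hn (neg_one_lt_levelValue hn hc hθ)).comp θ ?_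
  unfold levelValue
  fun_prop

/-- Along the curve, d(`planar`)/dθ times `heightU` is the Jacobian. Both the Jacobian and `heightU`
are negative here. -/
theorem strictMonoOn_planar_levelCurve {n : ℕ} (hn : 2 ≤ n) {c : ℝ} (hc : 0 < c) {ψ : ℝ}
    (hψ : ∀ θ ∈ Set.Ioo 0 (Real.pi / n), 0 < Real.sin ((n - 1) * θ + ψ)) :
    StrictMonoOn (fun θ => planar n ψ (levelCurve n c θ) θ) (Set.Ioo 0 (Real.pi / n)) := by
  have hn0 : n ≠ 0 := by omega
  have hd : ∀ θ ∈ Set.Ioo 0 (Real.pi / n), ∃ d,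
      HasDerivAt (fun θ => planar n ψ (levelCurve n c θ) θ) d θ ∧ 0 < d := by
    intro θ hθ
    have hp := levelCurve_mem hn0 hc hθ
    have hU := (differentiableAt_levelCurve hn0 hc hθ).hasDerivAt
    set U' := deriv (levelCurve n c) θ
    have hι : HasDerivAt (fun θ => (levelCurve n c θ, θ)) (U', (1 : ℝ)) θ :=
      hU.prodMk (hasDerivAt_id θ)
    have d1 : HasDerivAt (fun θ => height n (levelCurve n c θ) θ)
        (heightU n (levelCurve n c θ) θ * U' + heightTheta n (levelCurve n c θ) θ) θ := by
      have := (hasFDerivAt_height hp).comp_hasDerivAt (f := fun θ => (levelCurve n c θ, θ)) θ hι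
      refine HasDerivAt.congr_deriv (f := fun θ => height n (levelCurve n c θ) θ) this ?_
      simp
    have d2 : HasDerivAt (fun θ => planar n ψ (levelCurve n c θ) θ)
        (planarU n ψ (levelCurve n c θ) θ * U' + planarTheta n ψ (levelCurve n c θ) θ) θ := by
      have := (hasFDerivAt_planar ψ hp).comp_hasDerivAt (f := fun θ => (levelCurve n c θ, θ)) θ hι
      refine HasDerivAt.congr_deriv (f := fun θ => planar n ψ (levelCurve n c θ) θ) this ?_
      simp
    have d3 : HasDerivAt (fun θ => height n (levelCurve n c θ) θ) 0 θ := by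
      refine (hasDerivAt_const θ c).congr_of_eventuallyEq ?_
      filter_upwards [isOpen_Ioo.mem_nhds hθ] with x hx using height_levelCurve hn hc hx
    have e1 := d1.unique d3
    refine ⟨_, d2, ?_⟩
    have hneg := heightU_neg hn hp (by simpa using (height_levelCurve hn hc hθ).symm ▸ hc)
    have hJ := jacobian_eq hn ψ hp
    have hκ := mul_pos (jacobianFactor_pos hn hp) (hψ θ hθ)
    simp only at hneg hJ hκ
    have e2 : (planarU n ψ (levelCurve n c θ) θ * U' + planarTheta n ψ (levelCurve n c θ) θ) *
        heightU n (levelCurve n c θ) θ < 0 := by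
      have : (planarU n ψ (levelCurve n c θ) θ * U' + planarTheta n ψ (levelCurve n c θ) θ) *
        heightU n (levelCurve n c θ) θ = -(n ^ 4 * chebU n (levelCurve n c θ) /
          denom n (levelCurve n c θ) θ ^ 2 * Real.sin ((n - 1) * θ + ψ)) := by
        linear_combination hJ + planarU n ψ (levelCurve n c θ) θ * e1
      rw [this]
      linarith
    exact pos_of_mul_neg_left e2 hneg.le
  refine strictMonoOn_of_deriv_pos (convex_Ioo _ _) (fun θ hθ => ?_) fun θ hθ => ?_
  · obtain ⟨d, h1, _⟩ := hd θ hθ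
    exact h1.continuousAt.continuousWithinAt
  · rw [interior_Ioo] at hθ
    obtain ⟨d, h1, h2⟩ := hd θ hθ
    rwa [h1.deriv]

theorem sin_sub_one_mul_pos {n : ℕ} (hn : 2 ≤ n) {θ : ℝ} (hθ : θ ∈ Set.Ioo 0 (Real.pi / n)) :
    0 < Real.sin ((n - 1) * θ + 0) ∧ 0 < Real.sin ((n - 1) * θ + Real.pi / n) := by
  have hn' : (2 : ℝ) ≤ n := by exact_mod_cast hn
  have h1 : (n : ℝ) * θ < Real.pi := by
    rw [mul_comm, ← lt_div_iff₀ (by linarith)]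
    exact hθ.2
  have h2 : (n : ℝ) * (Real.pi / n) = Real.pi := by field_simp
  have h3 : 0 < Real.pi / n := hθ.1.trans hθ.2
  have h4 : 0 < ((n : ℝ) - 1) * θ := mul_pos (by linarith) hθ.1
  constructor
  · refine Real.sin_pos_of_pos_of_lt_pi (by linarith) ?_
    have := hθ.1
    linarith
  · refine Real.sin_pos_of_pos_of_lt_pi (by linarith) ?_
    have := mul_lt_mul_of_pos_left hθ.2 (show (0 : ℝ) < n - 1 by linarith)
    linarith

/-! ### Comparison of height and horizontal components -/

/-- Only the j = 0 terms are singular at the boundary point (1, 0). They cancel in the difference,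
since cos 0 = 1 and sin 0 = 0. -/
theorem continuousAt_planar_sub_height {n : ℕ} (hn : 2 ≤ n) :
    ContinuousAt (fun q : ℝ × ℝ => planar n 0 q.1 q.2 - height n q.1 q.2) (1, 0) := by
  have hn' : (0 : ℝ) < n := by positivity
  have he : (fun q : ℝ × ℝ => planar n 0 q.1 q.2 - height n q.1 q.2) = fun q =>
      ∑ j ∈ range n, ((Real.cos (node n j) - 1) *
        (Real.sin (q.2 - node n j) / (q.1 - Real.cos (q.2 - node n j))) -
      (n - 1) * Real.sin (node n j) * Real.log (q.1 - Real.cos (q.2 - node n j))) := by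
    funext q
    rw [planar, height, ← sum_sub_distrib]
    refine sum_congr rfl fun j _ => ?_
    rw [sub_zero]
    ring
  rw [he]
  refine tendsto_finsetSum _ fun j hj => ?_
  rcases Nat.eq_zero_or_pos j with rfl | hj0
  · simp [node_zero]
  · have h1 : Real.cos (node n j) ≠ 1 := by
      have hjn : (j : ℝ) < n := by exact_mod_cast mem_range.mp hj
      have hj0' : (0 : ℝ) < j := by exact_mod_cast hj0
      intro h
      have hpos : 0 < node n j := by rw [node]; positivity
      have hlt : node n j < 2 * Real.pi := by
        rw [node, div_lt_iff₀ hn']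
        have := Real.pi_pos
        nlinarith
      exact hpos.ne' ((Real.cos_eq_one_iff_of_lt_of_lt (by linarith) hlt).mp h)
    have h2 : ((1 : ℝ), (0 : ℝ)).1 - Real.cos (((1 : ℝ), (0 : ℝ)).2 - node n j) ≠ 0 := by
      simp only [zero_sub, Real.cos_neg]
      exact sub_ne_zero.mpr (Ne.symm h1)
    have hs : ContinuousAt (fun q : ℝ × ℝ => q.1 - Real.cos (q.2 - node n j)) (1, 0) := by fun_prop
    have hn : ContinuousAt (fun q : ℝ × ℝ => Real.sin (q.2 - node n j)) (1, 0) := by fun_prop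
    exact (continuousAt_const.mul (hn.div hs h2)).sub (continuousAt_const.mul (hs.log h2))

/-- As θ → 0⁺ the level curve `height` = c runs into (1, 0), where `planar` 0 - `height` tends to 0.
So `planar` 0 starts from the limit c and increases strictly. -/
theorem height_lt_planar {n : ℕ} (hn : 2 ≤ n) {p : ℝ × ℝ} (hp : p ∈ polarDomain n)
    (hθ : p.2 ∈ Set.Ioo 0 (Real.pi / n)) : height n p.1 p.2 < planar n 0 p.1 p.2 := by
  have hn0 : n ≠ 0 := by omega
  have hc := (height_pos_iff hn hp).mpr (sin_mul_pos hn0 hθ)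
  have hU := eq_levelCurve hn hp hθ
  set c := height n p.1 p.2
  have hmono := strictMonoOn_planar_levelCurve hn hc (fun θ h => (sin_sub_one_mul_pos hn h).1)
  -- Oddness in θ also holds for the default values x / 0 = 0 and log 0 = 0 at this boundary point,
  -- and the difference is continuous there.
  have hval : planar n 0 1 0 - height n 1 0 = 0 := by
    have h1 := planar_neg hn0 0 1 0
    have h2 := height_neg hn0 1 0
    rw [neg_zero] at h1 h2
    linarith
  have hcurve : Filter.Tendsto (fun θ => (levelCurve n c θ, θ)) (nhds 0) (nhds (1, 0)) := by
    have h1 : levelValue n c 0 = 1 := by simp [levelValue]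
    have h2 : ContinuousAt (levelCurve n c) 0 :=
      ContinuousAt.comp (g := chebInv n) (f := levelValue n c)
        (continuousAt_chebInv hn0 (by rw [h1]; norm_num))
        (continuous_levelValue n c).continuousAt
    have h3 : levelCurve n c 0 = 1 := by
      have h4 : Real.cos (Real.pi / n) < 1 := by
        have hp1 := cos_pi_div_lt_of_mem hn0 hp
        rw [← Real.cos_zero]
        have hn1 : (1 : ℝ) ≤ n := by exact_mod_cast Nat.one_le_iff_ne_zero.mpr hn0
        exact Real.cos_lt_cos_of_nonneg_of_le_pi le_rfl (div_le_self Real.pi_pos.le hn1)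
          (by have := Real.pi_pos; positivity)
      rw [levelCurve, h1]
      conv_lhs => rw [← chebT_one n]
      exact chebInv_eq hn0 h4
    have := h2.prodMk (continuousAt_id (x := (0 : ℝ)))
    rwa [ContinuousAt, h3] at this
  have hlim : Filter.Tendsto (fun θ => planar n 0 (levelCurve n c θ) θ)
      (nhdsWithin 0 (Set.Ioi 0)) (nhds c) := by
    have h1 := ((continuousAt_planar_sub_height hn).tendsto.comp hcurve).mono_left
      (nhdsWithin_le_nhds (s := Set.Ioi (0 : ℝ)))
    rw [hval] at h1
    have h2 := h1.add_const c
    rw [zero_add] at h2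
    refine h2.congr' ?_
    filter_upwards [Ioo_mem_nhdsGT (hθ.1.trans hθ.2)] with θ hθ'
    simp only [Function.comp_apply, height_levelCurve hn hc hθ']
    ring
  have hhalf : p.2 / 2 ∈ Set.Ioo 0 (Real.pi / n) := by
    constructor
    · linarith [hθ.1]
    · linarith [hθ.1, hθ.2]
  have h1 : c ≤ planar n 0 (levelCurve n c (p.2 / 2)) (p.2 / 2) := by
    refine le_of_tendsto hlim ?_
    filter_upwards [Ioo_mem_nhdsGT hhalf.1] with θ hθ'
    exact (hmono ⟨hθ'.1, hθ'.2.trans hhalf.2⟩ hhalf hθ'.2).le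
  have h2 := hmono hhalf hθ (by linarith [hθ.1])
  simp only [← hU] at h2
  exact h1.trans_lt h2

theorem half_sum_identity {a b : ℝ} (ha : Real.sin a ≠ 0) (hb : Real.sin b ≠ 0) :
    Real.sin (a + b) / (Real.cos (a - b) - Real.cos (a + b)) =
      (Real.sin (2 * a) / (1 - Real.cos (2 * a)) + Real.sin (2 * b) / (1 - Real.cos (2 * b))) / 2 ∧
    Real.log (Real.cos (a - b) - Real.cos (a + b)) =
      (Real.log (1 - Real.cos (2 * a)) + Real.log (1 - Real.cos (2 * b))) / 2 := by
  have e1 : Real.cos (a - b) - Real.cos (a + b) = 2 * Real.sin a * Real.sin b := by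
    rw [Real.cos_sub, Real.cos_add]; ring
  have e2 : ∀ x, 1 - Real.cos (2 * x) = 2 * Real.sin x ^ 2 := fun x => by
    rw [Real.cos_two_mul]; linear_combination -2 * Real.sin_sq_add_cos_sq x
  rw [e1, e2, e2]
  constructor
  · rw [Real.sin_two_mul, Real.sin_two_mul, Real.sin_add]
    field_simp
    ring
  -- `Real.log` is log |x|, so the individual signs of sin a and sin b do not matter.
  · rw [Real.log_mul (by simpa using ha) hb, Real.log_mul two_ne_zero ha,
      Real.log_mul two_ne_zero (pow_ne_zero 2 ha), Real.log_mul two_ne_zero (pow_ne_zero 2 hb),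
      Real.log_pow, Real.log_pow]
    push_cast
    ring

/-- D'Alembert's formula for u = cos σ: in the null coordinates θ ± σ each function is the average
of its values on u = 1. Termwise, cos σ - cos(a + b) = 2 sin a sin b with σ = a - b, and the
quotient becomes (cot a + cot b)/2. -/
theorem half_sum_cos {n : ℕ} (ψ : ℝ) {σ θ : ℝ} (hp : (Real.cos σ, θ) ∈ polarDomain n) :
    planar n ψ (Real.cos σ) θ = (planar n ψ 1 (θ + σ) + planar n ψ 1 (θ - σ)) / 2 ∧
    height n (Real.cos σ) θ = (height n 1 (θ + σ) + height n 1 (θ - σ)) / 2 := by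
  have key : ∀ j ∈ range n,
      Real.sin (θ - node n j) / (Real.cos σ - Real.cos (θ - node n j)) =
        (Real.sin (θ + σ - node n j) / (1 - Real.cos (θ + σ - node n j)) +
          Real.sin (θ - σ - node n j) / (1 - Real.cos (θ - σ - node n j))) / 2 ∧
      Real.log (Real.cos σ - Real.cos (θ - node n j)) =
        (Real.log (1 - Real.cos (θ + σ - node n j)) +
          Real.log (1 - Real.cos (θ - σ - node n j))) / 2 := fun j hj => by
    have h0 : 0 < Real.cos σ - Real.cos (θ - node n j) :=
      sub_pos.mpr (mem_polarDomain.mp hp j (mem_range.mp hj))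
    set a := (θ - node n j + σ) / 2 with ha
    set b := (θ - node n j - σ) / 2 with hb
    have e1 : θ - node n j = a + b := by rw [ha, hb]; ring
    have e2 : σ = a - b := by rw [ha, hb]; ring
    have e3 : θ + σ - node n j = 2 * a := by rw [ha]; ring
    have e4 : θ - σ - node n j = 2 * b := by rw [hb]; ring
    have e5 : Real.cos σ - Real.cos (θ - node n j) = 2 * Real.sin a * Real.sin b := by
      rw [e1, e2, Real.cos_sub, Real.cos_add]; ring
    rw [e5] at h0
    have h1 : Real.sin a ≠ 0 := fun h => by simp [h] at h0
    have h2 : Real.sin b ≠ 0 := fun h => by simp [h] at h0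
    rw [e3, e4, e1]
    rw [show Real.cos σ = Real.cos (a - b) by rw [← e2]]
    exact half_sum_identity h1 h2
  constructor
  · unfold planar
    rw [← sum_add_distrib, sum_div]
    refine sum_congr rfl fun j hj => ?_
    rw [(key j hj).1, (key j hj).2]
    ring
  · unfold height
    rw [← sum_add_distrib, sum_div]
    exact sum_congr rfl fun j hj => (key j hj).1

theorem discPoint_zero_pow_ne_one {n : ℕ} (hn : n ≠ 0) {φ : ℝ}
    (hφ : φ ∈ Set.Ioo 0 (2 * Real.pi / n)) : discPoint 0 φ ^ n ≠ 1 := by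
  have hn' : (0 : ℝ) < n := by positivity
  rw [discPoint_pow]
  intro h
  have h1 := congrArg re h
  rw [discPoint_re, mul_zero, neg_zero, Real.exp_zero, one_mul, one_re] at h1
  have hpos : 0 < n * φ := mul_pos hn' hφ.1
  have hlt : n * φ < 2 * Real.pi := by
    rw [mul_comm, ← lt_div_iff₀ hn']; exact hφ.2
  exact hpos.ne' ((Real.cos_eq_one_iff_of_lt_of_lt (by linarith [Real.pi_pos]) hlt).mp h1)

/-- On |z| = 1 the difference equals 2n²(1 - cos((n-1)φ + ψ)) / |z^n - 1|²: the boundary curve u = 1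
is lightlike, so no horizontal component changes faster than the height. -/
theorem planarTheta_sub_heightTheta_nonneg {n : ℕ} (hn : 2 ≤ n) (ψ : ℝ) {φ : ℝ}
    (hz : discPoint 0 φ ^ n ≠ 1) : 0 ≤ planarTheta n ψ 1 φ - heightTheta n 1 φ := by
  have h1 := (height_partials_discPoint hn le_rfl hz).2
  have h2 := (planar_partials_discPoint hn ψ le_rfl hz).2
  rw [Real.cosh_zero] at h1 h2
  rw [h1, h2]
  set z := discPoint 0 φ with hzdef
  have hz1 : z = exp (φ * I) := by simp [hzdef, discPoint]
  have hzn0 : z ^ n ≠ 0 := pow_ne_zero _ (by rw [hz1]; exact exp_ne_zero _)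
  have hw := sub_ne_zero.mpr hz
  have e1 : (z ^ n - 1) ^ 2 = -z ^ n * (normSq (z ^ n - 1) : ℂ) := by
    have hc : starRingEnd ℂ (z ^ n) = (z ^ n)⁻¹ := by
      rw [hz1, map_pow, ← exp_conj, map_mul, conj_ofReal, conj_I, mul_neg, exp_neg, inv_pow]
    rw [normSq_eq_conj_mul_self, map_sub, map_one, hc]
    field_simp
    ring
  have e2 : exp (ψ * I) * z ^ (2 * (n - 1)) * z + exp (-(ψ * I)) * z - 2 * z ^ n =
      z ^ n * ((2 * Real.cos ((n - 1) * φ + ψ) - 2 : ℝ) : ℂ) := by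
    have h3 : exp (ψ * I) * z ^ (2 * (n - 1)) * z = z ^ n * exp (((n - 1) * φ + ψ) * I) := by
      rw [hz1, ← exp_nat_mul, ← exp_nat_mul, ← exp_add, ← exp_add, ← exp_add]
      congr 1
      push_cast [Nat.cast_sub (show 1 ≤ n by omega)]
      ring
    have h4 : exp (-(ψ * I)) * z = z ^ n * exp (-((n - 1) * φ + ψ) * I) := by
      rw [hz1, ← exp_nat_mul, ← exp_add, ← exp_add]
      congr 1
      ring
    rw [h3, h4]
    push_cast
    rw [cos]
    ring
  have e3 : planarForm n ψ z * z - heightForm n z * z =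
      I * ((n ^ 2 * ((2 * Real.cos ((n - 1) * φ + ψ) - 2) / normSq (z ^ n - 1)) : ℝ) : ℂ) := by
    have hns : (normSq (z ^ n - 1) : ℂ) ≠ 0 := by
      exact_mod_cast fun h => hw (normSq_eq_zero.mp h)
    have e4 : planarForm n ψ z * z - heightForm n z * z =
        -I * n ^ 2 * (exp (ψ * I) * z ^ (2 * (n - 1)) * z + exp (-(ψ * I)) * z - 2 * z ^ n) /
          (z ^ n - 1) ^ 2 := by
      rw [planarForm, heightForm]
      have : z ^ (n - 1) * z = z ^ n := by rw [← pow_succ, Nat.sub_add_cancel (by omega)]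
      rw [← this]
      ring
    rw [e4, e1, e2]
    push_cast
    field_simp
  have e5 : -(planarForm n ψ z * z).im - -(heightForm n z * z).im =
      -(planarForm n ψ z * z - heightForm n z * z).im := by rw [sub_im]; ring
  rw [e5, e3, I_mul_im, ofReal_re, ← mul_neg, ← neg_div]
  have := Real.cos_le_one ((n - 1) * φ + ψ)
  have := normSq_nonneg (z ^ n - 1)
  exact mul_nonneg (by positivity) (div_nonneg (by linarith) this)

theorem monotoneOn_planar_sub_height {n : ℕ} (hn : 2 ≤ n) (ψ : ℝ) :
    MonotoneOn (fun φ => planar n ψ 1 φ - height n 1 φ) (Set.Ioo 0 (2 * Real.pi / n)) := by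
  have hd : ∀ φ ∈ Set.Ioo 0 (2 * Real.pi / n),
      HasDerivAt (fun φ => planar n ψ 1 φ - height n 1 φ)
        (planarTheta n ψ 1 φ - heightTheta n 1 φ) φ := fun φ hφ => by
    have hz := discPoint_zero_pow_ne_one (by omega) hφ
    have hp := discPoint_mem le_rfl hz
    rw [Real.cosh_zero] at hp
    have hι := (hasDerivAt_const φ (1 : ℝ)).prodMk (hasDerivAt_id φ)
    have d1 := (hasFDerivAt_height hp).comp_hasDerivAt φ hι
    have d2 := (hasFDerivAt_planar ψ hp).comp_hasDerivAt φ hι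
    refine HasDerivAt.congr_deriv (f := fun φ => planar n ψ 1 φ - height n 1 φ) (d2.sub d1) ?_
    simp
  refine monotoneOn_of_deriv_nonneg (convex_Ioo _ _)
    (fun φ hφ => (hd φ hφ).continuousAt.continuousWithinAt)
    (fun φ hφ => ?_) fun φ hφ => ?_
  all_goals rw [interior_Ioo] at hφ
  · exact (hd φ hφ).differentiableAt.differentiableWithinAt
  · rw [(hd φ hφ).deriv]
    exact planarTheta_sub_heightTheta_nonneg hn ψ (discPoint_zero_pow_ne_one (by omega) hφ)

theorem planar_le_height_of_lt_one {n : ℕ} (hn : 2 ≤ n) {p : ℝ × ℝ} (hp : p ∈ polarDomain n)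
    (hθ : p.2 ∈ Set.Ioo 0 (Real.pi / n)) (hu : p.1 < 1) :
    planar n (Real.pi / n) p.1 p.2 ≤ height n p.1 p.2 := by
  have hn0 : n ≠ 0 := by omega
  have hn1 : (1 : ℝ) ≤ n := by exact_mod_cast Nat.one_le_iff_ne_zero.mpr hn0
  obtain ⟨u, θ⟩ := p
  have hcos := cos_lt_of_mem hn0 hp
  simp only at hθ hu hcos ⊢
  have h1 := Real.cos_arccos ((Real.neg_one_le_cos _).trans hcos.le) hu.le
  set σ := Real.arccos u
  have hσ0 : 0 < σ := Real.arccos_pos.mpr hu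
  have hσ1 : σ < θ := by
    by_contra! hcon
    have h2 := Real.cos_le_cos_of_nonneg_of_le_pi hθ.1.le (Real.arccos_le_pi u) hcon
    rw [h1] at h2
    linarith
  rw [← h1] at hp ⊢
  obtain ⟨e1, e2⟩ := half_sum_cos (Real.pi / n) hp
  have h2n : 2 * Real.pi / n = 2 * (Real.pi / n) := by ring
  have hanti : ∀ φ, planar n (Real.pi / n) 1 (2 * Real.pi / n - φ) - height n 1 (2 * Real.pi / n - φ)
      = -(planar n (Real.pi / n) 1 φ - height n 1 φ) := fun φ => by
    have s1 := planar_add_two_pi_div hn0 (Real.pi / n) 1 (-φ)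
    have s2 := height_add_two_pi_div hn0 1 (-φ)
    rw [planar_neg hn0, show -(Real.pi / n - 2 * Real.pi / n) = Real.pi / n by ring] at s1
    rw [height_neg hn0] at s2
    rw [show 2 * Real.pi / n - φ = -φ + 2 * Real.pi / n by ring, s1, s2]
    ring
  -- The difference on u = 1 is antisymmetric about φ = π/n. Reflecting θ + σ makes the average half
  -- of a difference of its values at θ - σ and 2π/n - (θ + σ), and the former is smaller because θ
  -- < π/n.
  have hm := monotoneOn_planar_sub_height hn (Real.pi / n)
    (a := θ - σ) (b := 2 * Real.pi / n - (θ + σ)) ⟨by linarith, by linarith [hθ.2]⟩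
    ⟨by linarith [hθ.2], by linarith⟩ (by linarith [hθ.2])
  simp only [hanti] at hm
  rw [e1, e2]
  linarith

/-- `planar` (π/n) increases along the level curve towards θ = π/n. There the level value tends to
-1, so eventually u < 1 and `planar_le_height_of_lt_one` bounds a later, larger value. -/
theorem planar_le_height {n : ℕ} (hn : 2 ≤ n) {p : ℝ × ℝ} (hp : p ∈ polarDomain n)
    (hθ : p.2 ∈ Set.Ioo 0 (Real.pi / n)) :
    planar n (Real.pi / n) p.1 p.2 ≤ height n p.1 p.2 := by
  have hn0 : n ≠ 0 := by omega
  have hc := (height_pos_iff hn hp).mpr (sin_mul_pos hn0 hθ)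
  have hU := eq_levelCurve hn hp hθ
  set c := height n p.1 p.2
  have hmono := strictMonoOn_planar_levelCurve hn hc (fun θ h => (sin_sub_one_mul_pos hn h).2)
  have hlim : levelValue n c (Real.pi / n) < 1 := by
    rw [levelValue, mul_div_cancel₀ _ (by positivity)]
    norm_num
  have hev : ∀ᶠ θ in nhdsWithin (Real.pi / n) (Set.Iio (Real.pi / n)),
      levelValue n c θ < 1 ∧ θ ∈ Set.Ioo p.2 (Real.pi / n) :=
    (((continuous_levelValue n c).continuousAt.eventually_lt_const hlim).filter_mono
      nhdsWithin_le_nhds).and (Ioo_mem_nhdsLT hθ.2)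
  obtain ⟨θ, hθ1, hθ2⟩ := hev.exists
  have hθ3 : θ ∈ Set.Ioo 0 (Real.pi / n) := ⟨hθ.1.trans hθ2.1, hθ2.2⟩
  have h1 := hmono hθ hθ3 hθ2.1
  simp only [← hU] at h1
  have hx := neg_one_lt_levelValue hn0 hc hθ3
  have h2 : levelCurve n c θ < 1 := by
    refine ((strictMonoOn_chebT hn0).lt_iff_lt (cos_pi_div_lt_chebInv hn0 hx).le
      (Real.cos_le_one _)).mp ?_
    rw [chebT_chebInv hn0 hx, chebT_one]
    exact hθ1
  have h3 := planar_le_height_of_lt_one hn (levelCurve_mem hn0 hc hθ3) hθ3 h2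
  simp only [height_levelCurve hn hc hθ3] at h3
  exact h1.le.trans h3

/-! ### Injectivity at nonzero height -/

theorem eq_of_mem_sector {n : ℕ} (hn : 2 ≤ n) {p q : ℝ × ℝ} (hp : p ∈ polarDomain n)
    (hq : q ∈ polarDomain n) (hpθ : p.2 ∈ Set.Ioo 0 (Real.pi / n))
    (hqθ : q.2 ∈ Set.Ioo 0 (Real.pi / n)) (hh : height n p.1 p.2 = height n q.1 q.2)
    (hpl : planar n 0 p.1 p.2 = planar n 0 q.1 q.2) : p = q := by
  have hc := (height_pos_iff hn hp).mpr (sin_mul_pos (by omega) hpθ)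
  have hU := eq_levelCurve hn hp hpθ
  have hV := eq_levelCurve hn hq hqθ
  rw [← hh] at hV
  have hmono := strictMonoOn_planar_levelCurve hn hc (fun θ h => (sin_sub_one_mul_pos hn h).1)
  have h1 : p.2 = q.2 := by
    refine hmono.injOn hpθ hqθ ?_
    simp only [← hU, ← hV]
    exact hpl
  refine Prod.ext ?_ h1
  rw [hU, hV, h1]

theorem planar_rotate (n : ℕ) (φ ψ u θ : ℝ) :
    planar n ψ u θ = Real.cos (ψ - φ) * planar n φ u θ -
      Real.sin (ψ - φ) * planar n (φ - Real.pi / 2) u θ := by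
  rw [planar_eq_comb n ψ, planar_eq_comb n φ, planar_eq_comb n (φ - Real.pi / 2),
    Real.cos_sub_pi_div_two, Real.sin_sub_pi_div_two, Real.cos_sub, Real.sin_sub]
  linear_combination -(Real.cos ψ * planar n 0 u θ - Real.sin ψ * planar n (-(Real.pi / 2)) u θ) *
    Real.sin_sq_add_cos_sq φ

theorem sin_lt_sin_iff_mem_Ioo {A x : ℝ} (hA0 : 0 ≤ A) (hA : A ≤ Real.pi / 2)
    (hx : x ∈ Set.Icc (-(Real.pi / 2)) Real.pi) :
    Real.sin A < Real.sin x ↔ x ∈ Set.Ioo A (Real.pi - A) := by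
  have hpi := Real.pi_pos
  have hm := Real.strictMonoOn_sin
  have hAm : A ∈ Set.Icc (-(Real.pi / 2)) (Real.pi / 2) := ⟨by linarith, hA⟩
  rcases le_total x (Real.pi / 2) with h | h
  · rw [hm.lt_iff_lt hAm ⟨hx.1, h⟩]
    refine ⟨fun h1 => ⟨h1, by linarith⟩, fun h1 => h1.1⟩
  · rw [← Real.sin_pi_sub x, hm.lt_iff_lt hAm ⟨by linarith [hx.2], by linarith⟩]
    refine ⟨fun h1 => ⟨by linarith, by linarith⟩, fun h1 => by linarith [h1.2]⟩

/-- The horizontal position `X + iY` of the extended surface, scaled by `n²`. -/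
def horizontal (n : ℕ) (u θ : ℝ) : ℂ := ⟨planar n (-(Real.pi / 2)) u θ, planar n 0 u θ⟩

theorem planar_eq_norm_mul_sin (n : ℕ) (ψ u θ : ℝ) :
    planar n ψ u θ = ‖horizontal n u θ‖ * Real.sin (arg (horizontal n u θ) - ψ) := by
  have h1 := norm_mul_cos_arg (horizontal n u θ)
  have h2 := norm_mul_sin_arg (horizontal n u θ)
  rw [planar_eq_comb, Real.sin_sub]
  simp only [horizontal] at h1 h2 ⊢
  linear_combination -Real.cos ψ * h2 + Real.sin ψ * h1

theorem horizontal_add_int {n : ℕ} (hn : n ≠ 0) (u θ : ℝ) (k : ℤ) :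
    horizontal n u (θ + 2 * Real.pi * k / n) =
      horizontal n u θ * exp ((2 * Real.pi * k / n : ℝ) * I) := by
  apply Complex.ext
  · rw [mul_re, exp_ofReal_mul_I_re, exp_ofReal_mul_I_im]
    simp only [horizontal]
    rw [planar_add_int hn, planar_eq_comb,
      show -(Real.pi / 2) - 2 * Real.pi * k / n = -(2 * Real.pi * k / n + Real.pi / 2) by ring,
      Real.cos_neg, Real.sin_neg, Real.cos_add_pi_div_two, Real.sin_add_pi_div_two]
    ring
  · rw [mul_im, exp_ofReal_mul_I_re, exp_ofReal_mul_I_im]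
    simp only [horizontal]
    rw [planar_add_int hn, planar_eq_comb, zero_sub, Real.cos_neg, Real.sin_neg]
    ring

/-- With R and φ the modulus and argument, the two comparison inequalities read sin(φ - π/n) ≤ c/R <
sin φ. With A = arcsin(c/R), φ lies in (A, π - A) but φ - π/n does not. -/
theorem arg_horizontal_mem {n : ℕ} (hn : 2 ≤ n) {p : ℝ × ℝ} (hp : p ∈ polarDomain n)
    (hθ : p.2 ∈ Set.Ioo 0 (Real.pi / n)) :
    0 < ‖horizontal n p.1 p.2‖ ∧ arg (horizontal n p.1 p.2) ∈
      Set.Ioc (Real.arcsin (height n p.1 p.2 / ‖horizontal n p.1 p.2‖))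
        (Real.arcsin (height n p.1 p.2 / ‖horizontal n p.1 p.2‖) + Real.pi / n) := by
  have hc := (height_pos_iff hn hp).mpr (sin_mul_pos (by omega) hθ)
  have h1 := height_lt_planar hn hp hθ
  have h2 := planar_le_height hn hp hθ
  have hpn : Real.pi / n ≤ Real.pi / 2 := by
    have : (2 : ℝ) ≤ n := by exact_mod_cast hn
    exact div_le_div_of_nonneg_left Real.pi_pos.le two_pos this
  have hpn0 : 0 < Real.pi / n := hθ.1.trans hθ.2
  rw [planar_eq_norm_mul_sin, sub_zero] at h1
  rw [planar_eq_norm_mul_sin] at h2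
  set R := ‖horizontal n p.1 p.2‖
  set φ := arg (horizontal n p.1 p.2)
  set c := height n p.1 p.2
  have hR : 0 < R := by
    refine lt_of_le_of_ne (norm_nonneg _) fun h => ?_
    rw [← h, zero_mul] at h1
    linarith
  have hcR : c / R < Real.sin φ := by rwa [div_lt_iff₀' hR]
  have hcR' : Real.sin (φ - Real.pi / n) ≤ c / R := by rwa [le_div_iff₀' hR]
  have hcR0 : 0 < c / R := div_pos hc hR
  have hcR1 : c / R ≤ 1 := hcR.le.trans (Real.sin_le_one _)
  have hsin := Real.sin_arcsin (by linarith) hcR1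
  set A := Real.arcsin (c / R)
  have hA0 : 0 ≤ A := Real.arcsin_nonneg.mpr hcR0.le
  have hA1 : A ≤ Real.pi / 2 := Real.arcsin_le_pi_div_two _
  have hφ0 : 0 ≤ φ := by
    by_contra! h
    have := Real.sin_nonpos_of_nonpos_of_neg_pi_le h.le (neg_pi_lt_arg _).le
    linarith
  have hφ1 : φ ≤ Real.pi := arg_le_pi _
  rw [← hsin] at hcR hcR'
  have h3 := (sin_lt_sin_iff_mem_Ioo hA0 hA1 ⟨by linarith [Real.pi_pos], hφ1⟩).mp hcR
  refine ⟨hR, h3.1, ?_⟩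
  by_contra! h4
  have h5 := (sin_lt_sin_iff_mem_Ioo (x := φ - Real.pi / n) hA0 hA1
    ⟨by linarith, by linarith⟩).mpr ⟨by linarith, by linarith [h3.2]⟩
  linarith

theorem exists_mem_sector {n : ℕ} (hn : n ≠ 0) {p : ℝ × ℝ} (hp : p ∈ polarDomain n)
    (h : 0 < Real.sin (n * p.2)) :
    ∃ β ∈ Set.Ioo 0 (Real.pi / n), ∃ k : ℤ, p.2 = β + 2 * Real.pi * k / n ∧
      (p.1, β) ∈ polarDomain n := by
  have hn' : (0 : ℝ) < n := by positivity
  obtain ⟨j, hj, m, β, hβ, hθ⟩ := exists_near_node hn p.2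
  have hθ' : p.2 = β + 2 * Real.pi * ((j + n * m : ℤ) : ℝ) / n := by
    rw [hθ, node]
    push_cast
    field_simp
    ring
  have hnβ : Real.sin (n * p.2) = Real.sin (n * β) := by
    rw [hθ', show (n : ℝ) * (β + 2 * Real.pi * ((j + n * m : ℤ) : ℝ) / n) =
      n * β + ((j + n * m : ℤ) : ℝ) * (2 * Real.pi) by field_simp, Real.sin_add_int_mul_two_pi]
  rw [hnβ] at h
  have hβ1 := abs_le.mp hβ
  have h3 : (n : ℝ) * (Real.pi / n) = Real.pi := by field_simp
  have hβ0 : 0 < β := by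
    by_contra! hc
    have := Real.sin_nonpos_of_nonpos_of_neg_pi_le (mul_nonpos_of_nonneg_of_nonpos hn'.le hc)
      (by nlinarith [hβ1.1])
    linarith
  have hβ2 : β < Real.pi / n := by
    refine lt_of_le_of_ne hβ1.2 ?_
    rintro rfl
    rw [h3, Real.sin_pi] at h
    exact h.false
  refine ⟨β, ⟨hβ0, hβ2⟩, _, hθ', mem_polarDomain_of_cos_lt hβ0.le hβ2.le ?_⟩
  have h1 := mem_polarDomain.mp hp j hj
  rwa [hθ, show β + node n j + m * (2 * Real.pi) - node n j = β + m * (2 * Real.pi) by ring,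
    Real.cos_add_int_mul_two_pi] at h1

theorem polarPoint_eq_iff {p q : ℝ × ℝ} :
    polarPoint p = polarPoint q ↔ p.1 = q.1 ∧ ∃ m : ℤ, p.2 - q.2 = 2 * Real.pi * m := by
  rw [polarPoint, polarPoint, OnePoint.coe_eq_coe, Prod.mk.injEq,
    Real.Angle.angle_eq_iff_two_pi_dvd_sub]

/-- Rotate both points into the base sector. Their arguments then lie in the same half-open interval
of length π/n and differ by a multiple of 2π/n, so they coincide, and injectivity on the sector
applies. -/
theorem polarPoint_eq_of_height_pos {n : ℕ} (hn : 2 ≤ n) {p q : ℝ × ℝ} (hp : p ∈ polarDomain n)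
    (hq : q ∈ polarDomain n) (h0 : 0 < height n p.1 p.2)
    (hh : height n p.1 p.2 = height n q.1 q.2)
    (hpl : horizontal n p.1 p.2 = horizontal n q.1 q.2) : polarPoint p = polarPoint q := by
  have hn0 : n ≠ 0 := by omega
  have hn' : (0 : ℝ) < n := by positivity
  obtain ⟨a, ha, k, hk, hpa⟩ := exists_mem_sector hn0 hp ((height_pos_iff hn hp).mp h0)
  obtain ⟨b, hb, l, hl, hqb⟩ := exists_mem_sector hn0 hq ((height_pos_iff hn hq).mp (hh ▸ h0))
  rw [hk, hl, height_add_int hn0, height_add_int hn0] at hh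
  rw [hk, hl, horizontal_add_int hn0, horizontal_add_int hn0] at hpl
  obtain ⟨hR1, hA1⟩ := arg_horizontal_mem hn hpa ha
  obtain ⟨hR2, hA2⟩ := arg_horizontal_mem hn hqb hb
  simp only at hR1 hR2 hA1 hA2
  have hnorm : ‖horizontal n p.1 a‖ = ‖horizontal n q.1 b‖ := by
    have := congrArg norm hpl
    rwa [norm_mul, norm_mul, norm_exp_ofReal_mul_I, norm_exp_ofReal_mul_I, mul_one, mul_one] at this
  rw [hh, hnorm] at hA1
  have hexp : exp ((arg (horizontal n p.1 a) : ℝ) * I + (2 * Real.pi * k / n : ℝ) * I) =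
      exp ((arg (horizontal n q.1 b) : ℝ) * I + (2 * Real.pi * l / n : ℝ) * I) := by
    rw [exp_add, exp_add]
    have e1 := norm_mul_exp_arg_mul_I (horizontal n p.1 a)
    have e2 := norm_mul_exp_arg_mul_I (horizontal n q.1 b)
    rw [← e1, ← e2, hnorm] at hpl
    exact mul_left_cancel₀ (ofReal_ne_zero.mpr hR2.ne') (by simpa only [mul_assoc] using hpl)
  obtain ⟨m, hm⟩ := exp_eq_exp_iff_exists_int.mp hexp
  have hm' : arg (horizontal n p.1 a) + 2 * Real.pi * k / n =
      arg (horizontal n q.1 b) + 2 * Real.pi * l / n + m * (2 * Real.pi) := by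
    have := congrArg im hm
    simpa using this
  have hkl : k - l - n * m = 0 := by
    have e1 : arg (horizontal n q.1 b) - arg (horizontal n p.1 a) =
        2 * (Real.pi / n) * ((k - l - n * m : ℤ) : ℝ) := by
      push_cast
      field_simp
      field_simp at hm'
      linarith
    have hpn : 0 < Real.pi / n := by have := Real.pi_pos; positivity
    have e2 : |((k - l - n * m : ℤ) : ℝ)| < 1 := by
      rw [abs_lt]
      constructor <;> nlinarith [hA1.1, hA1.2, hA2.1, hA2.2]
    have e3 : |k - l - n * m| < 1 := by exact_mod_cast e2
    exact Int.abs_lt_one_iff.mp e3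
  have hkl' : (k : ℝ) = l + n * m := by
    have : k = l + n * m := by linarith
    exact_mod_cast this
  have hpl' : horizontal n p.1 a = horizontal n q.1 b := by
    have harg : arg (horizontal n p.1 a) = arg (horizontal n q.1 b) := by
      rw [hkl'] at hm'
      field_simp at hm'
      nlinarith
    rw [← norm_mul_exp_arg_mul_I (horizontal n p.1 a),
      ← norm_mul_exp_arg_mul_I (horizontal n q.1 b), hnorm, harg]
  have hpq := eq_of_mem_sector hn hpa hqb ha hb hh (congrArg im hpl')
  rw [Prod.mk.injEq] at hpq
  rw [polarPoint_eq_iff]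
  refine ⟨hpq.1, m, ?_⟩
  rw [hk, hl, hpq.2, hkl']
  field_simp
  ring

theorem mem_polarDomain_neg {n : ℕ} {p : ℝ × ℝ} (hp : p ∈ polarDomain n) :
    (p.1, -p.2) ∈ polarDomain n := by
  rw [mem_polarDomain] at hp ⊢
  intro j hj
  rcases Nat.eq_zero_or_pos j with rfl | hj0
  · have := hp 0 hj
    simpa [node_zero] using this
  · have := hp (n - j) (by omega)
    have hn : (n : ℝ) ≠ 0 := by
      have : n ≠ 0 := by omega
      positivity
    have e : p.2 - node n (n - j) = -(-p.2 - node n j) - 2 * Real.pi := by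
      rw [node, node, Nat.cast_sub hj.le]
      field_simp
      ring
    rwa [e, Real.cos_sub_two_pi, Real.cos_neg] at this

theorem horizontal_neg {n : ℕ} (hn : n ≠ 0) (u θ : ℝ) :
    horizontal n u (-θ) = starRingEnd ℂ (horizontal n u θ) := by
  apply Complex.ext
  · simp only [horizontal, conj_re]
    rw [planar_neg hn, neg_neg, planar_eq_comb, Real.cos_pi_div_two, Real.sin_pi_div_two]
    ring
  · simp only [horizontal, conj_im]
    rw [planar_neg hn, neg_zero]

/-! ### Injectivity at height zero -/

theorem tendsto_planar_atTop {n : ℕ} (hn : 2 ≤ n) (ψ θ : ℝ) :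
    Filter.Tendsto (fun u => planar n ψ u θ) Filter.atTop (nhds 0) := by
  have hn0 : n ≠ 0 := by omega
  have h1 : Filter.Tendsto (fun s => discPoint s θ) Filter.atTop (nhds 0) := by
    have h2 : Filter.Tendsto (fun s : ℝ => Real.exp (-s)) Filter.atTop (nhds 0) :=
      Real.tendsto_exp_neg_atTop_nhds_zero
    have h3 := ((continuous_ofReal.tendsto 0).comp h2).mul_const (exp (θ * I))
    simpa [discPoint, Function.comp_def] using h3
  have h2 : Filter.Tendsto (discPlanar n ψ) (nhds 0) (nhds 0) := by
    have := (hasFDerivAt_discPlanar hn ψ (z := 0) (by simp [hn0])).continuousAt.tendsto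
    rwa [discPlanar_zero] at this
  have h3 : Filter.Tendsto Real.arcosh Filter.atTop Filter.atTop := by
    refine Filter.tendsto_atTop_mono' _ ?_ Real.tendsto_log_atTop
    filter_upwards [Filter.eventually_ge_atTop 1] with u hu
    rw [← Real.exp_le_exp, Real.exp_log (by linarith), Real.exp_arcosh hu]
    linarith [Real.sqrt_nonneg (u ^ 2 - 1)]
  refine ((h2.comp h1).comp h3).congr' ?_
  filter_upwards [Filter.eventually_gt_atTop 1] with u hu
  have hz : discPoint (Real.arcosh u) θ ^ n ≠ 1 := pow_ne_one_of_norm_lt hn0 (by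
    rw [discPoint, norm_exp_neg_mul, Real.exp_lt_one_iff]
    linarith [Real.arcosh_pos hu])
  simp only [Function.comp_apply]
  rw [discPlanar_discPoint hn ψ hz, Real.cosh_arcosh hu.le]

theorem mem_polarDomain_of_le {n : ℕ} {u v θ : ℝ} (h : (u, θ) ∈ polarDomain n) (huv : u ≤ v) :
    (v, θ) ∈ polarDomain n := by
  rw [mem_polarDomain] at h ⊢
  exact fun j hj => (h j hj).trans_le huv

theorem heightTheta_mul_denom {n : ℕ} (hn : 2 ≤ n) {p : ℝ × ℝ} (hp : p ∈ polarDomain n) :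
    heightTheta n p.1 p.2 * denom n p.1 p.2 + height n p.1 p.2 * (n * Real.sin (n * p.2)) =
      n ^ 2 * Real.cos (n * p.2) := by
  have hι : HasDerivAt (fun θ : ℝ => (p.1, θ)) ((0 : ℝ), (1 : ℝ)) p.2 :=
    (hasDerivAt_const _ _).prodMk (hasDerivAt_id _)
  have d1 : HasDerivAt (fun θ => height n p.1 θ) (heightTheta n p.1 p.2) p.2 := by
    have := (hasFDerivAt_height hp).comp_hasDerivAt (f := fun θ : ℝ => (p.1, θ)) p.2 hι
    refine HasDerivAt.congr_deriv (f := fun θ => height n p.1 θ) this ?_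
    simp
  have hl : HasDerivAt (fun θ : ℝ => (n : ℝ) * θ) n p.2 := by
    simpa using (hasDerivAt_id p.2).const_mul (n : ℝ)
  have d2 : HasDerivAt (fun θ => denom n p.1 θ) (n * Real.sin (n * p.2)) p.2 := by
    have := hl.cos.const_sub (chebT n p.1)
    refine HasDerivAt.congr_deriv (f := fun θ => denom n p.1 θ) this ?_
    ring
  have d3 := d1.fun_mul d2
  have hev : ∀ᶠ θ in nhds p.2, (p.1, θ) ∈ polarDomain n :=
    hι.continuousAt.eventually_mem ((isOpen_polarDomain n).mem_nhds hp)
  have hev' : (fun θ => height n p.1 θ * denom n p.1 θ) =ᶠ[nhds p.2]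
      fun θ => (n : ℝ) * Real.sin (n * θ) := by
    filter_upwards [hev] with θ hθ
    have h := height_mul_denom hn hθ
    exact h
  have d4 := (hl.sin.const_mul (n : ℝ)).congr_of_eventuallyEq hev'
  have := d3.unique d4
  linarith

/-- On such a ray `height` and `heightU` vanish, so the Jacobian reduces to -`heightTheta` ·
`planarU`, and the closed formulas make `planarU` negative. -/
theorem strictAntiOn_planar_ray {n : ℕ} (hn : 2 ≤ n) {u θ : ℝ} (hp : (u, θ) ∈ polarDomain n)
    (h0 : Real.sin (n * θ) = 0) :
    StrictAntiOn (fun v => planar n (θ - Real.pi / 2) v θ) (Set.Ici u) := by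
  have hd : ∀ v ∈ Set.Ici u, ∃ d,
      HasDerivAt (fun v => planar n (θ - Real.pi / 2) v θ) d v ∧ d < 0 := by
    intro v hv
    have hq := mem_polarDomain_of_le hp hv
    have hι : HasDerivAt (fun v : ℝ => (v, θ)) ((1 : ℝ), (0 : ℝ)) v :=
      (hasDerivAt_id _).prodMk (hasDerivAt_const _ _)
    refine ⟨planarU n (θ - Real.pi / 2) v θ, ?_, ?_⟩
    · have := (hasFDerivAt_planar (θ - Real.pi / 2) hq).comp_hasDerivAt
        (f := fun v : ℝ => (v, θ)) v hι
      refine HasDerivAt.congr_deriv (f := fun v => planar n (θ - Real.pi / 2) v θ) this ?_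
      simp
    · have e1 := heightU_mul_denom hn hq
      have e2 := heightTheta_mul_denom hn hq
      have e3 := jacobian_eq hn (θ - Real.pi / 2) hq
      have e4 := (height_eq_zero_iff hn hq).mpr h0
      have hN := denom_pos (by omega) hq
      have hκ := jacobianFactor_pos hn hq
      have hsc := Real.sin_sq_add_cos_sq (n * θ)
      simp only at e1 e2 e3 e4 hN hκ
      rw [e4, zero_mul, neg_zero] at e1
      have e5 := (mul_eq_zero.mp e1).resolve_right hN.ne'
      rw [e4, zero_mul, add_zero] at e2
      rw [e5, zero_mul, zero_sub, show ((n : ℝ) - 1) * θ + (θ - Real.pi / 2) = n * θ - Real.pi / 2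
        by ring, Real.sin_sub_pi_div_two] at e3
      rw [h0, zero_pow two_ne_zero, zero_add] at hsc
      set κ := n ^ 4 * chebU n v / denom n v θ ^ 2
      -- Both e2 and e3 carry a factor cos nθ, whose square is 1 because sin nθ = 0.
      have e6 : (n : ℝ) ^ 2 * planarU n (θ - Real.pi / 2) v θ = -(κ * denom n v θ) := by
        linear_combination (-(n : ℝ) ^ 2 * planarU n (θ - Real.pi / 2) v θ - κ * denom n v θ) * hsc
          - planarU n (θ - Real.pi / 2) v θ * Real.cos (n * θ) * e2 -
          Real.cos (n * θ) * denom n v θ * e3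
      have e7 := mul_pos hκ hN
      have hn2 : (0 : ℝ) < (n : ℝ) ^ 2 := by positivity
      by_contra! hc
      have := mul_nonneg hn2.le hc
      linarith
  refine strictAntiOn_of_deriv_neg (convex_Ici _) (fun v hv => ?_) fun v hv => ?_
  · obtain ⟨d, h1, _⟩ := hd v hv
    exact h1.continuousAt.continuousWithinAt
  · obtain ⟨d, h1, h2⟩ := hd v (interior_subset hv)
    rwa [h1.deriv]

theorem planar_ray_pos {n : ℕ} (hn : 2 ≤ n) {p : ℝ × ℝ} (hp : p ∈ polarDomain n)
    (h0 : Real.sin (n * p.2) = 0) : 0 < planar n (p.2 - Real.pi / 2) p.1 p.2 := by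
  have hm := strictAntiOn_planar_ray hn hp h0
  have h1 : p.1 + 1 ∈ Set.Ici p.1 := by simp
  have h2 := hm Set.self_mem_Ici h1 (by linarith)
  have h3 : 0 ≤ planar n (p.2 - Real.pi / 2) (p.1 + 1) p.2 := by
    refine le_of_tendsto (tendsto_planar_atTop hn (p.2 - Real.pi / 2) p.2) ?_
    filter_upwards [Filter.eventually_ge_atTop (p.1 + 1)] with v hv
    exact hm.antitoneOn h1 (le_trans (by linarith) hv : p.1 ≤ v) hv
  exact h3.trans_lt h2

/-- The ray is fixed by the reflection -θ ↦ -θ + 2πk/n = θ, which makes the transverse component its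
own negative. -/
theorem planar_ray_eq_zero {n : ℕ} (hn : n ≠ 0) {u θ : ℝ} (h0 : Real.sin (n * θ) = 0) :
    planar n θ u θ = 0 := by
  obtain ⟨k, hk⟩ := Real.sin_eq_zero_iff.mp h0
  have hn' : (n : ℝ) ≠ 0 := by positivity
  have e : 2 * Real.pi * k / n = 2 * θ := by field_simp; linarith
  have h1 := planar_add_int hn θ u (-θ) k
  rw [e, planar_neg hn, show -θ + 2 * θ = θ by ring, show -(θ - 2 * θ) = θ by ring] at h1
  linarith

/-- The horizontal position is nonzero and its direction determines θ modulo 2π: the transverse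
component vanishes and the radial one is positive. Strict monotonicity along the ray then recovers
u. -/
theorem polarPoint_eq_of_height_eq_zero {n : ℕ} (hn : 2 ≤ n) {p q : ℝ × ℝ}
    (hp : p ∈ polarDomain n) (hq : q ∈ polarDomain n) (hp0 : height n p.1 p.2 = 0)
    (hq0 : height n q.1 q.2 = 0) (hpl : ∀ ψ, planar n ψ p.1 p.2 = planar n ψ q.1 q.2) :
    polarPoint p = polarPoint q := by
  have hn0 : n ≠ 0 := by omega
  have sp := (height_eq_zero_iff hn hp).mp hp0
  have sq := (height_eq_zero_iff hn hq).mp hq0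
  have vp := planar_ray_pos hn hp sp
  have vq := planar_ray_pos hn hq sq
  have e1 := planar_rotate n q.2 p.2 q.1 q.2
  have e2 := planar_rotate n q.2 (p.2 - Real.pi / 2) q.1 q.2
  rw [planar_ray_eq_zero hn0 sq, mul_zero, zero_sub] at e1 e2
  rw [← hpl, planar_ray_eq_zero hn0 sp] at e1
  rw [show p.2 - Real.pi / 2 - q.2 = p.2 - q.2 - Real.pi / 2 by ring, Real.sin_sub_pi_div_two,
    neg_mul, neg_neg] at e2
  have hs : Real.sin (p.2 - q.2) = 0 :=
    (mul_eq_zero.mp (neg_eq_zero.mp e1.symm)).resolve_right vq.ne'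
  have hc : 0 < Real.cos (p.2 - q.2) := by
    rw [← hpl] at e2
    rw [e2] at vp
    exact pos_of_mul_pos_left vp vq.le
  have hc1 : Real.cos (p.2 - q.2) = 1 := by
    have := Real.sin_sq_add_cos_sq (p.2 - q.2)
    rw [hs] at this
    nlinarith
  obtain ⟨m, hm⟩ := (Real.cos_eq_one_iff _).mp hc1
  have hm' : p.2 = q.2 + 2 * Real.pi * ((n * m : ℤ) : ℝ) / n := by
    have hn' : (n : ℝ) ≠ 0 := by positivity
    push_cast
    field_simp
    linarith
  refine polarPoint_eq_iff.mpr ⟨?_, m, by linarith⟩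
  have hper : ∀ v, planar n (p.2 - Real.pi / 2) v p.2 = planar n (q.2 - Real.pi / 2) v q.2 := by
    intro v
    rw [hm', planar_add_int hn0]
    congr 1
    ring
  have h2 : planar n (q.2 - Real.pi / 2) p.1 q.2 = planar n (q.2 - Real.pi / 2) q.1 q.2 := by
    rw [← hper, hpl, e2, hc1, one_mul]
  have hpq : (p.1, q.2) ∈ polarDomain n := by
    rw [mem_polarDomain] at hp ⊢
    intro j hj
    have := hp j hj
    rwa [show p.2 - node n j = q.2 - node n j + m * (2 * Real.pi) by linarith,
      Real.cos_add_int_mul_two_pi] at this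
  rcases le_total p.1 q.1 with h | h
  · exact (strictAntiOn_planar_ray hn hpq sq).injOn Set.self_mem_Ici h h2
  · exact ((strictAntiOn_planar_ray hn hq sq).injOn Set.self_mem_Ici h h2.symm).symm

/-! ### Global injectivity -/

theorem polarSurface_apply (n : ℕ) (p : ℝ × ℝ) :
    polarSurface n p 0 = ((n : ℝ) ^ 2)⁻¹ * height n p.1 p.2 ∧
    polarSurface n p 1 = -(((n : ℝ) ^ 2)⁻¹ * planar n 0 p.1 p.2) ∧
    polarSurface n p 2 = -(((n : ℝ) ^ 2)⁻¹ * planar n (-(Real.pi / 2)) p.1 p.2) := by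
  refine ⟨?_, ?_, ?_⟩ <;> simp [polarSurface]

theorem injective_extendedSurface {n : ℕ} (hn : 2 ≤ n) :
    Function.Injective (extendedSurface n) := by
  have hn0 : n ≠ 0 := by omega
  have hn2 : ((n : ℝ) ^ 2)⁻¹ ≠ 0 := by positivity
  -- p_∞ goes to the origin. Another preimage would have height 0, where the radial component is
  -- positive.
  have hzero : ∀ p ∈ polarDomain n, polarSurface n p ≠ 0 := by
    intro p hp h
    obtain ⟨h1, h2, h3⟩ := polarSurface_apply n p
    simp only [h, Pi.zero_apply, zero_eq_mul, zero_eq_neg, hn2, false_or] at h1 h2 h3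
    have h4 := planar_ray_pos hn hp ((height_eq_zero_iff hn hp).mp h1)
    rw [planar_eq_comb, (mul_eq_zero.mp h2).resolve_left hn2,
      (mul_eq_zero.mp h3).resolve_left hn2] at h4
    simp at h4
  have hpolar : ∀ p ∈ polarDomain n, ∀ q ∈ polarDomain n, polarSurface n p = polarSurface n q →
      polarPoint p = polarPoint q := by
    intro p hp q hq h
    obtain ⟨p1, p2, p3⟩ := polarSurface_apply n p
    obtain ⟨q1, q2, q3⟩ := polarSurface_apply n q
    rw [h, q1] at p1
    rw [h, q2] at p2
    rw [h, q3] at p3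
    have e1 := (mul_left_cancel₀ hn2 p1).symm
    have e2 := (mul_left_cancel₀ hn2 (neg_injective p2)).symm
    have e3 := (mul_left_cancel₀ hn2 (neg_injective p3)).symm
    have e4 : horizontal n p.1 p.2 = horizontal n q.1 q.2 := Complex.ext e3 e2
    rcases lt_trichotomy (height n p.1 p.2) 0 with hneg | h0 | hpos
    · have := polarPoint_eq_of_height_pos hn (mem_polarDomain_neg hp) (mem_polarDomain_neg hq)
        (by simp only [height_neg hn0]; linarith) (by simp only [height_neg hn0, e1])
        (by simp only [horizontal_neg hn0, e4])
      obtain ⟨h1, m, hm⟩ := polarPoint_eq_iff.mp this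
      refine polarPoint_eq_iff.mpr ⟨h1, -m, ?_⟩
      push_cast
      simp only at hm
      linarith
    · refine polarPoint_eq_of_height_eq_zero hn hp hq h0 (e1 ▸ h0) fun ψ => ?_
      rw [planar_eq_comb, e2, e3, ← planar_eq_comb]
    · exact polarPoint_eq_of_height_pos hn hp hq hpos e1 e4
  rintro ⟨p, hp⟩ ⟨q, hq⟩ h
  simp only [extendedSurface] at h
  rw [Subtype.mk.injEq]
  by_cases hpi : p = ∞ <;> by_cases hqi : q = ∞
  · rw [hpi, hqi]
  · obtain ⟨b, hb, rfl⟩ := exists_polarPoint_eq hq hqi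
    rw [hpi, extension_infty, extension_polarPoint] at h
    exact absurd h.symm (hzero b hb)
  · obtain ⟨a, ha, rfl⟩ := exists_polarPoint_eq hp hpi
    rw [hqi, extension_infty, extension_polarPoint] at h
    exact absurd h (hzero a ha)
  · obtain ⟨a, ha, rfl⟩ := exists_polarPoint_eq hp hpi
    obtain ⟨b, hb, rfl⟩ := exists_polarPoint_eq hq hqi
    rw [extension_polarPoint, extension_polarPoint] at h
    exact hpolar a ha b hb h

/-! ### Continuity on the one-point compactification -/

instance : CompactSpace Real.Angle :=
  haveI : Fact (0 < 2 * Real.pi) := ⟨Real.two_pi_pos⟩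
  inferInstanceAs (CompactSpace (AddCircle (2 * Real.pi)))

theorem exists_norm_polarSurface_lt {n : ℕ} (hn : 2 ≤ n) {ε : ℝ} (hε : 0 < ε) :
    ∃ M, ∀ p : ℝ × ℝ, M < p.1 → ‖polarSurface n p‖ < ε := by
  have hn0 : n ≠ 0 := by omega
  have hc := (analyticAt_discSurface hn0 (z := 0) (by simp)).continuousAt
  obtain ⟨δ, hδ, h⟩ := Metric.continuousAt_iff.mp hc ε hε
  refine ⟨max 1 δ⁻¹, fun p hp => ?_⟩
  have h1 : 1 < p.1 := (le_max_left _ _).trans_lt hp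
  have h2 : δ⁻¹ < p.1 := (le_max_right _ _).trans_lt hp
  have hnorm := norm_exp_neg_mul (s := Real.arcosh p.1) p.2
  have hexp : Real.exp (-Real.arcosh p.1) < δ := by
    rw [Real.exp_neg, Real.exp_arcosh h1.le]
    refine inv_lt_of_inv_lt₀ hδ (h2.trans_le ?_)
    linarith [Real.sqrt_nonneg (p.1 ^ 2 - 1)]
  have hlt : Real.exp (-Real.arcosh p.1) < 1 := by
    rw [Real.exp_lt_one_iff]
    linarith [Real.arcosh_pos h1]
  have h3 := h (x := (Real.exp (-Real.arcosh p.1) : ℝ) * exp (p.2 * I))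
    (by rw [dist_zero_right, hnorm]; exact hexp)
  rwa [discSurface_zero, dist_zero_right,
    discSurface_polar hn (Real.exp_pos _) _ (pow_ne_one_of_norm_lt hn0 (hnorm.trans_lt hlt)),
    cosh_eq_exp_neg, Real.cosh_arcosh h1.le] at h3

theorem continuous_angle_sin_sub (a : ℝ) :
    Continuous fun q : ℝ × Real.Angle => (q.2 - (a : Real.Angle)).sin :=
  Real.Angle.continuous_sin.comp (continuous_snd.sub continuous_const)

theorem continuous_fst_sub_angle_cos (a : ℝ) :
    Continuous fun q : ℝ × Real.Angle => q.1 - (q.2 - (a : Real.Angle)).cos :=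
  continuous_fst.sub (Real.Angle.continuous_cos.comp (continuous_snd.sub continuous_const))

theorem coe_mem_Omega {n : ℕ} {q : ℝ × Real.Angle} :
    (q : Cylinder) ∈ Omega n ↔ ∀ j < n, 0 < q.1 - (q.2 - (node n j : Real.Angle)).cos := by
  simp [Omega, node]

theorem cos_pi_div_nonneg {n : ℕ} (hn : 2 ≤ n) : 0 ≤ Real.cos (Real.pi / n) := by
  have h1 : (2 : ℝ) ≤ n := by exact_mod_cast hn
  have h2 := Real.pi_pos
  refine Real.cos_nonneg_of_neg_pi_div_two_le_of_le ?_
    (div_le_div_of_nonneg_left h2.le two_pos h1)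
  have : 0 < Real.pi / n := by positivity
  linarith

theorem continuousWithinAt_extension {n : ℕ} (hn : 2 ≤ n) {p : Cylinder} (hp : p ∈ Omega n) :
    ContinuousWithinAt (extension n) (Omega n) p := by
  induction p using OnePoint.rec with
  | infty =>
    rw [ContinuousWithinAt, extension_infty, Metric.tendsto_nhds]
    intro ε hε
    obtain ⟨M, hM⟩ := exists_norm_polarSurface_lt hn hε
    set K : Set (ℝ × Real.Angle) := Set.Icc 0 M ×ˢ Set.univ
    have hK : IsOpen ((fun q : ℝ × Real.Angle => (q : Cylinder)) '' K)ᶜ :=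
      isOpen_compl_image_coe.mpr ⟨isClosed_Icc.prod isClosed_univ, isCompact_Icc.prod isCompact_univ⟩
    -- Removing 0 ≤ u ≤ M suffices: the end u → -∞ of the cylinder also reaches ∞, but u > cos(π/n)
    -- ≥ 0 on the domain.
    have hmem : (∞ : Cylinder) ∈ ((fun q : ℝ × Real.Angle => (q : Cylinder)) '' K)ᶜ := by simp
    filter_upwards [mem_nhdsWithin_of_mem_nhds (hK.mem_nhds hmem), self_mem_nhdsWithin] with x hx hxΩ
    rw [dist_zero_right]
    by_cases hi : x = ∞
    · rw [hi, extension_infty, norm_zero]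
      exact hε
    · obtain ⟨q, hq, rfl⟩ := exists_polarPoint_eq hxΩ hi
      rw [extension_polarPoint]
      refine hM q ?_
      have h1 := (cos_pi_div_nonneg hn).trans (cos_pi_div_lt_of_mem (by omega) hq).le
      by_contra! hc
      exact hx ⟨(q.1, (q.2 : Real.Angle)), ⟨⟨h1, hc⟩, trivial⟩, rfl⟩
  | coe q =>
    refine ContinuousAt.continuousWithinAt (OnePoint.continuousAt_coe.mpr ?_)
    have hpos := coe_mem_Omega.mp hp
    have hS := fun j => (continuous_fst_sub_angle_cos (node n j)).continuousAt (x := q)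
    have hN := fun j => (continuous_angle_sin_sub (node n j)).continuousAt (x := q)
    have hh : ContinuousAt (fun q : ℝ × Real.Angle => height n q.1 q.2.toReal) q := by
      simp only [height, sin_toReal_sub, cos_toReal_sub]
      exact tendsto_finsetSum _ fun j hj => (hN j).div (hS j) (hpos j (mem_range.mp hj)).ne'
    have hpl : ∀ ψ, ContinuousAt (fun q : ℝ × Real.Angle => planar n ψ q.1 q.2.toReal) q := by
      intro ψ
      simp only [planar, sin_toReal_sub, cos_toReal_sub]
      refine tendsto_finsetSum _ fun j hj => ?_
      have h0 := (hpos j (mem_range.mp hj)).ne'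
      exact (continuousAt_const.mul ((hN j).div (hS j) h0)).sub
        (continuousAt_const.mul ((hS j).log h0))
    have : ContinuousAt (fun q : ℝ × Real.Angle => polarSurface n (q.1, q.2.toReal)) q := by
      unfold polarSurface
      refine ContinuousAt.fun_const_smul ?_ ((n : ℝ) ^ 2)⁻¹
      refine continuousAt_pi.mpr fun k => ?_
      fin_cases k
      · exact hh
      · exact (hpl _).neg
      · exact (hpl _).neg
    exact this

theorem continuous_extendedSurface {n : ℕ} (hn : 2 ≤ n) : Continuous (extendedSurface n) :=
  continuousOn_iff_continuous_domRestrict.mp fun _ hp => continuousWithinAt_extension hn hp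

/-! ### Blow-up at the boundary and properness -/

/-- If a ≠ 0, the first summand behaves like a²/S and the logarithmic one is eventually nonnegative.
If a = 0, then u = 1 and the logarithm diverges. -/
theorem tendsto_boundary_term {X : Type*} {l : Filter X} {N S : X → ℝ} {a u c : ℝ} (hc : 0 < c)
    (hN : Filter.Tendsto N l (nhds a)) (hS : Filter.Tendsto S l (nhdsWithin 0 (Set.Ioi 0)))
    (hu : 0 ≤ u) (hau : a ^ 2 + u ^ 2 = 1) :
    Filter.Tendsto (fun x => a * (N x / S x) + c * u * -Real.log (S x)) l Filter.atTop := by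
  have hlog : Filter.Tendsto (fun x => -Real.log (S x)) l Filter.atTop :=
    Filter.tendsto_neg_atBot_atTop.comp (Real.tendsto_log_nhdsGT_zero.comp hS)
  by_cases ha : a = 0
  · have hu1 : u = 1 := by
      rw [ha] at hau
      nlinarith
    simp only [ha, hu1, zero_mul, zero_add, mul_one]
    exact hlog.const_mul_atTop hc
  · have h1 : Filter.Tendsto (fun x => a * (N x / S x)) l Filter.atTop := by
      have h2 : Filter.Tendsto (fun x => a * N x * (S x)⁻¹) l Filter.atTop :=
        (hN.const_mul a).pos_mul_atTop (mul_self_pos.mpr ha)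
          (tendsto_inv_nhdsGT_zero.comp hS)
      refine h2.congr fun x => ?_
      rw [div_eq_mul_inv, mul_assoc]
    refine Filter.tendsto_atTop_mono' l ?_ h1
    filter_upwards [hlog.eventually_ge_atTop 0] with x hx
    exact le_add_of_nonneg_right (mul_nonneg (mul_nonneg hc.le hu) hx)

/-- The direction θ₀ - π/2 gives node j the coefficients sin(θ₀ - θ_j) and (n-1) cos(θ₀ - θ_j).
Hence every term singular at q₀ tends to +∞, even when several are, and no cancellation occurs. -/
theorem tendsto_planar_boundary {n : ℕ} (hn : 2 ≤ n) {q₀ : ℝ × Real.Angle}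
    (hq₀ : (q₀ : Cylinder) ∉ Omega n) :
    Filter.Tendsto (fun q : ℝ × Real.Angle =>
      planar n (q₀.2.toReal - Real.pi / 2) q.1 q.2.toReal)
      (nhdsWithin q₀ {q : ℝ × Real.Angle | (q : Cylinder) ∈ Omega n}) Filter.atTop := by
  have hnR : (0 : ℝ) < n - 1 := by
    have : (2 : ℝ) ≤ n := by exact_mod_cast hn
    linarith
  set l := nhdsWithin q₀ {q : ℝ × Real.Angle | (q : Cylinder) ∈ Omega n} with hl
  have hS : ∀ j, Filter.Tendsto (fun q : ℝ × Real.Angle => q.1 - (q.2 - (node n j : Real.Angle)).cos)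
      l (nhds (q₀.1 - (q₀.2 - (node n j : Real.Angle)).cos)) := fun j =>
    (continuous_fst_sub_angle_cos (node n j)).continuousAt.mono_left nhdsWithin_le_nhds
  have hN : ∀ j, Filter.Tendsto (fun q : ℝ × Real.Angle => (q.2 - (node n j : Real.Angle)).sin)
      l (nhds (q₀.2 - (node n j : Real.Angle)).sin) := fun j =>
    (continuous_angle_sin_sub (node n j)).continuousAt.mono_left nhdsWithin_le_nhds
  have hpos : ∀ j < n, ∀ᶠ q : ℝ × Real.Angle in l,
      0 < q.1 - (q.2 - (node n j : Real.Angle)).cos := fun j hj => by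
    filter_upwards [self_mem_nhdsWithin] with q hq using coe_mem_Omega.mp hq j hj
  by_cases hneg : ∃ j < n, q₀.1 - (q₀.2 - (node n j : Real.Angle)).cos < 0
  · obtain ⟨j, hj, hlt⟩ := hneg
    -- Here q₀ lies outside the closure of the domain, so the limit is vacuous.
    have hbot : l = ⊥ := by
      rw [← Filter.eventually_false_iff_eq_bot]
      filter_upwards [hpos j hj, (hS j).eventually_lt_const hlt] with q h1 h2
      exact lt_asymm h1 h2
    rw [hbot]
    exact Filter.tendsto_bot
  push Not at hneg
  have hu : 0 ≤ q₀.1 := by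
    obtain ⟨j, hj, m, β, hβ, hθ⟩ := exists_near_node (n := n) (by omega) q₀.2.toReal
    have h1 := hneg j hj
    rw [← cos_toReal_sub, hθ, show β + node n j + m * (2 * Real.pi) - node n j =
      β + m * (2 * Real.pi) by ring, Real.cos_add_int_mul_two_pi] at h1
    have := cos_pi_div_le_cos (by omega) hβ
    have := cos_pi_div_nonneg hn
    linarith
  set g : ℕ → ℝ × Real.Angle → ℝ := fun j q => (q₀.2 - (node n j : Real.Angle)).sin *
    ((q.2 - (node n j : Real.Angle)).sin / (q.1 - (q.2 - (node n j : Real.Angle)).cos)) +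
    (n - 1) * (q₀.2 - (node n j : Real.Angle)).cos *
      -Real.log (q.1 - (q.2 - (node n j : Real.Angle)).cos) with hg
  have hsum : (fun q : ℝ × Real.Angle => planar n (q₀.2.toReal - Real.pi / 2) q.1 q.2.toReal) =
      fun q => ∑ j ∈ range n, g j q := by
    funext q
    simp only [planar, hg]
    refine sum_congr rfl fun j _ => ?_
    rw [show node n j - (q₀.2.toReal - Real.pi / 2) = Real.pi / 2 - (q₀.2.toReal - node n j) by ring,
      Real.cos_pi_div_two_sub, Real.sin_pi_div_two_sub]
    simp only [sin_toReal_sub, cos_toReal_sub]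
    ring
  have htop : ∀ j < n, q₀.1 - (q₀.2 - (node n j : Real.Angle)).cos = 0 →
      Filter.Tendsto (g j) l Filter.atTop := fun j hj h0 => by
    have h1 := hS j
    rw [h0] at h1
    have hcu : (q₀.2 - (node n j : Real.Angle)).cos = q₀.1 := by linarith
    refine tendsto_boundary_term hnR (hN j)
      (tendsto_nhdsWithin_iff.mpr ⟨h1, hpos j hj⟩) (hcu ▸ hu) ?_
    rw [add_comm]
    exact Real.Angle.cos_sq_add_sin_sq _
  have hbdd : ∀ j ∈ range n, ∃ C, ∀ᶠ q in l, C ≤ g j q := fun j hj => by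
    have hj' := mem_range.mp hj
    rcases (hneg j hj').eq_or_lt with h0 | h0
    · exact ⟨0, (htop j hj' h0.symm).eventually_ge_atTop 0⟩
    · have h1 := (((hN j).div (hS j) h0.ne').const_mul (q₀.2 - (node n j : Real.Angle)).sin).add
        (((hS j).log h0.ne').neg.const_mul ((n - 1) * (q₀.2 - (node n j : Real.Angle)).cos))
      exact ⟨_, (h1.eventually_const_lt (sub_one_lt _)).mono fun q hq => hq.le⟩
  choose! C hC using hbdd
  obtain ⟨i, hi, hi0⟩ : ∃ j < n, q₀.1 - (q₀.2 - (node n j : Real.Angle)).cos = 0 := by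
    rw [coe_mem_Omega] at hq₀
    push Not at hq₀
    obtain ⟨j, hj, hle⟩ := hq₀
    exact ⟨j, hj, le_antisymm hle (hneg j hj)⟩
  rw [hsum]
  refine Filter.tendsto_atTop_mono' l ?_
    (Filter.tendsto_atTop_add_const_right l (∑ j ∈ (range n).erase i, C j) (htop i hi hi0))
  filter_upwards [(Filter.eventually_all_finset (range n)).mpr hC] with q hq
  rw [← add_sum_erase _ _ (mem_range.mpr hi)]
  gcongr with j hj
  exact hq j (mem_of_mem_erase hj)

theorem abs_planar_le {n : ℕ} (hn : n ≠ 0) (ψ : ℝ) (p : ℝ × ℝ) :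
    |planar n ψ p.1 p.2| ≤ 2 * n ^ 2 * ‖polarSurface n p‖ := by
  obtain ⟨-, h2, h3⟩ := polarSurface_apply n p
  have hn2 : (0 : ℝ) < (n : ℝ) ^ 2 := by positivity
  have b2 := norm_le_pi_norm (polarSurface n p) 1
  have b3 := norm_le_pi_norm (polarSurface n p) 2
  rw [h2, norm_neg, norm_mul, norm_inv, Real.norm_of_nonneg hn2.le, inv_mul_le_iff₀ hn2,
    Real.norm_eq_abs] at b2
  rw [h3, norm_neg, norm_mul, norm_inv, Real.norm_of_nonneg hn2.le, inv_mul_le_iff₀ hn2,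
    Real.norm_eq_abs] at b3
  rw [planar_eq_comb]
  refine (abs_sub _ _).trans ?_
  rw [abs_mul, abs_mul]
  have c1 := mul_le_of_le_one_left (abs_nonneg (planar n 0 p.1 p.2)) (Real.abs_cos_le_one ψ)
  have c2 := mul_le_of_le_one_left (abs_nonneg (planar n (-(Real.pi / 2)) p.1 p.2))
    (Real.abs_sin_le_one ψ)
  linarith

/-- `Cylinder` is compact, so the preimage of K need only be closed in it. Limit points inside Ω_n
are handled by continuity; outside Ω_n, the blow-up of `planar` contradicts the boundedness of K. -/
theorem isProperMap_extendedSurface {n : ℕ} (hn : 2 ≤ n) : IsProperMap (extendedSurface n) := by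
  refine isProperMap_iff_isCompact_preimage.mpr ⟨continuous_extendedSurface hn, fun K hK => ?_⟩
  rw [Subtype.isCompact_iff]
  refine IsClosed.isCompact ?_
  have himg : Subtype.val '' (extendedSurface n ⁻¹' K) = {p | extension n p ∈ K ∧ p ∈ Omega n} := by
    ext p
    constructor
    · rintro ⟨⟨q, hq⟩, h, rfl⟩
      exact ⟨h, hq⟩
    · rintro ⟨h, hp⟩
      exact ⟨⟨p, hp⟩, h, rfl⟩
  rw [himg, ← closure_subset_iff_isClosed]
  intro p hp
  rw [mem_closure_iff_frequently] at hp
  by_cases hΩ : p ∈ Omega n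
  · exact ⟨hK.isClosed.mem_of_frequently_of_tendsto (frequently_nhdsWithin_iff.mpr hp)
      (continuousWithinAt_extension hn hΩ), hΩ⟩
  · exfalso
    induction p using OnePoint.rec with
    | infty => exact hΩ (Set.mem_insert _ _)
    | coe q₀ =>
      rw [nhds_coe_eq, Filter.frequently_map] at hp
      obtain ⟨R, hR⟩ := hK.isBounded.exists_norm_le
      have hev := (tendsto_planar_boundary hn hΩ).eventually_gt_atTop (2 * n ^ 2 * R)
      obtain ⟨q, hqK, hq⟩ := ((frequently_nhdsWithin_iff.mpr hp).and_eventually hev).exists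
      have h1 := hR _ hqK
      rw [extension_coe] at h1
      have h2 := (le_abs_self _).trans
        (abs_planar_le (n := n) (by omega) (q₀.2.toReal - Real.pi / 2) (q.1, q.2.toReal))
      have h3 : 2 * (n : ℝ) ^ 2 * ‖polarSurface n (q.1, q.2.toReal)‖ ≤ 2 * n ^ 2 * R := by gcongr
      simp only at h2
      linarith

theorem isProperEmbedding_extendedSurface {n : ℕ} (hn : 2 ≤ n) :
    IsProperEmbedding (extendedSurface n) := by
  have hp := isProperMap_extendedSurface hn
  exact ⟨isImmersive_extendedSurface hn, (Topology.IsClosedEmbedding.of_continuous_injective_isClosedMap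
    hp.continuous (injective_extendedSurface hn) hp.isClosedMap).isEmbedding, hp⟩

end JorgeMeeks
end

theorem mainTheorem1 (n : ℕ) (hn : 2 ≤ n) :
    ∃ f : JorgeMeeks.Omega n → JorgeMeeks.MinkowskiSpace,
      JorgeMeeks.IsAnalyticExtension f ∧
      (∀ f' : JorgeMeeks.Omega n → JorgeMeeks.MinkowskiSpace,
        JorgeMeeks.IsAnalyticExtension f' → f' = f) ∧
      JorgeMeeks.IsProperEmbedding f :=
  have hf := JorgeMeeks.isAnalyticExtension_extendedSurface hn
  ⟨JorgeMeeks.extendedSurface n, hf, fun _ hf' => hf.unique (by omega) hf',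
    JorgeMeeks.isProperEmbedding_extendedSurface hn⟩
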